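/- **Setting.** Let $F$ be a $p$-adic field (a finite extension of $\mathbb{Q}_p$) with $p\neq 2$, ring of integers $\mathcal{O}_F$, residue field $\mathfrak{k}$ of order $q=p^f$, normalized valuation $v_F$ and a fixed uniformizer $\varpi$. Let $E$ be an algebraically closed field of characteristic $p$ with a fixed embedding $\mathfrak{k}\hookrightarrow E$. Let $(a,b)_F\in\mu_2=\{\pm1\}$ be the quadratic Hilbert symbol of $F$: it is $1$ if the reduction in $\mathfrak k^\times$ of $(-1)^{v_F(a)v_F(b)}\,b^{v_F(a)}/a^{v_F(b)}$ is a square and $-1$ otherwise. **The group.** For $g=\begin{pmatrix}a&b\\c&d\end{pmatrix}\in GL_2(F)$ put $X(g)=c$ if $c\ne0$ and $X(g)=d$ if $c=0$. Let $\widetilde{GL}_2(F)$ be the set $GL_2(F)\times\mu_2$ with the multiplication $(g,\zeta)(g',\zeta')=(gg',\zeta\zeta'\Delta(g,g'))$, where $$\Delta(g,g')=\left(\tfrac{X(gg')}{X(g)},\tfrac{X(gg')}{X(g')}\right)_F\left(\det g,\tfrac{X(gg')}{X(g)}\right)_F,$$ and let $\widetilde{G}=\widetilde{SL}_2(F)$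 be the subgroup of the $(g,\zeta)$ with $\det g=1$ (the metaplectic group). Let $K=SL_2(\mathcal{O}_F)$, and for $k\in K$ with bottom row $(c,d)$ let $\theta(k)=1$ if $c=0$ or $c\in\mathcal{O}_F^\times$, and $\theta(k)=(c,d)_F$ otherwise. Then $k\mapsto(k,\theta(k))$ is a homomorphism $K\to\widetilde{G}$; let $K^*$ be its image. $\widetilde{G}$ carries the group topology for which $K^*$, with the topology of $K$, is an open subgroup. Let $\widetilde{K}\cong K^*\times\mu_2$ be the preimage of $K$ in $\widetilde{G}$, let $\tilde\alpha=(\mathrm{diag}(1,\varpi),1)\in\widetilde{GL}_2(F)$, and let $\widetilde{K}'=\tilde\alpha\widetilde{K}\tilde\alpha^{-1}\subset\widetilde G$. Let $\tilde h(\varpi)=\tilde w(\varpi)\tilde w(-1)$, where $\tilde w(x)=\left(\begin{pmatrix}0&x\\-x^{-1}&0\end{pmatrix},1\right)$. **Weights.** For $\vec r=(r_0,\dots,r_{f-1})\in\{0,\dots,p-1\}^f$ let $\sigma_{\vec r}=\bigotimes_{i=0}^{f-1}(\mathrm{Sym}^{r_i}E^2)^{\mathrm{Fr}^i}$, a representation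 of $SL_2(\mathfrak{k})$ inflated to $K$, where $\mathrm{Fr}^i$ denotes the twist by $x\mapsto x^{p^i}$ on $\mathfrak{k}$. Let $\tilde\sigma_{\vec r}$ be the representation of $\widetilde{K}$ on which $(k,\theta(k)\zeta)$ acts as $\zeta\,\sigma_{\vec r}(k)$, and let $\tilde\sigma_{\vec r}^{\tilde\alpha}(h)=\tilde\sigma_{\vec r}(\tilde\alpha^{-1}h\tilde\alpha)$, a representation of $\widetilde{K}'$. Writing $x,y$ for the standard basis of $E^2$, let $\rho_{\vec r}=\bigotimes_i\rho_{r_i}$ be the endomorphism of the space of $\sigma_{\vec r}$ where $\rho_{r_i}$ fixes $x^{r_i}$ and kills $x^{r_i-j}y^j$ for $j>0$ (the projection onto the highest weight line). **Cokernel modules.** For an open compact subgroup $H\subset\widetilde{G}$ and a representation $\sigma$ of $H$, let $\mathrm{ind}_H^{\widetilde{G}}\sigma$ be the space of compactly supported functions $\phi$ on $\widetilde{G}$, with values in the space of $\sigma$, such that $\phi(hg)=\sigma(h)\phi(g)$ for $h\in H$, with $\widetilde{G}$ acting by right translation. Let $\varphi^{\vec r}$ be the function on $\widetilde{G}$ with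 values in the endomorphisms of $\sigma_{\vec r}$ that is supported on $\widetilde{K}\tilde h(\varpi)^{-1}\widetilde{K}$ and satisfies $\varphi^{\vec r}(k\,\tilde h(\varpi)^{-1}k')=\tilde\sigma_{\vec r}(k)\,\rho_{\vec r}\,\tilde\sigma_{\vec r}(k')$ for $k,k'\in\widetilde{K}$, and let $\mathcal{T}^{\vec r}$ be the $\widetilde{G}$-equivariant operator on $\mathrm{ind}_{\widetilde{K}}^{\widetilde{G}}\tilde\sigma_{\vec r}$ given by $$(\mathcal{T}^{\vec r}\phi)(g)=\sum_{x\in\widetilde{K}\backslash\widetilde{G}}\varphi^{\vec r}(gx^{-1})\,\phi(x).$$ Let $\Phi:\mathrm{ind}_{\widetilde{K}}^{\widetilde{G}}\tilde\sigma_{\vec r}\to\mathrm{ind}_{\widetilde{K}'}^{\widetilde{G}}\tilde\sigma_{\vec r}^{\tilde\alpha}$ be the linear isomorphism $\Phi(\phi)(g)=\phi(\tilde\alpha^{-1}g\tilde\alpha)$, and put $\mathcal{T}^{\tilde\alpha,\vec r}=\Phi\circ\mathcal{T}^{\vec r}\circ\Phi^{-1}$. For $\lambda\in E$ set $$\pi(\vec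 r,\lambda)=\frac{\mathrm{ind}_{\widetilde{K}}^{\widetilde{G}}\tilde\sigma_{\vec r}}{(\mathcal{T}^{\vec r}-\lambda)},\qquad \pi'(\vec r,\lambda)=\frac{\mathrm{ind}_{\widetilde{K}'}^{\widetilde{G}}\tilde\sigma_{\vec r}^{\tilde\alpha}}{(\mathcal{T}^{\tilde\alpha,\vec r}-\lambda)}.$$ A representation $\rho$ of $\widetilde{G}$ on an $E$-vector space is *genuine* if $(1,\zeta)$ acts as the scalar $\zeta$ for $\zeta\in\mu_2$, *smooth* if the stabilizer of every vector is open, and *admissible* if the subspace of vectors fixed by any open subgroup is finite-dimensional. A pair $(\vec r,\lambda)\in\{0,\dots,p-1\}^f\times E$ is a *parameter* of $\rho$ with respect to $\widetilde{K}$ (respectively $\widetilde{K}'$) if $\rho$ is a quotient of $\pi(\vec r,\lambda)$ (respectively $\pi'(\vec r,\lambda)$). **Proposition.** Let $\rho$ be a smooth, genuine, irreducible, admissible representation of $\widetilde{G}$ over $E$. Then $\rho$ has a parameter with respect to each of $\widetilde{K}$ and $\widetilde{K}'$: there are $\vec r,\vec s\in\{0,\dots,p-1\}^f$ and $\lambda,\lambda'\in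 E$ such that $\rho$ is a quotient of $\pi(\vec r,\lambda)$ and a quotient of $\pi'(\vec s,\lambda')$. -/

import Mathlib

set_option linter.unusedSectionVars false

open scoped ValuativeRel

namespace MetaplecticSL2

section Symbol

variable {F : Type*} [Field F] [ValuativeRel F] [TopologicalSpace F] [IsNonarchimedeanLocalField F]

/-- The normalized valuation `v_F : Fˣ → ℤ`, written additively: uniformizers have valuation `1`. -/
noncomputable def ord (x : Fˣ) : ℤ :=
  -WithZero.log (IsNonarchimedeanLocalField.valueGroupWithZeroIsoInt F
    (ValuativeRel.valuation F (x : F)))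

/-- Reduction `𝒪_F → 𝔨` (extended by zero outside `𝒪_F`). -/
noncomputable def red (x : F) : 𝓀[F] :=
  open Classical in if h : x ∈ 𝒪[F] then IsLocalRing.residue 𝒪[F] ⟨x, h⟩ else 0

/-- The unit `(-1)^{v(a)v(b)} b^{v(a)} / a^{v(b)}` of `𝒪_F`. -/
noncomputable def tameUnit (a b : Fˣ) : Fˣ :=
  (-1) ^ (ord a * ord b) * (b ^ ord a / a ^ ord b)

/-- The quadratic character of the reduction of a unit `u` of `𝒪_F`. For odd residue characteristic,
by Euler's criterion, this is `ω(u)^{(q-1)/2}` where `ω(u)` is the Teichmüller part of `u`. -/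
noncomputable def unitSign (u : Fˣ) : ℤˣ :=
  open Classical in if IsSquare (red (u : F)) then 1 else -1

/-- The quadratic Hilbert symbol `(a, b)_F ∈ μ₂`. In odd residue characteristic it is tame, and this
is the formula for the tame symbol. -/
noncomputable def hilbert (a b : Fˣ) : ℤˣ := unitSign (tameUnit a b)

theorem ord_mul (x y : Fˣ) : ord (x * y) = ord x + ord y := by
  simp only [ord, Units.val_mul, map_mul]
  rw [WithZero.log_mul (by simp) (by simp)]
  ring

theorem ord_one : ord (1 : Fˣ) = 0 := by simp [ord]

theorem ord_inv (x : Fˣ) : ord x⁻¹ = -ord x := by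
  have := ord_mul x x⁻¹
  rw [mul_inv_cancel, ord_one] at this
  omega

theorem ord_zpow (x : Fˣ) (n : ℤ) : ord (x ^ n) = n * ord x := by
  have := map_zpow (MonoidHom.mk' (fun x : Fˣ => Multiplicative.ofAdd (ord x))
    (fun a b => by rw [ord_mul]; rfl)) x n
  have h := congrArg Multiplicative.toAdd this
  simpa using h

theorem ord_neg (x : Fˣ) : ord (-x) = ord x := by simp [ord]

theorem ord_nonneg_iff (x : Fˣ) : 0 ≤ ord x ↔ (x : F) ∈ 𝒪[F] := by
  rw [Valuation.mem_integer_iff, ord, neg_nonneg, ← WithZero.log_one (M := ℤ),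
    WithZero.log_le_log (by simp) (by simp)]
  rw [← map_one (IsNonarchimedeanLocalField.valueGroupWithZeroIsoInt F)]
  exact OrderIsoClass.map_le_map_iff _

theorem red_of_mem {x : F} (h : x ∈ 𝒪[F]) : red x = IsLocalRing.residue 𝒪[F] ⟨x, h⟩ := by
  simp [red, h]

theorem red_coe (x : 𝒪[F]) : red (x : F) = IsLocalRing.residue 𝒪[F] x := red_of_mem x.2

theorem red_mul {x y : F} (hx : x ∈ 𝒪[F]) (hy : y ∈ 𝒪[F]) : red (x * y) = red x * red y := by
  rw [red_of_mem hx, red_of_mem hy, red_of_mem (mul_mem hx hy), ← map_mul]; rfl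

theorem red_one : red (1 : F) = 1 := by
  rw [red_of_mem (one_mem _)]; exact map_one _

theorem mem_of_ord_eq {u : Fˣ} (hu : ord u = 0) : (u : F) ∈ 𝒪[F] :=
  (ord_nonneg_iff u).1 hu.ge

theorem red_ne_zero {u : Fˣ} (hu : ord u = 0) : red (u : F) ≠ 0 := by
  intro h
  have h1 := red_mul (mem_of_ord_eq hu) (mem_of_ord_eq (u := u⁻¹) (by rw [ord_inv, hu, neg_zero]))
  rw [h, zero_mul] at h1
  simp [red_one] at h1

/-- A nonzero element of positive valuation reduces to `0`. -/
theorem red_eq_zero {x : Fˣ} (hx : 0 < ord x) : red (x : F) = 0 := by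
  have hm := (ord_nonneg_iff x).1 hx.le
  rw [red_of_mem hm, IsLocalRing.residue_eq_zero_iff, IsLocalRing.mem_maximalIdeal, mem_nonunits_iff]
  rintro ⟨w, hw⟩
  have h1 : ((w⁻¹ : (𝒪[F])ˣ) : 𝒪[F]) * ⟨(x : F), hm⟩ = 1 := by rw [← hw]; simp
  have h2 : (((w⁻¹ : (𝒪[F])ˣ) : 𝒪[F]) : F) * x = 1 := congrArg Subtype.val h1
  have h3 : (((w⁻¹ : (𝒪[F])ˣ) : 𝒪[F]) : F) = ((x⁻¹ : Fˣ) : F) := by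
    rw [Units.val_inv_eq_inv_val]; exact eq_inv_of_mul_eq_one_left h2
  have h4 : ((x⁻¹ : Fˣ) : F) ∈ 𝒪[F] := h3 ▸ Subtype.property _
  have := (ord_nonneg_iff _).2 h4
  rw [ord_inv] at this
  omega

theorem unitSign_mul {u w : Fˣ} (hu : ord u = 0) (hw : ord w = 0) :
    unitSign (u * w) = unitSign u * unitSign w := by
  classical
  have := Fintype.ofFinite 𝓀[F]
  have key : ∀ z : Fˣ, ord z = 0 → ((unitSign z : ℤˣ) : ℤ) = quadraticChar 𝓀[F] (red (z : F)) := by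
    intro z hz
    rw [unitSign]
    split_ifs with h
    · rw [(quadraticChar_one_iff_isSquare (red_ne_zero hz)).2 h]; rfl
    · rcases quadraticChar_dichotomy (red_ne_zero hz) with h' | h'
      · exact absurd ((quadraticChar_one_iff_isSquare (red_ne_zero hz)).1 h') h
      · rw [h']; rfl
  apply Units.ext
  rw [Units.val_mul, key u hu, key w hw, key (u * w) (by rw [ord_mul, hu, hw, add_zero]),
    Units.val_mul, red_mul (mem_of_ord_eq hu) (mem_of_ord_eq hw), map_mul]

theorem unitSign_eq_one {u : Fˣ} (hu : red (u : F) = 1) : unitSign u = 1 := by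
  rw [unitSign, if_pos]; rw [hu]; exact IsSquare.one

theorem unitSign_one : unitSign (1 : Fˣ) = 1 := unitSign_eq_one (by simp [red_one])

theorem unitSign_inv {u : Fˣ} (hu : ord u = 0) : unitSign u⁻¹ = unitSign u := by
  have h := unitSign_mul hu (w := u⁻¹) (by rw [ord_inv, hu, neg_zero])
  rw [mul_inv_cancel, unitSign_one] at h
  rw [← Int.units_inv_eq_self (unitSign u)]
  exact (inv_eq_of_mul_eq_one_right h.symm).symm

theorem ord_tameUnit (a b : Fˣ) : ord (tameUnit a b) = 0 := by
  rw [tameUnit, ord_mul, div_eq_mul_inv, ord_mul, ord_inv, ord_zpow, ord_zpow, ord_zpow, ord_neg,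
    ord_one]
  ring

theorem hilbert_mul_left (a a' b : Fˣ) : hilbert (a * a') b = hilbert a b * hilbert a' b := by
  rw [hilbert, hilbert, hilbert, ← unitSign_mul (ord_tameUnit a b) (ord_tameUnit a' b)]
  congr 1
  simp only [tameUnit, ord_mul, add_mul, zpow_add, mul_zpow, div_eq_mul_inv, mul_inv]
  ac_rfl

theorem hilbert_symm (a b : Fˣ) : hilbert a b = hilbert b a := by
  rw [hilbert, hilbert, ← unitSign_inv (ord_tameUnit a b)]
  congr 1
  simp only [tameUnit, mul_inv, ← inv_zpow, inv_neg_one, inv_div, mul_comm (ord a)]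

theorem hilbert_mul_right (a b b' : Fˣ) : hilbert a (b * b') = hilbert a b * hilbert a b' := by
  rw [hilbert_symm, hilbert_mul_left, hilbert_symm b, hilbert_symm b']

theorem hilbert_one_left (b : Fˣ) : hilbert 1 b = 1 := by
  have := hilbert_mul_left 1 1 b
  rwa [one_mul, left_eq_mul] at this

theorem hilbert_one_right (b : Fˣ) : hilbert b 1 = 1 := by rw [hilbert_symm, hilbert_one_left]

theorem hilbert_inv_left (a b : Fˣ) : hilbert a⁻¹ b = hilbert a b := by
  have := hilbert_mul_left a a⁻¹ b
  rw [mul_inv_cancel, hilbert_one_left] at this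
  rw [← Int.units_inv_eq_self (hilbert a b)]
  exact (inv_eq_of_mul_eq_one_right this.symm).symm

theorem hilbert_inv_right (a b : Fˣ) : hilbert a b⁻¹ = hilbert a b := by
  rw [hilbert_symm, hilbert_inv_left, hilbert_symm]

theorem hilbert_self_neg (a : Fˣ) : hilbert a (-a) = 1 := by
  rw [hilbert]
  convert unitSign_one (F := F)
  rw [tameUnit, ord_neg, ← div_zpow, neg_div, div_self', ← zpow_add]
  exact Even.neg_one_zpow (Int.even_mul_succ_self (ord a) |> fun h => by rwa [mul_add, mul_one] at h)

theorem hilbert_unit_unit {a b : Fˣ} (ha : ord a = 0) (hb : ord b = 0) : hilbert a b = 1 := by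
  rw [hilbert, tameUnit, ha, hb]; simp [unitSign_one]

/-- A principal unit pairs trivially with everything. -/
theorem hilbert_principal {a b : Fˣ} (hb : red (b : F) = 1) (hb' : ord b = 0) : hilbert a b = 1 := by
  rw [hilbert, tameUnit, hb', mul_zero, zpow_zero, zpow_zero, one_mul, div_one]
  have h : ∀ n : ℕ, unitSign (b ^ n) = 1 := by
    intro n
    induction n with
    | zero => simp [unitSign_one]
    | succ n ih =>
      rw [pow_succ, unitSign_mul _ hb', ih, unitSign_eq_one hb, one_mul]
      rw [← zpow_natCast, ord_zpow, hb', mul_zero]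
  rcases Int.eq_nat_or_neg (ord a) with ⟨n, hn | hn⟩
  · rw [hn, zpow_natCast, h]
  · rw [hn, zpow_neg, zpow_natCast, unitSign_inv, h]
    rw [← zpow_natCast, ord_zpow, hb', mul_zero]

theorem red_one_sub {x : Fˣ} (hx : 0 < ord x) {y : F} (h : y = 1 - x) : red y = 1 := by
  have hm := (ord_nonneg_iff x).1 hx.le
  have hy : y ∈ 𝒪[F] := h ▸ sub_mem (one_mem _) hm
  have h1 : IsLocalRing.residue 𝒪[F] ⟨(x : F), hm⟩ = 0 := by rw [← red_of_mem hm, red_eq_zero hx]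
  rw [red_of_mem hy]
  have : (⟨y, hy⟩ : 𝒪[F]) = 1 - ⟨(x : F), hm⟩ := Subtype.ext h
  rw [this, map_sub, map_one, h1, sub_zero]

theorem ord_one_sub {x y : Fˣ} (hx : 0 < ord x) (h : (y : F) = 1 - x) : ord y = 0 := by
  have hr := red_one_sub hx h
  have hy : 0 ≤ ord y := (ord_nonneg_iff y).2
    (h ▸ sub_mem (one_mem _) ((ord_nonneg_iff x).1 hx.le))
  rcases hy.eq_or_lt with h' | h'
  · exact h'.symm
  · rw [red_eq_zero h'] at hr; exact absurd hr zero_ne_one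

/-- The Steinberg relation. -/
theorem hilbert_steinberg {a b : Fˣ} (h : (a : F) + b = 1) : hilbert a b = 1 := by
  rcases lt_trichotomy (ord a) 0 with ha | ha | ha
  · -- then `-b/a = 1 - 1/a` is a principal unit
    have h1 : ((-b * a⁻¹ : Fˣ) : F) = 1 - (a⁻¹ : Fˣ) := by
      push_cast
      rw [eq_sub_of_add_eq' h]
      field_simp
      ring
    have h0 : 0 < ord a⁻¹ := by rw [ord_inv]; omega
    have h2 := hilbert_principal (a := a) (red_one_sub h0 h1) (ord_one_sub h0 h1)
    rw [← mul_one (hilbert a b), ← hilbert_self_neg a, ← hilbert_mul_right,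
      
      show b * -a = (-b * a⁻¹) * (a * a) by
        rw [mul_assoc, inv_mul_cancel_left]; simp,
      hilbert_mul_right, h2, one_mul, hilbert_self_neg, hilbert_mul_right]
    exact Int.units_mul_self _
  · have hb : 0 ≤ ord b := by
      rw [ord_nonneg_iff, eq_sub_of_add_eq' h]
      exact sub_mem (one_mem _) (mem_of_ord_eq ha)
    rcases hb.eq_or_lt with hb | hb
    · exact hilbert_unit_unit ha hb.symm
    · have h1 : (a : F) = 1 - b := eq_sub_of_add_eq h
      rw [hilbert_symm]
      exact hilbert_principal (red_one_sub hb h1) (ord_one_sub hb h1)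
  · have h1 : (b : F) = 1 - a := eq_sub_of_add_eq' h
    exact hilbert_principal (red_one_sub ha h1) (ord_one_sub ha h1)

end Symbol

section Cover

variable (F : Type*) [Field F] [ValuativeRel F] [TopologicalSpace F] [IsNonarchimedeanLocalField F]

variable {F}

theorem bottom_row_ne_zero {R : Type*} [Field R] (g : GL (Fin 2) R) (h : g.1 1 0 = 0) : g.1 1 1 ≠ 0 := by
  intro h'
  have := g.det_ne_zero
  rw [Matrix.det_fin_two, h, h'] at this
  simp at this

/-- `X(g) = c` if `c ≠ 0` and `X(g) = d` if `c = 0`, where `(c, d)` is the bottom row of `g`. -/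
noncomputable def bottomEntry {R : Type*} [Field R] (g : GL (Fin 2) R) : Rˣ :=
  open Classical in
  if h : g.1 1 0 = 0 then Units.mk0 (g.1 1 1) (bottom_row_ne_zero g h) else Units.mk0 (g.1 1 0) h

/-- The Kubota cocycle
`Δ(g, g') = (X(gg')/X(g), X(gg')/X(g'))_F · (det g, X(gg')/X(g))_F`. -/
noncomputable def cocycle (g g' : GL (Fin 2) F) : ℤˣ :=
  hilbert (bottomEntry (g * g') / bottomEntry g) (bottomEntry (g * g') / bottomEntry g') *
    hilbert (Matrix.GeneralLinearGroup.det g) (bottomEntry (g * g') / bottomEntry g)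

theorem bottomEntry_val {R : Type*} [Field R] [DecidableEq R] (g : GL (Fin 2) R) :
    (bottomEntry g : R) = if g.1 1 0 = 0 then g.1 1 1 else g.1 1 0 := by
  rw [bottomEntry]; split_ifs <;> simp_all

theorem bottomEntry_of_zero {R : Type*} [Field R] {g : GL (Fin 2) R} (h : g.1 1 0 = 0) :
    (bottomEntry g : R) = g.1 1 1 := by
  classical rw [bottomEntry_val, if_pos h]

theorem bottomEntry_of_ne {R : Type*} [Field R] {g : GL (Fin 2) R} (h : g.1 1 0 ≠ 0) :
    (bottomEntry g : R) = g.1 1 0 := by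
  classical rw [bottomEntry_val, if_neg h]

theorem bottomEntry_one {R : Type*} [Field R] : bottomEntry (1 : GL (Fin 2) R) = 1 := by
  apply Units.ext; rw [bottomEntry_of_zero] <;> simp

theorem cocycle_one_left (g : GL (Fin 2) F) : cocycle 1 g = 1 := by
  simp [cocycle, hilbert_one_left, hilbert_one_right]

theorem cocycle_one_right (g : GL (Fin 2) F) : cocycle g 1 = 1 := by
  simp [cocycle, hilbert_one_left, hilbert_one_right]

theorem bottomEntry_relation {R : Type*} [Field R] (g₁ g₂ g₃ : GL (Fin 2) R) :
    let A : R := g₂.1.det * bottomEntry g₁ * bottomEntry g₃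
    let B : R := bottomEntry (g₁ * g₂ * g₃) * bottomEntry g₂
    let C : R := bottomEntry (g₁ * g₂) * bottomEntry (g₂ * g₃)
    A = C ∨ B = C ∨ A = -B ∨ A + B = C := by
  classical
  intro A B C
  have d1 := g₁.det_ne_zero
  have d2 := g₂.det_ne_zero
  have d3 := g₃.det_ne_zero
  simp only [A, B, C, bottomEntry_val, Units.val_mul, Matrix.det_fin_two, Matrix.mul_apply, Fin.sum_univ_two] at *
  clear A B C
  generalize g₁.1 0 0 = a1 at *
  generalize g₁.1 0 1 = b1 at *
  generalize g₁.1 1 0 = c1 at *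
  generalize g₁.1 1 1 = e1 at *
  generalize g₂.1 0 0 = a2 at *
  generalize g₂.1 0 1 = b2 at *
  generalize g₂.1 1 0 = c2 at *
  generalize g₂.1 1 1 = e2 at *
  generalize g₃.1 0 0 = a3 at *
  generalize g₃.1 0 1 = b3 at *
  generalize g₃.1 1 0 = c3 at *
  generalize g₃.1 1 1 = e3 at *
  by_cases h1 : c1 = 0
  · have he : e1 ≠ 0 := by rintro rfl; simp [h1] at d1
    right; left
    subst h1
    have r : e1 * c2 * a3 + e1 * e2 * c3 = e1 * (c2 * a3 + e2 * c3) := by ring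
    simp only [zero_mul, zero_add]
    rw [r]
    simp only [mul_eq_zero, he, false_or]
    split_ifs <;> ring
  by_cases h3 : c3 = 0
  · subst h3
    have ha : a3 ≠ 0 := by rintro rfl; simp at d3
    have he : e3 ≠ 0 := by rintro rfl; simp at d3
    simp only [mul_zero, add_zero, mul_eq_zero, ha, or_false, h1, if_false, if_true]
    by_cases h12 : c1 * a2 + e1 * c2 = 0
    · simp only [h12, if_true]
      by_cases h2 : c2 = 0
      · have : a2 = 0 := by simpa [h2, h1] using h12
        simp [h2, this] at d2
      · simp only [h2, if_false]
        right; right; left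
        linear_combination (e2 * e3) * h12
    · simp only [h12, if_false]
      by_cases h2 : c2 = 0
      · subst h2
        left
        simp only [if_true]
        ring
      · simp only [h2, if_false]
        right; left
        ring
  by_cases h2 : c2 = 0
  · subst h2
    have ha : a2 ≠ 0 := by rintro rfl; simp at d2
    have he : e2 ≠ 0 := by rintro rfl; simp at d2
    left
    simp only [h1, h3, if_false, mul_zero, add_zero, zero_mul, zero_add, mul_eq_zero, ha, he, or_self]
    ring
  simp only [h1, h2, h3, if_false]
  by_cases h12 : c1 * a2 + e1 * c2 = 0
  · right; right; left
    have hn : c1 * b2 + e1 * e2 ≠ 0 := by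
      intro h
      apply h1
      have : c1 * (a2 * e2 - b2 * c2) = 0 := by linear_combination e2 * h12 - c2 * h
      exact (mul_eq_zero.1 this).resolve_right d2
    simp only [h12, zero_mul, zero_add, mul_eq_zero, hn, h3, or_self, if_false]
    linear_combination (e2 * c3) * h12
  by_cases h23 : c2 * a3 + e2 * c3 = 0
  · right; right; left
    have r : (c1 * a2 + e1 * c2) * a3 + (c1 * b2 + e1 * e2) * c3 = c1 * (a2 * a3 + b2 * c3) := by
      linear_combination e1 * h23
    have hn : a2 * a3 + b2 * c3 ≠ 0 := by
      intro h
      apply h3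
      have : c3 * (a2 * e2 - b2 * c2) = 0 := by linear_combination a2 * h23 - c2 * h
      exact (mul_eq_zero.1 this).resolve_right d2
    simp only [r, mul_eq_zero, h1, hn, or_self, if_false]
    linear_combination (a2 * c1) * h23
  by_cases h123 : (c1 * a2 + e1 * c2) * a3 + (c1 * b2 + e1 * e2) * c3 = 0
  · left
    simp only [h12, h23, if_false]
    linear_combination (-c2) * h123
  · right; right; right
    simp only [h12, h23, h123, if_false]
    ring

theorem hilbert_of_relation {A B C : Fˣ}
    (h : (A : F) = C ∨ (B : F) = C ∨ (A : F) = -B ∨ (A : F) + B = C) :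
    hilbert C (-(A * B)) = hilbert A B := by
  rcases h with h | h | h | h
  · rw [← Units.ext h, ← neg_mul, hilbert_mul_right, hilbert_self_neg, one_mul]
  · rw [← Units.ext h, mul_comm A, ← neg_mul, hilbert_mul_right, hilbert_self_neg, one_mul, hilbert_symm]
  · have h' : A = -B := Units.ext h
    rw [h', hilbert_symm (-B), hilbert_self_neg, neg_mul, neg_neg, hilbert_mul_right]
    exact Int.units_mul_self _
  · have h1 : hilbert (A / C) (B / C) = 1 := hilbert_steinberg (by
      push_cast
      rw [← add_div, h, div_self C.ne_zero])
    rw [div_eq_mul_inv, div_eq_mul_inv, hilbert_mul_left, hilbert_mul_right, hilbert_mul_right,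
      hilbert_inv_left, hilbert_inv_left, hilbert_inv_right, hilbert_inv_right] at h1
    have h2 : hilbert C C = hilbert C (-1) := by
      have := hilbert_self_neg C
      rw [← neg_one_mul, hilbert_mul_right] at this
      rw [← Int.units_inv_eq_self (hilbert C (-1))]
      exact eq_inv_of_mul_eq_one_right this
    rw [h2, hilbert_symm A C] at h1
    rw [← neg_one_mul, hilbert_mul_right, hilbert_mul_right, ← Int.units_inv_eq_self (hilbert A B)]
    apply eq_inv_of_mul_eq_one_right
    rw [← h1]
    ac_rfl

theorem cocycle_identity (g₁ g₂ g₃ : GL (Fin 2) F) :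
    cocycle g₁ g₂ * cocycle (g₁ * g₂) g₃ = cocycle g₁ (g₂ * g₃) * cocycle g₂ g₃ := by
  have key := hilbert_of_relation (F := F)
    (A := Matrix.GeneralLinearGroup.det g₂ * bottomEntry g₁ * bottomEntry g₃)
    (B := bottomEntry (g₁ * g₂ * g₃) * bottomEntry g₂)
    (C := bottomEntry (g₁ * g₂) * bottomEntry (g₂ * g₃)) (bottomEntry_relation g₁ g₂ g₃)
  simp only [cocycle, map_mul, mul_assoc g₁] at *
  generalize bottomEntry g₁ = x1 at *
  generalize bottomEntry g₂ = x2 at *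
  generalize bottomEntry g₃ = x3 at *
  generalize bottomEntry (g₁ * g₂) = x12 at *
  generalize bottomEntry (g₂ * g₃) = x23 at *
  generalize bottomEntry (g₁ * (g₂ * g₃)) = x123 at *
  generalize Matrix.GeneralLinearGroup.det g₁ = D1 at *
  generalize Matrix.GeneralLinearGroup.det g₂ = D2 at *
  have sq : ∀ x : Fˣ, hilbert x x = hilbert x (-1) := by
    intro C
    have := hilbert_self_neg C
    rw [← neg_one_mul, hilbert_mul_right] at this
    rw [← Int.units_inv_eq_self (hilbert C (-1))]
    exact eq_inv_of_mul_eq_one_right this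
  -- pass to additive notation, with values in `ZMod 2`
  let e : ℤˣ → ZMod 2 := fun u => if u = 1 then 0 else 1
  have e_mul : ∀ u w : ℤˣ, e (u * w) = e u + e w := by decide
  have e_inj : ∀ u w : ℤˣ, e u = e w → u = w := by decide
  rw [← neg_one_mul] at key
  simp only [div_eq_mul_inv, hilbert_mul_left, hilbert_mul_right, hilbert_inv_left, hilbert_inv_right] at key ⊢
  apply e_inj
  have key' := congrArg e key
  simp only [sq, e_mul] at key' ⊢
  rw [hilbert_symm x12 x1, hilbert_symm x12 D2, hilbert_symm x23 D2, hilbert_symm x23 x1,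
    hilbert_symm x23 x2, hilbert_symm x3 x2] at key'
  rw [hilbert_symm x3 x123] at key'
  rw [hilbert_symm x123 x23]
  have two : (2 : ZMod 2) = 0 := rfl
  linear_combination key' + (e (hilbert x1 x2) + e (hilbert D1 x12) + e (hilbert x123 x3) +
    e (hilbert D2 x123) - e (hilbert x23 x123) - e (hilbert x1 x23) - e (hilbert x23 (-1)) -
    e (hilbert x2 x23) - e (hilbert x23 x3) - e (hilbert D2 x23)) * two

end Cover

section Group

variable (F : Type*) [Field F] [ValuativeRel F] [TopologicalSpace F] [IsNonarchimedeanLocalField F]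

/-- The double cover of `GL₂(F)`: pairs `(g, ζ)` with `ζ ∈ μ₂ = {±1}`, with the multiplication
`(g, ζ)(g', ζ') = (gg', ζζ'Δ(g, g'))`. -/
@[ext] structure GLCover where
  mat : GL (Fin 2) F
  sgn : ℤˣ

namespace GLCover

variable {F}

noncomputable instance : Mul (GLCover F) :=
  ⟨fun x y => ⟨x.mat * y.mat, x.sgn * y.sgn * cocycle x.mat y.mat⟩⟩

noncomputable instance : One (GLCover F) := ⟨⟨1, 1⟩⟩

noncomputable instance : Inv (GLCover F) := ⟨fun x => ⟨x.mat⁻¹, x.sgn * cocycle x.mat⁻¹ x.mat⟩⟩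

@[simp] theorem mul_mat (x y : GLCover F) : (x * y).mat = x.mat * y.mat := rfl

@[simp] theorem mul_sgn (x y : GLCover F) : (x * y).sgn = x.sgn * y.sgn * cocycle x.mat y.mat := rfl

@[simp] theorem one_mat : (1 : GLCover F).mat = 1 := rfl

@[simp] theorem one_sgn : (1 : GLCover F).sgn = 1 := rfl

noncomputable instance : Group (GLCover F) := Group.ofLeftAxioms
  (by
    intro x y z
    ext1
    · simp [mul_assoc]
    · have := cocycle_identity x.mat y.mat z.mat
      simp only [mul_sgn, mul_mat]
      calc x.sgn * y.sgn * cocycle x.mat y.mat * z.sgn * cocycle (x.mat * y.mat) z.mat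
          = x.sgn * y.sgn * z.sgn * (cocycle x.mat y.mat * cocycle (x.mat * y.mat) z.mat) := by ac_rfl
        _ = _ := by rw [this]; ac_rfl)
  (by intro x; ext1 <;> simp [cocycle_one_left])
  (by
    intro x
    ext1
    · exact inv_mul_cancel x.mat
    · change x.sgn * cocycle x.mat⁻¹ x.mat * x.sgn * cocycle x.mat⁻¹ x.mat = 1
      rw [mul_assoc, mul_right_comm, ← mul_assoc, Int.units_mul_self, one_mul, Int.units_mul_self])

/-- The projection of the cover onto `GL₂(F)`. -/
noncomputable def pr : GLCover F →* GL (Fin 2) F where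
  toFun := mat
  map_one' := rfl
  map_mul' _ _ := rfl

@[simp] theorem pr_apply (x : GLCover F) : pr x = x.mat := rfl

end GLCover

/-- The metaplectic group `G̃`, the double cover of `SL₂(F)` given by Kubota's cocycle: the elements
`(g, ζ)` of the cover of `GL₂(F)` with `det g = 1`. -/
noncomputable def Mp : Subgroup (GLCover F) :=
  (Matrix.GeneralLinearGroup.det.comp GLCover.pr).ker

instance : (Mp F).Normal := by rw [Mp]; infer_instance

variable {F}

theorem mem_Mp {x : GLCover F} : x ∈ Mp F ↔ Matrix.GeneralLinearGroup.det x.mat = 1 := Iff.rfl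

/-- On `SL₂(F)` the cocycle is Kubota's cocycle `(X(gg')/X(g), X(gg')/X(g'))_F`. -/
theorem cocycle_of_det_eq_one {g g' : GL (Fin 2) F} (h : Matrix.GeneralLinearGroup.det g = 1) :
    cocycle g g' =
      hilbert (bottomEntry (g * g') / bottomEntry g) (bottomEntry (g * g') / bottomEntry g') := by
  rw [cocycle, h, hilbert_one_left, mul_one]

/-- The embedding `SL₂(𝒪_F) → GL₂(F)`. -/
noncomputable def toGL : Matrix.SpecialLinearGroup (Fin 2) 𝒪[F] →* GL (Fin 2) F :=
  Matrix.SpecialLinearGroup.toGL.comp (Matrix.SpecialLinearGroup.map (algebraMap 𝒪[F] F))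

theorem toGL_apply (k : Matrix.SpecialLinearGroup (Fin 2) 𝒪[F]) (i j : Fin 2) :
    (toGL k).1 i j = (k.1 i j : F) := rfl

theorem det_toGL (k : Matrix.SpecialLinearGroup (Fin 2) 𝒪[F]) :
    Matrix.GeneralLinearGroup.det (toGL k) = 1 := by
  simp [toGL]

theorem toGL_injective : Function.Injective (toGL (F := F)) := by
  intro k k' h
  ext i j
  have := congrArg (fun g : GL (Fin 2) F => g.1 i j) h
  simpa [toGL_apply] using this

end Group

section Splitting

variable {F : Type*} [Field F] [ValuativeRel F] [TopologicalSpace F] [IsNonarchimedeanLocalField F]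

theorem det_eq (k : Matrix.SpecialLinearGroup (Fin 2) 𝒪[F]) :
    k.1 0 0 * k.1 1 1 - k.1 0 1 * k.1 1 0 = 1 := by
  rw [← Matrix.det_fin_two]; exact k.2

theorem lowerRight_ne_zero (k : Matrix.SpecialLinearGroup (Fin 2) 𝒪[F])
    (h : ¬ IsUnit (k.1 1 0)) : (k.1 1 1 : F) ≠ 0 := by
  intro h'
  apply h
  have := det_eq k
  rw [ZeroMemClass.coe_eq_zero.1 h'] at this
  exact IsUnit.of_mul_eq_one (-(k.1 0 1)) (by linear_combination this)

/-- The function `θ` on `K = SL₂(𝒪_F)`: if `(c, d)` is the bottom row of `k`, then `θ(k) = 1` if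
`c = 0` or `c` is a unit, and `θ(k) = (c, d)_F` otherwise. -/
noncomputable def theta (k : Matrix.SpecialLinearGroup (Fin 2) 𝒪[F]) : ℤˣ :=
  open Classical in
  if h : (k.1 1 0 : F) ≠ 0 ∧ ¬ IsUnit (k.1 1 0) then
    hilbert (Units.mk0 _ h.1) (Units.mk0 _ (lowerRight_ne_zero k h.2))
  else 1

theorem isUnit_iff_ord {x : 𝒪[F]} {u : Fˣ} (h : (u : F) = x) : IsUnit x ↔ ord u = 0 := by
  constructor
  · rintro ⟨y, rfl⟩
    have h1 : 0 ≤ ord u := (ord_nonneg_iff u).2 (h ▸ y.1.2)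
    have h2 : 0 ≤ ord u⁻¹ := by
      refine (ord_nonneg_iff _).2 ?_
      have : ((u⁻¹ : Fˣ) : F) = ((y⁻¹ : (𝒪[F])ˣ) : 𝒪[F]) := by
        have h3 : (((y⁻¹ : (𝒪[F])ˣ) : 𝒪[F]) : F) * ((y : 𝒪[F]) : F) = 1 :=
          congrArg Subtype.val y.inv_mul
        rw [Units.val_inv_eq_inv_val, h]
        exact (eq_inv_of_mul_eq_one_left h3).symm
      rw [this]; exact Subtype.mem _
    rw [ord_inv] at h2
    omega
  · intro hu
    refine IsUnit.of_mul_eq_one ⟨((u⁻¹ : Fˣ) : F), mem_of_ord_eq (by rw [ord_inv, hu, neg_zero])⟩ ?_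
    apply Subtype.ext
    change (x : F) * ((u⁻¹ : Fˣ) : F) = 1
    rw [← h, Units.mul_inv]

theorem theta_of_zero {k : Matrix.SpecialLinearGroup (Fin 2) 𝒪[F]} (h : k.1 1 0 = 0) :
    theta k = 1 := by
  rw [theta, dif_neg]; simp [h]

theorem theta_of_unit {k : Matrix.SpecialLinearGroup (Fin 2) 𝒪[F]} (h : IsUnit (k.1 1 0)) :
    theta k = 1 := by
  rw [theta, dif_neg]; tauto

theorem theta_of_pos {k : Matrix.SpecialLinearGroup (Fin 2) 𝒪[F]} {C D : Fˣ}
    (hC : (C : F) = k.1 1 0) (hD : (D : F) = k.1 1 1) (h : ¬ IsUnit (k.1 1 0)) :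
    theta k = hilbert C D := by
  rw [theta, dif_pos ⟨by rw [← hC]; exact C.ne_zero, h⟩]
  congr 1 <;> exact Units.ext (by simp [hC, hD])

theorem theta_congr {k k' : Matrix.SpecialLinearGroup (Fin 2) 𝒪[F]} (h0 : k.1 1 0 = k'.1 1 0)
    (h1 : k.1 1 1 = k'.1 1 1) : theta k = theta k' := by
  classical
  by_cases h : (k.1 1 0 : F) ≠ 0 ∧ ¬ IsUnit (k.1 1 0)
  · have h' : (k'.1 1 0 : F) ≠ 0 ∧ ¬ IsUnit (k'.1 1 0) := by rwa [h0] at h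
    rw [theta, theta, dif_pos h, dif_pos h']
    congr 1 <;> exact Units.ext (by simp only [Units.val_mk0, h0, h1])
  · have h' : ¬ ((k'.1 1 0 : F) ≠ 0 ∧ ¬ IsUnit (k'.1 1 0)) := by rwa [h0] at h
    rw [theta, theta, dif_neg h, dif_neg h']

theorem theta_one : theta (1 : Matrix.SpecialLinearGroup (Fin 2) 𝒪[F]) = 1 := theta_of_zero rfl

/-- The map `k ↦ (k, θ(k))`. -/
noncomputable def splitFun (k : Matrix.SpecialLinearGroup (Fin 2) 𝒪[F]) : GLCover F :=
  ⟨toGL k, theta k⟩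

theorem splitFun_one : splitFun (1 : Matrix.SpecialLinearGroup (Fin 2) 𝒪[F]) = 1 := by
  ext1
  · exact map_one toGL
  · exact theta_one

/-- The elements at which `splitFun` is multiplicative. -/
noncomputable def multSet : Subgroup (Matrix.SpecialLinearGroup (Fin 2) 𝒪[F]) where
  carrier := {k | ∀ k', splitFun (k * k') = splitFun k * splitFun k'}
  one_mem' := by intro k; rw [one_mul, splitFun_one, one_mul]
  mul_mem' := by
    intro a b ha hb k
    rw [mul_assoc, ha, hb, ha, mul_assoc]
  inv_mem' := by
    intro a ha k
    have h : ∀ k, splitFun (a⁻¹ * k) = (splitFun a)⁻¹ * splitFun k := by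
      intro k
      rw [eq_inv_mul_iff_mul_eq, ← ha, mul_inv_cancel_left]
    have h1 := h 1
    rw [mul_one, splitFun_one, mul_one] at h1
    rw [h, h1]

/-- Upper unipotent elements. -/
def upper {R : Type*} [CommRing R] (x : R) : Matrix.SpecialLinearGroup (Fin 2) R :=
  ⟨!![1, x; 0, 1], by simp⟩

/-- Lower unipotent elements. -/
def lower {R : Type*} [CommRing R] (x : R) : Matrix.SpecialLinearGroup (Fin 2) R :=
  ⟨!![1, 0; x, 1], by simp⟩

/-- The standard Weyl element. -/
def weyl (R : Type*) [CommRing R] : Matrix.SpecialLinearGroup (Fin 2) R :=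
  ⟨!![0, 1; -1, 0], by simp⟩

theorem mul_entry {R : Type*} [CommRing R] (k k' : Matrix.SpecialLinearGroup (Fin 2) R)
    (i j : Fin 2) : (k * k').1 i j = k.1 i 0 * k'.1 0 j + k.1 i 1 * k'.1 1 j := by
  rw [Matrix.SpecialLinearGroup.coe_mul, Matrix.mul_apply, Fin.sum_univ_two]

theorem upper_entry {R : Type*} [CommRing R] (x : R) : (upper x).1 = !![1, x; 0, 1] := rfl

theorem lower_entry {R : Type*} [CommRing R] (x : R) : (lower x).1 = !![1, 0; x, 1] := rfl

theorem weyl_entry {R : Type*} [CommRing R] : (weyl R).1 = !![0, 1; -1, 0] := rfl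

theorem upper_mem (x : 𝒪[F]) : upper x ∈ multSet (F := F) := by
  intro k
  have h0 : (upper x * k).1 1 0 = k.1 1 0 := by
    rw [mul_entry, upper_entry]; simp
  have h1 : (upper x * k).1 1 1 = k.1 1 1 := by
    rw [mul_entry, upper_entry]; simp
  have hX : bottomEntry (toGL (upper x * k)) = bottomEntry (toGL k) := by
    classical
    apply Units.ext
    rw [bottomEntry_val, bottomEntry_val, toGL_apply, toGL_apply, toGL_apply, toGL_apply, h0, h1]
  have hu : bottomEntry (toGL (upper x)) = 1 := by
    apply Units.ext
    rw [bottomEntry_of_zero] <;> rw [toGL_apply, upper_entry] <;> simp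
  have hu' : theta (upper x) = 1 := theta_of_zero (by rw [upper_entry]; simp)
  ext1
  · exact map_mul toGL _ _
  · change theta (upper x * k) = theta (upper x) * theta k * cocycle (toGL (upper x)) (toGL k)
    rw [theta_congr h0 h1, hu', one_mul, cocycle_of_det_eq_one (det_toGL _), ← map_mul, hX, div_self',
      hilbert_one_right, mul_one]

theorem weyl_mem : weyl 𝒪[F] ∈ multSet (F := F) := by
  intro k
  have h0 : (weyl 𝒪[F] * k).1 1 0 = -k.1 0 0 := by
    rw [mul_entry, weyl_entry]; simp
  have h1 : (weyl 𝒪[F] * k).1 1 1 = -k.1 0 1 := by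
    rw [mul_entry, weyl_entry]; simp
  have hdet := det_eq k
  have hdetF : (k.1 0 0 : F) * k.1 1 1 - k.1 0 1 * k.1 1 0 = 1 := by
    have := congrArg Subtype.val hdet
    simpa using this
  have hu : bottomEntry (toGL (weyl 𝒪[F])) = -1 := by
    apply Units.ext
    rw [bottomEntry_of_ne] <;> rw [toGL_apply, weyl_entry] <;> simp
  have hu' : theta (weyl 𝒪[F]) = 1 := theta_of_unit (by rw [weyl_entry]; simp)
  ext1
  · exact map_mul toGL _ _
  change theta (weyl 𝒪[F] * k) = theta (weyl 𝒪[F]) * theta k * cocycle (toGL (weyl 𝒪[F])) (toGL k)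
  rw [hu', one_mul, cocycle_of_det_eq_one (det_toGL _), ← map_mul, hu]
  have hinv : (-1 : Fˣ)⁻¹ = -1 := by simp
  set Y := bottomEntry (toGL (weyl 𝒪[F] * k)) with hY
  set X := bottomEntry (toGL k) with hX
  have hs : hilbert (Y / -1) (Y / X) = hilbert (-Y) X := by
    rw [div_eq_mul_inv, hinv, mul_neg_one, div_eq_mul_inv, hilbert_mul_right, hilbert_symm (-Y) Y,
      hilbert_self_neg, one_mul, hilbert_inv_right]
  rw [hs]
  clear hs
  by_cases ha : k.1 0 0 = 0
  · -- `a = 0`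
    have hbc : IsUnit (k.1 1 0) := IsUnit.of_mul_eq_one (-(k.1 0 1)) (by
      rw [ha] at hdet; linear_combination hdet)
    have hb : IsUnit (k.1 0 1) := IsUnit.of_mul_eq_one (-(k.1 1 0)) (by
      rw [ha] at hdet; linear_combination hdet)
    rw [theta_of_unit hbc, theta_of_zero (by rw [h0, ha, neg_zero]), one_mul,
      hilbert_unit_unit]
    · rw [ord_neg]
      refine (isUnit_iff_ord (x := (weyl 𝒪[F] * k).1 1 1) ?_).1 (by rw [h1]; exact hb.neg)
      rw [hY, bottomEntry_of_zero]
      · rfl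
      · rw [toGL_apply, h0, ha]; simp
    · refine (isUnit_iff_ord (x := k.1 1 0) ?_).1 hbc
      rw [hX, bottomEntry_of_ne]
      · rfl
      · rw [toGL_apply]; simpa using hbc.ne_zero
  have hYA : ((-Y : Fˣ) : F) = k.1 0 0 := by
    have h2 : (toGL (weyl 𝒪[F] * k)).1 1 0 ≠ 0 := by
      rw [toGL_apply, h0]; simpa using ha
    rw [Units.val_neg, hY, bottomEntry_of_ne h2, toGL_apply, h0]; simp
  by_cases hc : k.1 1 0 = 0
  · have had : IsUnit (k.1 0 0) := IsUnit.of_mul_eq_one (k.1 1 1) (by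
      rw [hc] at hdet; linear_combination hdet)
    have hd : IsUnit (k.1 1 1) := IsUnit.of_mul_eq_one (k.1 0 0) (by
      rw [hc] at hdet; linear_combination hdet)
    rw [theta_of_zero hc, theta_of_unit (by rw [h0]; exact had.neg), hilbert_unit_unit, one_mul]
    · exact (isUnit_iff_ord hYA).1 had
    · refine (isUnit_iff_ord (x := k.1 1 1) ?_).1 hd
      rw [hX, bottomEntry_of_zero]
      · rfl
      · rw [toGL_apply, hc]; rfl
  have hXC : (X : F) = k.1 1 0 := by
    rw [hX, bottomEntry_of_ne]
    · rfl
    · rw [toGL_apply]; simpa using hc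
  by_cases hau : IsUnit (k.1 0 0)
  · rw [theta_of_unit (by rw [h0]; exact hau.neg)]
    by_cases hcu : IsUnit (k.1 1 0)
    · rw [theta_of_unit hcu, one_mul, hilbert_unit_unit]
      · exact (isUnit_iff_ord hYA).1 hau
      · exact (isUnit_iff_ord hXC).1 hcu
    · set D := Units.mk0 _ (lowerRight_ne_zero k hcu) with hD
      have hDv : (D : F) = k.1 1 1 := rfl
      have hpos : 0 < ord X := by
        have h2 : 0 ≤ ord X := (ord_nonneg_iff X).2 (hXC ▸ Subtype.mem _)
        have h3 := mt (isUnit_iff_ord hXC).2 hcu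
        omega
      rw [theta_of_pos hXC hDv hcu, hilbert_symm (-Y), ← hilbert_mul_right]
      by_cases hb : k.1 0 1 = 0
      · have : D * -Y = 1 := by
          apply Units.ext
          rw [Units.val_mul, hYA, hDv]
          rw [hb] at hdetF
          simpa [mul_comm] using hdetF
        rw [this, hilbert_one_right]
      · have hb' : (k.1 0 1 : F) ≠ 0 := by simpa using hb
        have e : ((D * -Y : Fˣ) : F) = 1 - ((-(X * Units.mk0 _ hb') : Fˣ) : F) := by
          rw [Units.val_mul, hYA, hDv]
          simp only [Units.val_neg, Units.val_mul, hXC, Units.val_mk0]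
          linear_combination hdetF
        have hpos' : 0 < ord (-(X * Units.mk0 _ hb') : Fˣ) := by
          have h2 : 0 ≤ ord (Units.mk0 _ hb') := (ord_nonneg_iff _).2 (Subtype.mem _)
          rw [ord_neg, ord_mul]; omega
        exact (hilbert_principal (red_one_sub hpos' e) (ord_one_sub hpos' e)).symm
  · have hpos : 0 < ord (-Y) := by
      have h2 : 0 ≤ ord (-Y) := (ord_nonneg_iff (-Y)).2 (hYA ▸ Subtype.mem _)
      have h3 := mt (isUnit_iff_ord hYA).2 hau
      omega
    have hbc : IsUnit (k.1 0 1 * k.1 1 0) := by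
      by_contra h
      have h4 : k.1 0 0 * k.1 1 1 - k.1 0 1 * k.1 1 0 ∈ IsLocalRing.maximalIdeal 𝒪[F] :=
        sub_mem (Ideal.mul_mem_right _ _ ((IsLocalRing.mem_maximalIdeal _).2 hau))
          ((IsLocalRing.mem_maximalIdeal _).2 h)
      rw [hdet] at h4
      exact (IsLocalRing.mem_maximalIdeal _).1 h4 isUnit_one
    have hcu : IsUnit (k.1 1 0) := isUnit_of_mul_isUnit_right hbc
    have hb' : (k.1 0 1 : F) ≠ 0 := by
      have := (isUnit_of_mul_isUnit_left hbc).ne_zero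
      simpa using this
    set B := Units.mk0 _ hb' with hB
    have hBv : (B : F) = k.1 0 1 := rfl
    have hoX := (isUnit_iff_ord hXC).1 hcu
    rw [theta_of_unit hcu, one_mul, theta_of_pos (C := Y) (D := -B) _ _ (by
      rw [h0, IsUnit.neg_iff]; exact hau)]
    · have e1 : hilbert (-1) X = 1 := hilbert_unit_unit (by rw [ord_neg, ord_one]) hoX
      have e2 : hilbert Y X = hilbert (-Y) X := by
        rw [← neg_one_mul Y, hilbert_mul_left, e1, one_mul]
      rw [← e2, ← Int.units_inv_eq_self (hilbert Y X), ← mul_eq_one_iff_eq_inv, ← hilbert_mul_right]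
      by_cases hd : k.1 1 1 = 0
      · have : -B * X = 1 := by
          apply Units.ext
          rw [Units.val_mul, Units.val_neg, hXC, hBv]
          rw [hd] at hdetF
          simpa using hdetF
        rw [this, hilbert_one_right]
      · have hd' : (k.1 1 1 : F) ≠ 0 := by simpa using hd
        have e : ((-B * X : Fˣ) : F) = 1 - ((-Y * Units.mk0 _ hd' : Fˣ) : F) := by
          rw [Units.val_mul, Units.val_mul, hYA, hXC, Units.val_neg, hBv, Units.val_mk0]
          linear_combination hdetF
        have hpos' : 0 < ord (-Y * Units.mk0 _ hd' : Fˣ) := by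
          have h2 : 0 ≤ ord (Units.mk0 _ hd') := (ord_nonneg_iff _).2 (Subtype.mem _)
          rw [ord_mul]; omega
        exact hilbert_principal (red_one_sub hpos' e) (ord_one_sub hpos' e)
    · rw [h0]
      have : (Y : F) = -((-Y : Fˣ) : F) := by simp
      rw [this, hYA]; rfl
    · rw [h1, Units.val_neg, hBv]; rfl

theorem lower_mem (x : 𝒪[F]) : lower x ∈ multSet (F := F) := by
  have : lower x = weyl 𝒪[F] * upper (-x) * (weyl 𝒪[F])⁻¹ := by
    rw [eq_mul_inv_iff_mul_eq]
    ext i j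
    fin_cases i <;> fin_cases j <;> simp [mul_entry, lower_entry, weyl_entry, upper_entry]
  rw [this]
  exact mul_mem (mul_mem weyl_mem (upper_mem _)) (inv_mem weyl_mem)

theorem mem_multSet_of_isUnit {k : Matrix.SpecialLinearGroup (Fin 2) 𝒪[F]} (h : IsUnit (k.1 1 0)) :
    k ∈ multSet (F := F) := by
  obtain ⟨y, hy⟩ := h.exists_right_inv
  have hdet := det_eq k
  -- a matrix with unit lower left entry `c` is `u((a-1)/c) ū(c) u((d-1)/c)`
  have : k = upper ((k.1 0 0 - 1) * y) * lower (k.1 1 0) * upper ((k.1 1 1 - 1) * y) := by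
    ext i j
    fin_cases i <;> fin_cases j <;> simp [mul_entry, lower_entry, upper_entry]
    · have h1 : (k.1 0 0 : F) = 1 + (k.1 0 0 - 1) * y * k.1 1 0 := by
        have := congrArg Subtype.val hy
        simp only [MulMemClass.coe_mul, OneMemClass.coe_one] at this
        linear_combination (1 - (k.1 0 0 : F)) * this
      exact h1
    · have h1 : (k.1 0 1 : F) = (1 + (k.1 0 0 - 1) * y * k.1 1 0) * ((k.1 1 1 - 1) * y) +
          (k.1 0 0 - 1) * y := by
        have hy' := congrArg Subtype.val hy
        have hd := congrArg Subtype.val hdet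
        simp only [MulMemClass.coe_mul, OneMemClass.coe_one, AddSubgroupClass.coe_sub] at hy' hd
        linear_combination (-(k.1 0 1 : F) - (k.1 0 0 - 1) * (k.1 1 1 - 1) * y) * hy' - (y : F) * hd
      exact h1
    · have h1 : (k.1 1 1 : F) = k.1 1 0 * ((k.1 1 1 - 1) * y) + 1 := by
        have hy' := congrArg Subtype.val hy
        simp only [MulMemClass.coe_mul, OneMemClass.coe_one] at hy'
        linear_combination (1 - (k.1 1 1 : F)) * hy'
      exact h1
  rw [this]
  exact mul_mem (mul_mem (upper_mem _) (lower_mem _)) (upper_mem _)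

theorem multSet_eq_top : multSet (F := F) = ⊤ := by
  rw [Subgroup.eq_top_iff']
  intro k
  by_cases h : IsUnit (k.1 1 0)
  · exact mem_multSet_of_isUnit h
  · have hdet := det_eq k
    have ha : IsUnit (k.1 0 0) := by
      by_contra ha
      have h4 : k.1 0 0 * k.1 1 1 - k.1 0 1 * k.1 1 0 ∈ IsLocalRing.maximalIdeal 𝒪[F] :=
        sub_mem (Ideal.mul_mem_right _ _ ((IsLocalRing.mem_maximalIdeal _).2 ha))
          (Ideal.mul_mem_left _ _ ((IsLocalRing.mem_maximalIdeal _).2 h))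
      rw [hdet] at h4
      exact (IsLocalRing.mem_maximalIdeal _).1 h4 isUnit_one
    have h1 : weyl 𝒪[F] * k ∈ multSet (F := F) := by
      apply mem_multSet_of_isUnit
      have : (weyl 𝒪[F] * k).1 1 0 = -k.1 0 0 := by rw [mul_entry, weyl_entry]; simp
      rw [this]; exact ha.neg
    exact (Subgroup.mul_mem_cancel_left _ weyl_mem).1 h1

theorem splitFun_mul (k k' : Matrix.SpecialLinearGroup (Fin 2) 𝒪[F]) :
    splitFun (k * k') = splitFun k * splitFun k' := by
  have : k ∈ multSet (F := F) := by rw [multSet_eq_top]; trivial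
  exact this k'

/-- The splitting `K → G̃`, `k ↦ (k, θ(k))`, whose image is `K*`. -/
noncomputable def split : Matrix.SpecialLinearGroup (Fin 2) 𝒪[F] →* Mp F where
  toFun k := ⟨splitFun k, mem_Mp.2 (det_toGL k)⟩
  map_one' := Subtype.ext splitFun_one
  map_mul' k k' := Subtype.ext (splitFun_mul k k')

end Splitting

section RepresentationTheory

variable {G : Type*} [Group G] {E : Type*} [Field E] {V : Type*} [AddCommGroup V] [Module E V]

/-- The space of the compact induction `ind_H^G σ` for a compact open subgroup `H`: functions
`f : G → V` with `f(hg) = σ(h) f(g)` for `h ∈ H` and compact support, that is, supported on finitely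
many cosets `Hs`. -/
def compactInd (H : Subgroup G) (σ : Representation E H V) : Submodule E (G → V) where
  carrier := {f | (∀ (h : H) (g : G), f (h * g) = σ h (f g)) ∧
    ∃ S : Set G, S.Finite ∧ ∀ g, f g ≠ 0 → ∃ s ∈ S, g * s⁻¹ ∈ H}
  zero_mem' := ⟨fun h g => by simp, ∅, Set.finite_empty, fun g hg => (hg rfl).elim⟩
  add_mem' := by
    rintro f f' ⟨h1, S, hS, h2⟩ ⟨h1', S', hS', h2'⟩
    refine ⟨fun h g => by simp [h1, h1'], S ∪ S', hS.union hS', fun g hg => ?_⟩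
    by_cases h0 : f g = 0
    · have h0' : f' g ≠ 0 := by
        intro h; apply hg; simp [h0, h]
      obtain ⟨s, hs, h⟩ := h2' g h0'
      exact ⟨s, Or.inr hs, h⟩
    · obtain ⟨s, hs, h⟩ := h2 g h0
      exact ⟨s, Or.inl hs, h⟩
  smul_mem' := by
    rintro c f ⟨h1, S, hS, h2⟩
    refine ⟨fun h g => by simp [h1], S, hS, fun g hg => h2 g ?_⟩
    intro h; apply hg; simp [h]

/-- The action of `G` on `ind_H^G σ` by right translation. -/
def indRep (H : Subgroup G) (σ : Representation E H V) : Representation E G (compactInd H σ) where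
  toFun x :=
    { toFun f := ⟨fun g => f.1 (g * x), fun h g => by
        change f.1 (h * g * x) = σ h (f.1 (g * x))
        rw [mul_assoc, f.2.1], by
        obtain ⟨S, hS, h⟩ := f.2.2
        refine ⟨(fun s => s * x⁻¹) '' S, hS.image _, fun g hg => ?_⟩
        obtain ⟨s, hs, h'⟩ := h _ hg
        exact ⟨_, ⟨s, hs, rfl⟩, by simpa [mul_assoc] using h'⟩⟩
      map_add' _ _ := rfl
      map_smul' _ _ := rfl }
  map_one' := by ext f g; simp
  map_mul' x y := by ext f g; simp [mul_assoc]

@[simp] theorem indRep_apply (H : Subgroup G) (σ : Representation E H V) (x : G)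
    (f : compactInd H σ) (g : G) : (indRep H σ x f).1 g = f.1 (g * x) := rfl

/-- The Hecke algebra of `(G, H, σ)` as a space of functions: maps `φ : G → End V` with
`φ(h g h') = σ(h) φ(g) σ(h')`, supported on finitely many cosets `Hs`. -/
structure HeckeFun (H : Subgroup G) (σ : Representation E H V) where
  toFun : G → V →ₗ[E] V
  equivariant (h h' : H) (g : G) : toFun (h * g * h') = σ h ∘ₗ toFun g ∘ₗ σ h'
  finite_support : ∃ S : Set G, S.Finite ∧ ∀ g, toFun g ≠ 0 → ∃ s ∈ S, g * s⁻¹ ∈ H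

theorem HeckeFun.left {H : Subgroup G} {σ : Representation E H V} (φ : HeckeFun H σ) (h : H) (g : G) :
    φ.toFun (h * g) = σ h ∘ₗ φ.toFun g := by
  have := φ.equivariant h 1 g
  rw [map_one, OneMemClass.coe_one, mul_one] at this
  exact this

theorem HeckeFun.right {H : Subgroup G} {σ : Representation E H V} (φ : HeckeFun H σ) (h : H) (g : G) :
    φ.toFun (g * h) = φ.toFun g ∘ₗ σ h := by
  have := φ.equivariant 1 h g
  rw [map_one, OneMemClass.coe_one, one_mul] at this
  exact this

/-- The summand `φ(g x⁻¹) f(x)`, which depends only on the coset `Hx`. -/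
def heckeTerm {H : Subgroup G} {σ : Representation E H V} (φ : HeckeFun H σ) (f : compactInd H σ)
    (g : G) : Quotient (QuotientGroup.rightRel H) → V :=
  Quotient.lift (fun x => φ.toFun (g * x⁻¹) (f.1 x)) (by
    intro x y hxy
    have h : y * x⁻¹ ∈ H := QuotientGroup.rightRel_apply.1 hxy
    have e1 : f.1 y = σ ⟨y * x⁻¹, h⟩ (f.1 x) := by
      rw [← f.2.1]; simp
    have e2 : φ.toFun (g * x⁻¹) = φ.toFun (g * y⁻¹) ∘ₗ σ ⟨y * x⁻¹, h⟩ := by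
      rw [← φ.right]; simp [mul_assoc]
    change φ.toFun (g * x⁻¹) (f.1 x) = φ.toFun (g * y⁻¹) (f.1 y)
    rw [e1, e2]; rfl)

theorem heckeTerm_mk {H : Subgroup G} {σ : Representation E H V} (φ : HeckeFun H σ)
    (f : compactInd H σ) (g x : G) :
    heckeTerm φ f g (Quotient.mk _ x) = φ.toFun (g * x⁻¹) (f.1 x) := rfl

theorem heckeTerm_support {H : Subgroup G} {σ : Representation E H V} (φ : HeckeFun H σ)
    (f : compactInd H σ) (g : G) : (Function.support (heckeTerm φ f g)).Finite := by
  obtain ⟨S, hS, h⟩ := f.2.2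
  refine (hS.image (Quotient.mk (QuotientGroup.rightRel H))).subset ?_
  intro q
  induction q using Quotient.inductionOn with
  | h x =>
    intro hq
    have hx : f.1 x ≠ 0 := by
      intro h0
      apply hq
      rw [heckeTerm_mk, h0, map_zero]
    obtain ⟨s, hs, h'⟩ := h x hx
    exact ⟨s, hs, Quotient.sound (QuotientGroup.rightRel_apply.2 h')⟩

/-- The operator `T(f)(g) = ∑_{x ∈ H\G} φ(g x⁻¹) f(x)` on `ind_H^G σ` given by an element `φ` of the
Hecke algebra. -/
noncomputable def heckeOp {H : Subgroup G} {σ : Representation E H V} (φ : HeckeFun H σ) :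
    (indRep H σ).IntertwiningMap (indRep H σ) where
  toFun f := ⟨fun g => ∑ᶠ q, heckeTerm φ f g q, by
    constructor
    · intro h g
      have := (σ h).toAddMonoidHom.map_finsum (heckeTerm_support φ f g)
      refine Eq.trans ?_ this.symm
      apply finsum_congr
      intro q
      induction q using Quotient.inductionOn with
      | h x => simp only [heckeTerm_mk, mul_assoc, φ.left]; rfl
    · obtain ⟨S, hS, h1⟩ := f.2.2
      obtain ⟨S', hS', h2⟩ := φ.finite_support
      refine ⟨Set.image2 (fun s' s => s' * s) S' S, hS'.image2 _ hS, fun g hg => ?_⟩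
      have hg' : ∃ q, heckeTerm φ f g q ≠ 0 := by
        by_contra h0
        push Not at h0
        exact hg (finsum_eq_zero_of_forall_eq_zero h0)
      obtain ⟨q, hq⟩ := hg'
      induction q using Quotient.inductionOn with
      | h x =>
        have hx : f.1 x ≠ 0 := by
          intro h0
          apply hq
          rw [heckeTerm_mk, h0, map_zero]
        obtain ⟨s, hs, h3⟩ := h1 x hx
        have hs' : heckeTerm φ f g (Quotient.mk _ x) = heckeTerm φ f g (Quotient.mk _ s) :=
          congrArg _ (Quotient.sound (QuotientGroup.rightRel_apply.2
            (by simpa using H.inv_mem h3)))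
        rw [hs', heckeTerm_mk] at hq
        have h4 : φ.toFun (g * s⁻¹) ≠ 0 := by
          intro h0; apply hq; rw [h0]; rfl
        obtain ⟨s', hs', h5⟩ := h2 _ h4
        exact ⟨s' * s, ⟨s', hs', s, hs, rfl⟩, by simpa [mul_assoc] using h5⟩⟩
  map_add' f f' := by
    apply Subtype.ext
    funext g
    change ∑ᶠ q, heckeTerm φ (f + f') g q = ∑ᶠ q, heckeTerm φ f g q + ∑ᶠ q, heckeTerm φ f' g q
    rw [← finsum_add_distrib (heckeTerm_support φ f g) (heckeTerm_support φ f' g)]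
    apply finsum_congr
    intro q
    induction q using Quotient.inductionOn with
    | h x => exact map_add (φ.toFun (g * x⁻¹)) _ _
  map_smul' c f := by
    apply Subtype.ext
    funext g
    change ∑ᶠ q, heckeTerm φ (c • f) g q = c • ∑ᶠ q, heckeTerm φ f g q
    rw [smul_finsum' c (heckeTerm_support φ f g)]
    apply finsum_congr
    intro q
    induction q using Quotient.inductionOn with
    | h x => exact map_smul (φ.toFun (g * x⁻¹)) _ _
  isIntertwining' y := by
    apply LinearMap.ext
    intro f
    apply Subtype.ext
    funext g
    change ∑ᶠ q, heckeTerm φ (indRep H σ y f) g q = ∑ᶠ q, heckeTerm φ f (g * y) q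
    -- substitute `x ↦ xy` in the sum
    let e : Quotient (QuotientGroup.rightRel H) ≃ Quotient (QuotientGroup.rightRel H) :=
      Quotient.congr (Equiv.mulRight y) (fun a b => by
        change (QuotientGroup.rightRel H) a b ↔ (QuotientGroup.rightRel H) (a * y) (b * y)
        rw [QuotientGroup.rightRel_apply, QuotientGroup.rightRel_apply]
        simp [mul_assoc])
    rw [← finsum_comp_equiv e (f := heckeTerm φ f (g * y))]
    apply finsum_congr
    intro q
    induction q using Quotient.inductionOn with
    | h x =>
      change φ.toFun (g * x⁻¹) (f.1 (x * y)) = φ.toFun (g * y * (x * y)⁻¹) (f.1 (x * y))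
      simp [mul_assoc]

/-- The space of the cokernel `π/(T - λ)π` of an operator `T` on a representation `π`. -/
abbrev Coker {M : Type*} [AddCommGroup M] [Module E M] {π : Representation E G M}
    (T : π.IntertwiningMap π) (lam : E) : Type _ :=
  M ⧸ LinearMap.range (T.toLinearMap - lam • (LinearMap.id : M →ₗ[E] M))

/-- The representation `π/(T - λ)π`. -/
def cokerRep {M : Type*} [AddCommGroup M] [Module E M] {π : Representation E G M}
    (T : π.IntertwiningMap π) (lam : E) : Representation E G (Coker T lam) :=
  π.quotient _ (by
    rintro g _ ⟨v, rfl⟩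
    refine ⟨π g v, ?_⟩
    have := LinearMap.congr_fun (T.isIntertwining' g) v
    simp only [LinearMap.comp_apply] at this
    simp [this])

/-- `ρ` is a quotient of `π`. -/
def IsQuotientOf {M W : Type*} [AddCommGroup M] [Module E M] [AddCommGroup W] [Module E W]
    (ρ : Representation E G W) (π : Representation E G M) : Prop :=
  ∃ f : π.IntertwiningMap ρ, Function.Surjective f

theorem heckeSingle_aux {H : Subgroup G} {σ : Representation E H V} {t : G} {ρ₀ : V →ₗ[E] V}
    (compat : ∀ h h' : H, h * t = t * h' → σ h ∘ₗ ρ₀ = ρ₀ ∘ₗ σ h') (h₁ h₁' h₂ h₂' : H)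
    (h : (h₁ : G) * t * h₁' = h₂ * t * h₂') : σ h₁ ∘ₗ ρ₀ ∘ₗ σ h₁' = σ h₂ ∘ₗ ρ₀ ∘ₗ σ h₂' := by
  have h3 := compat (h₂⁻¹ * h₁) (h₂' * h₁'⁻¹) (by
    push_cast
    rw [mul_assoc, inv_mul_eq_iff_eq_mul, ← mul_assoc t, ← mul_assoc, ← mul_assoc, ← h]
    simp [mul_assoc])
  have h4 := congrArg (fun A => σ h₂ ∘ₗ A ∘ₗ σ h₁') h3
  simp only [← Module.End.mul_eq_comp, mul_assoc, ← map_mul] at h4 ⊢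
  simp only [← mul_assoc, ← map_mul] at h4
  simpa [mul_assoc] using h4

/-- The function `φ` supported on `H t H` with `φ(h t h') = σ(h) ρ₀ σ(h')`, provided this is well
defined and `H t H` consists of finitely many cosets `Hs`. -/
noncomputable def heckeSingle {H : Subgroup G} {σ : Representation E H V} (t : G) (ρ₀ : V →ₗ[E] V)
    (compat : ∀ h h' : H, h * t = t * h' → σ h ∘ₗ ρ₀ = ρ₀ ∘ₗ σ h')
    (fin : ∃ S : Set G, S.Finite ∧ ∀ h : H, ∃ s ∈ S, t * h * s⁻¹ ∈ H) : HeckeFun H σ :=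
  open Classical in
  { toFun g := if hg : ∃ p : H × H, g = p.1 * t * p.2 then σ hg.choose.1 ∘ₗ ρ₀ ∘ₗ σ hg.choose.2 else 0
    equivariant h h' g := by
      by_cases hg : ∃ p : H × H, g = p.1 * t * p.2
      · have hg' : ∃ p : H × H, h * g * h' = p.1 * t * p.2 := by
          obtain ⟨p, hp⟩ := hg
          exact ⟨(h * p.1, p.2 * h'), by rw [hp]; simp [mul_assoc]⟩
        rw [dif_pos hg, dif_pos hg']
        rw [heckeSingle_aux compat _ _ (h * hg.choose.1) (hg.choose.2 * h')]
        · simp only [map_mul, Module.End.mul_eq_comp, LinearMap.comp_assoc]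
        · rw [← hg'.choose_spec]
          nth_rewrite 1 [hg.choose_spec]
          simp [mul_assoc]
      · have hg' : ¬ ∃ p : H × H, h * g * h' = p.1 * t * p.2 := by
          rintro ⟨p, hp⟩
          refine hg ⟨(h⁻¹ * p.1, p.2 * h'⁻¹), ?_⟩
          rw [mul_assoc, ← eq_inv_mul_iff_mul_eq, ← eq_mul_inv_iff_mul_eq] at hp
          rw [hp]
          simp [mul_assoc]
        rw [dif_neg hg, dif_neg hg']
        simp
    finite_support := by
      obtain ⟨S, hS, h⟩ := fin
      refine ⟨S, hS, fun g hg => ?_⟩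
      by_cases hp : ∃ p : H × H, g = p.1 * t * p.2
      · obtain ⟨p, rfl⟩ := hp
        obtain ⟨s, hs, h'⟩ := h p.2
        refine ⟨s, hs, ?_⟩
        have := H.mul_mem p.1.2 h'
        simpa [mul_assoc] using this
      · rw [dif_neg hp] at hg
        exact (hg rfl).elim }

theorem heckeSingle_apply {H : Subgroup G} {σ : Representation E H V} (t : G) (ρ₀ : V →ₗ[E] V)
    (compat : ∀ h h' : H, h * t = t * h' → σ h ∘ₗ ρ₀ = ρ₀ ∘ₗ σ h')
    (fin : ∃ S : Set G, S.Finite ∧ ∀ h : H, ∃ s ∈ S, t * h * s⁻¹ ∈ H) (h h' : H) :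
    (heckeSingle t ρ₀ compat fin).toFun (h * t * h') = σ h ∘ₗ ρ₀ ∘ₗ σ h' := by
  have hg : ∃ p : H × H, (h : G) * t * h' = p.1 * t * p.2 := ⟨(h, h'), rfl⟩
  refine (dif_pos hg).trans ?_
  exact heckeSingle_aux compat _ _ _ _ hg.choose_spec.symm

theorem heckeSingle_eq_zero {H : Subgroup G} {σ : Representation E H V} (t : G) (ρ₀ : V →ₗ[E] V)
    (compat : ∀ h h' : H, h * t = t * h' → σ h ∘ₗ ρ₀ = ρ₀ ∘ₗ σ h')
    (fin : ∃ S : Set G, S.Finite ∧ ∀ h : H, ∃ s ∈ S, t * h * s⁻¹ ∈ H) {g : G}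
    (hg : ¬ ∃ p : H × H, g = p.1 * t * p.2) : (heckeSingle t ρ₀ compat fin).toFun g = 0 :=
  dif_neg hg

/-- The subgroup `c(H)`, for an automorphism `c` of `G`. -/
abbrev conjSubgroup (c : MulAut G) (H : Subgroup G) : Subgroup G := H.map c.toMonoidHom

/-- The conjugate representation `σ^c(h) = σ(c⁻¹(h))` of `c(H)`. -/
noncomputable def conjRep (c : MulAut G) {H : Subgroup G} (σ : Representation E H V) :
    Representation E (conjSubgroup c H) V :=
  σ.comp (c.subgroupMap H).symm.toMonoidHom

theorem conjRep_apply (c : MulAut G) {H : Subgroup G} (σ : Representation E H V) (h : H) :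
    conjRep c σ ⟨c h, ⟨h, h.2, rfl⟩⟩ = σ h := by
  change σ ((c.subgroupMap H).symm _) = σ h
  exact congrArg σ ((c.subgroupMap H).symm_apply_apply h)

/-- The isomorphism `Φ(f)(g) = f(c⁻¹(g))` from `ind_H σ` onto `ind_{c(H)} σ^c`. It identifies
`(ind_H σ)^c` with `ind_{c(H)} σ^c`. -/
noncomputable def conjInd (c : MulAut G) (H : Subgroup G) (σ : Representation E H V) :
    compactInd H σ ≃ₗ[E] compactInd (conjSubgroup c H) (conjRep c σ) where
  toFun f := ⟨fun g => f.1 (c.symm g), by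
    constructor
    · rintro ⟨_, ⟨h, hh, rfl⟩⟩ g
      have := conjRep_apply c σ ⟨h, hh⟩
      change f.1 (c.symm (c h * g)) = (conjRep c σ ⟨c h, ⟨h, hh, rfl⟩⟩) (f.1 (c.symm g))
      rw [this, ← f.2.1]
      simp
    · obtain ⟨S, hS, h⟩ := f.2.2
      refine ⟨c '' S, hS.image _, fun g hg => ?_⟩
      obtain ⟨s, hs, h'⟩ := h _ hg
      refine ⟨_, ⟨s, hs, rfl⟩, ⟨_, h', ?_⟩⟩
      change c (c.symm g * s⁻¹) = g * (c s)⁻¹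
      simp⟩
  invFun f := ⟨fun g => f.1 (c g), by
    constructor
    · intro h g
      change f.1 (c (h * g)) = σ h (f.1 (c g))
      rw [map_mul, ← conjRep_apply c σ h, ← f.2.1]
    · obtain ⟨S, hS, h⟩ := f.2.2
      refine ⟨c.symm '' S, hS.image _, fun g hg => ?_⟩
      obtain ⟨s, hs, x, hx, h'⟩ := h _ hg
      refine ⟨_, ⟨s, hs, rfl⟩, ?_⟩
      have : g * (c.symm s)⁻¹ = x := by
        apply c.injective
        rw [map_mul, map_inv, MulEquiv.apply_symm_apply]
        exact h'.symm
      rw [this]; exact hx⟩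
  map_add' _ _ := rfl
  map_smul' _ _ := rfl
  left_inv f := by
    apply Subtype.ext; funext g
    exact congrArg f.1 (c.symm_apply_apply g)
  right_inv f := by
    apply Subtype.ext; funext g
    exact congrArg f.1 (c.apply_symm_apply g)

/-- The operator `Φ ∘ T ∘ Φ⁻¹`. -/
noncomputable def conjOp (c : MulAut G) {H : Subgroup G} {σ : Representation E H V}
    (T : (indRep H σ).IntertwiningMap (indRep H σ)) :
    (indRep (conjSubgroup c H) (conjRep c σ)).IntertwiningMap
      (indRep (conjSubgroup c H) (conjRep c σ)) where
  toLinearMap := (conjInd c H σ).toLinearMap ∘ₗ T.toLinearMap ∘ₗ (conjInd c H σ).symm.toLinearMap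
  isIntertwining' g := by
    apply LinearMap.ext
    intro f
    have h1 : (conjInd c H σ).symm (indRep _ _ g f) =
        indRep H σ (c.symm g) ((conjInd c H σ).symm f) := by
      apply Subtype.ext; funext x
      change f.1 (c x * g) = f.1 (c (x * c.symm g))
      simp
    have h2 : ∀ f', conjInd c H σ (indRep H σ (c.symm g) f') =
        indRep _ _ g (conjInd c H σ f') := by
      intro f'
      apply Subtype.ext; funext x
      change f'.1 (c.symm x * c.symm g) = f'.1 (c.symm (x * g))
      simp
    have h3 := LinearMap.congr_fun (T.isIntertwining' (c.symm g)) ((conjInd c H σ).symm f)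
    simp only [LinearMap.comp_apply, LinearEquiv.coe_coe] at h3 ⊢
    rw [h1, h3, h2]

end RepresentationTheory

section Subgroups

variable (F : Type*) [Field F] [ValuativeRel F] [TopologicalSpace F] [IsNonarchimedeanLocalField F]

/-- `K̃`, the full preimage of `K = SL₂(𝒪_F)` in `G̃`. -/
noncomputable def Kt : Subgroup (Mp F) :=
  (toGL (F := F)).range.comap (GLCover.pr.comp (Mp F).subtype)

/-- The topology of `G̃`: the one for which `K*`, with the topology of `K = SL₂(𝒪_F)`, is an open
subgroup. Explicitly, `U` is open if `{k ∈ K | g · (k, θ(k)) ∈ U}` is open in `K` for all `g`. -/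
noncomputable instance : TopologicalSpace (Mp F) :=
  ⨆ g : Mp F, TopologicalSpace.coinduced
    (fun k : Matrix.SpecialLinearGroup (Fin 2) 𝒪[F] => g * split k) inferInstance

variable {F}

theorem Mp_isOpen_iff (U : Set (Mp F)) : IsOpen U ↔ ∀ g : Mp F,
    IsOpen {k : Matrix.SpecialLinearGroup (Fin 2) 𝒪[F] | g * split k ∈ U} := by
  rw [isOpen_iSup_iff]; rfl

/-- The element `(1, ζ)` of the center of `G̃`. -/
def central (ζ : ℤˣ) : Mp F := ⟨⟨1, ζ⟩, mem_Mp.2 (map_one _)⟩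

/-- The homomorphism `(k, ζ) ↦ (k, θ(k))(1, ζ) = (k, θ(k)ζ)` from `K × μ₂` to `G̃`. -/
noncomputable def ktHom : Matrix.SpecialLinearGroup (Fin 2) 𝒪[F] × ℤˣ →* Mp F where
  toFun x := ⟨⟨toGL x.1, theta x.1 * x.2⟩, mem_Mp.2 (det_toGL x.1)⟩
  map_one' := by
    apply Subtype.ext
    ext1
    · exact map_one toGL
    · simp [theta_one]
  map_mul' x y := by
    apply Subtype.ext
    ext1
    · exact map_mul toGL _ _
    · have := congrArg GLCover.sgn (splitFun_mul x.1 y.1)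
      change theta (x.1 * y.1) = theta x.1 * theta y.1 * cocycle (toGL x.1) (toGL y.1) at this
      change theta (x.1 * y.1) * (x.2 * y.2) =
        (theta x.1 * x.2) * (theta y.1 * y.2) * cocycle (toGL x.1) (toGL y.1)
      rw [this]
      ac_rfl

theorem ktHom_mem (x : Matrix.SpecialLinearGroup (Fin 2) 𝒪[F] × ℤˣ) : ktHom x ∈ Kt F := ⟨x.1, rfl⟩

/-- The isomorphism `K × μ₂ ≃ K* × μ₂ = K̃`, `(k, ζ) ↦ (k, θ(k)ζ)`. -/
noncomputable def ktEquiv : Matrix.SpecialLinearGroup (Fin 2) 𝒪[F] × ℤˣ ≃* Kt F :=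
  MulEquiv.ofBijective (ktHom.codRestrict (Kt F) ktHom_mem) (by
    constructor
    · rintro ⟨k, ζ⟩ ⟨k', ζ'⟩ h
      have h' : ktHom (k, ζ) = ktHom (k', ζ') := congrArg Subtype.val h
      have h1 : toGL k = toGL k' := congrArg (fun x : Mp F => x.1.mat) h'
      have h2 : theta k * ζ = theta k' * ζ' := congrArg (fun x : Mp F => x.1.sgn) h'
      have h3 := toGL_injective h1
      subst h3
      rw [mul_left_cancel h2]
    · rintro ⟨⟨⟨g, ζ⟩, hg⟩, ⟨k, hk⟩⟩
      refine ⟨(k, theta k * ζ), ?_⟩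
      apply Subtype.ext
      apply Subtype.ext
      ext1
      · exact hk
      · change theta k * (theta k * ζ) = ζ
        rw [← mul_assoc, Int.units_mul_self, one_mul])

theorem ktEquiv_mat (x : Matrix.SpecialLinearGroup (Fin 2) 𝒪[F] × ℤˣ) :
    (ktEquiv x).1.1.mat = toGL x.1 := rfl

theorem ktEquiv_sgn (x : Matrix.SpecialLinearGroup (Fin 2) 𝒪[F] × ℤˣ) :
    (ktEquiv x).1.1.sgn = theta x.1 * x.2 := rfl

/-- The diagonal matrix `diag(x, y)`. -/
noncomputable def diag (x y : Fˣ) : GL (Fin 2) F :=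
  Matrix.GeneralLinearGroup.mkOfDetNeZero !![(x : F), 0; 0, (y : F)] (by simp)

/-- The element `w(x)` with rows `(0, x)`, `(-x⁻¹, 0)`. -/
noncomputable def weylElt (x : Fˣ) : GL (Fin 2) F :=
  Matrix.GeneralLinearGroup.mkOfDetNeZero !![0, (x : F); -((x⁻¹ : Fˣ) : F), 0] (by simp)

/-- `w̃(x) = (w(x), 1)`. -/
noncomputable def weylTilde (x : Fˣ) : Mp F :=
  ⟨⟨weylElt x, 1⟩, mem_Mp.2 (by
    apply Units.ext
    simp [weylElt, Matrix.GeneralLinearGroup.mkOfDetNeZero])⟩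

/-- `h̃(x) = w̃(x)w̃(-1)`, a lift of `diag(x, x⁻¹)`. -/
noncomputable def torusTilde (x : Fˣ) : Mp F := weylTilde x * weylTilde (-1)

theorem torusTilde_mat (x : Fˣ) : (torusTilde x).1.mat = diag x x⁻¹ := by
  apply Units.ext
  change (weylElt x).1 * (weylElt (-1)).1 = _
  ext i j
  fin_cases i <;> fin_cases j <;>
    simp [weylElt, diag, Matrix.GeneralLinearGroup.mkOfDetNeZero]

/-- The chosen uniformizer as a unit of `F`. -/
noncomputable def unif (ϖ : {x : 𝒪[F] // Irreducible x}) : Fˣ :=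
  Units.mk0 (ϖ.1 : F) (by simpa using ϖ.2.ne_zero)

/-- `α̃ = (diag(1, ϖ), 1)`. -/
noncomputable def alphaTilde (ϖ : {x : 𝒪[F] // Irreducible x}) : GLCover F := ⟨diag 1 (unif ϖ), 1⟩

/-- Conjugation `g ↦ α̃ g α̃⁻¹` on `G̃`. -/
noncomputable def conjAlpha (ϖ : {x : 𝒪[F] // Irreducible x}) : MulAut (Mp F) :=
  MulAut.conjNormal (alphaTilde ϖ)

/-- `K̃' = α̃ K̃ α̃⁻¹`. -/
noncomputable abbrev Kt' (ϖ : {x : 𝒪[F] // Irreducible x}) : Subgroup (Mp F) :=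
  conjSubgroup (conjAlpha ϖ) (Kt F)

/-- `K̃'` is the full preimage of `K' = α K α⁻¹`. -/
theorem mem_Kt'_iff (ϖ : {x : 𝒪[F] // Irreducible x}) (x : Mp F) :
    x ∈ Kt' ϖ ↔ ∃ k, diag 1 (unif ϖ) * toGL k * (diag 1 (unif ϖ))⁻¹ = x.1.mat := by
  constructor
  · rintro ⟨y, ⟨k, hk⟩, rfl⟩
    refine ⟨k, ?_⟩
    have hk' : toGL k = y.1.mat := hk
    rw [hk']
    have := MulAut.conjNormal_apply (alphaTilde ϖ) y
    exact (congrArg (GLCover.pr (F := F)) this).symm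
  · rintro ⟨k, hk⟩
    refine ⟨(conjAlpha ϖ).symm x, ⟨k, ?_⟩, (conjAlpha ϖ).apply_symm_apply x⟩
    have := MulAut.conjNormal_symm_apply (alphaTilde ϖ) x
    have h2 : ((conjAlpha ϖ).symm x).1.mat = (diag 1 (unif ϖ))⁻¹ * x.1.mat * diag 1 (unif ϖ) :=
      congrArg (GLCover.pr (F := F)) this
    change toGL k = ((conjAlpha ϖ).symm x).1.mat
    rw [h2, ← hk]
    simp [mul_assoc]

/-- The subgroup `K*` is open. -/
theorem isOpen_range_split : IsOpen (Set.range (split (F := F))) := by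
  rw [Mp_isOpen_iff]
  intro g
  by_cases hg : g ∈ (split (F := F)).range
  · convert isOpen_univ
    ext k
    simp only [Set.mem_ofPred_eq, Set.mem_univ, iff_true]
    exact mul_mem hg ⟨k, rfl⟩
  · convert isOpen_empty
    ext k
    simp only [Set.mem_ofPred_eq, Set.mem_empty_iff_false, iff_false]
    intro h
    have hk : split k ∈ (split (F := F)).range := ⟨k, rfl⟩
    exact hg ((Subgroup.mul_mem_cancel_right _ hk).1 h)

end Subgroups

section Compatibility

variable {F : Type*} [Field F] [ValuativeRel F] [TopologicalSpace F] [IsNonarchimedeanLocalField F]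

theorem diag_entry (x y : Fˣ) : (diag x y).1 = !![(x : F), 0; 0, (y : F)] := rfl

theorem unif_pos (ϖ : {x : 𝒪[F] // Irreducible x}) : 0 < ord (unif ϖ) := by
  have h1 : 0 ≤ ord (unif ϖ) := (ord_nonneg_iff _).2 (Subtype.mem _)
  have h2 := mt (isUnit_iff_ord (x := ϖ.1) (u := unif ϖ) rfl).2 ϖ.2.not_isUnit
  omega

/-- If `h(ϖ)κ = κ'h(ϖ)` with `κ, κ' ∈ K`, the entries are related as follows. -/
theorem torus_conj_entries {ϖ : {x : 𝒪[F] // Irreducible x}}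
    {k k' : Matrix.SpecialLinearGroup (Fin 2) 𝒪[F]}
    (h : diag (unif ϖ) (unif ϖ)⁻¹ * toGL k = toGL k' * diag (unif ϖ) (unif ϖ)⁻¹) :
    k'.1 0 0 = k.1 0 0 ∧ k'.1 1 1 = k.1 1 1 ∧ k'.1 0 1 = ϖ.1 ^ 2 * k.1 0 1 ∧
      k.1 1 0 = ϖ.1 ^ 2 * k'.1 1 0 := by
  have hne : (unif ϖ : F) ≠ 0 := (unif ϖ).ne_zero
  have e : ∀ i j, (diag (unif ϖ) (unif ϖ)⁻¹ * toGL k).1 i j =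
      (toGL k' * diag (unif ϖ) (unif ϖ)⁻¹).1 i j := by rw [h]; simp
  simp only [Units.val_mul, Matrix.mul_apply, Fin.sum_univ_two, diag_entry, toGL_apply] at e
  have e00 := e 0 0
  have e01 := e 0 1
  have e10 := e 1 0
  have e11 := e 1 1
  simp at e00 e01 e10 e11
  have hv : (unif ϖ : F) = ϖ.1 := rfl
  refine ⟨Subtype.ext ?_, Subtype.ext ?_, Subtype.ext ?_, Subtype.ext ?_⟩
  · apply mul_left_cancel₀ hne
    rw [e00, mul_comm]
  · have : (unif ϖ : F)⁻¹ ≠ 0 := inv_ne_zero hne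
    apply mul_left_cancel₀ this
    rw [e11, mul_comm]
  · push_cast
    rw [← hv]
    field_simp at e01
    linear_combination -e01
  · push_cast
    rw [← hv]
    field_simp at e10
    linear_combination e10

theorem theta_torus_conj {ϖ : {x : 𝒪[F] // Irreducible x}}
    {k k' : Matrix.SpecialLinearGroup (Fin 2) 𝒪[F]} (h11 : k'.1 1 1 = k.1 1 1)
    (h10 : k.1 1 0 = ϖ.1 ^ 2 * k'.1 1 0) : theta k = theta k' := by
  by_cases hc : k'.1 1 0 = 0
  · rw [theta_of_zero hc, theta_of_zero (by rw [h10, hc, mul_zero])]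
  have hcF : (k'.1 1 0 : F) ≠ 0 := by simpa using hc
  have hnu : ¬ IsUnit (k.1 1 0) := by
    intro hu
    rw [h10] at hu
    exact ϖ.2.not_isUnit (isUnit_of_dvd_unit ⟨ϖ.1 * k'.1 1 0, by ring⟩ hu)
  set C' := Units.mk0 _ hcF with hC'
  have hC'v : (C' : F) = k'.1 1 0 := rfl
  set D := Units.mk0 _ (lowerRight_ne_zero k hnu) with hD
  have hDv : (D : F) = k.1 1 1 := rfl
  have hCv : ((unif ϖ ^ 2 * C' : Fˣ) : F) = k.1 1 0 := by
    rw [h10]; rfl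
  have hsq : hilbert (unif ϖ ^ 2 * C') D = hilbert C' D := by
    rw [pow_two, hilbert_mul_left, hilbert_mul_left, Int.units_mul_self, one_mul]
  rw [theta_of_pos hCv hDv hnu, hsq]
  by_cases hu : IsUnit (k'.1 1 0)
  · rw [theta_of_unit hu]
    refine hilbert_unit_unit ((isUnit_iff_ord hC'v).1 hu) ((isUnit_iff_ord hDv).1 ?_)
    have hdet := det_eq k
    by_contra hd
    have h4 : k.1 0 0 * k.1 1 1 - k.1 0 1 * k.1 1 0 ∈ IsLocalRing.maximalIdeal 𝒪[F] :=
      sub_mem (Ideal.mul_mem_left _ _ ((IsLocalRing.mem_maximalIdeal _).2 hd))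
        (Ideal.mul_mem_left _ _ ((IsLocalRing.mem_maximalIdeal _).2 hnu))
    rw [hdet] at h4
    exact (IsLocalRing.mem_maximalIdeal _).1 h4 isUnit_one
  · exact (theta_of_pos hC'v (by rw [hDv, h11]) hu).symm

theorem cocycle_torus_conj {ϖ : {x : 𝒪[F] // Irreducible x}}
    {k k' : Matrix.SpecialLinearGroup (Fin 2) 𝒪[F]}
    (h : diag (unif ϖ) (unif ϖ)⁻¹ * toGL k = toGL k' * diag (unif ϖ) (unif ϖ)⁻¹)
    (h11 : k'.1 1 1 = k.1 1 1) (h10 : k.1 1 0 = ϖ.1 ^ 2 * k'.1 1 0) :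
    cocycle (diag (unif ϖ) (unif ϖ)⁻¹) (toGL k) = cocycle (toGL k') (diag (unif ϖ) (unif ϖ)⁻¹) := by
  have hdet : Matrix.GeneralLinearGroup.det (diag (unif ϖ) (unif ϖ)⁻¹) = 1 := by
    apply Units.ext
    change (diag (unif ϖ) (unif ϖ)⁻¹).1.det = 1
    rw [diag_entry]; simp
  have hD : bottomEntry (diag (unif ϖ) (unif ϖ)⁻¹) = (unif ϖ)⁻¹ := by
    apply Units.ext
    rw [bottomEntry_of_zero] <;> rw [diag_entry] <;> simp
  have hDk : bottomEntry (diag (unif ϖ) (unif ϖ)⁻¹ * toGL k) = (unif ϖ)⁻¹ * bottomEntry (toGL k) := by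
    have e : ∀ j, (diag (unif ϖ) (unif ϖ)⁻¹ * toGL k).1 1 j = (unif ϖ : F)⁻¹ * (toGL k).1 1 j := by
      intro j
      rw [Units.val_mul, Matrix.mul_apply, Fin.sum_univ_two, diag_entry]
      simp
    apply Units.ext
    rw [Units.val_mul]
    by_cases hc : (toGL k).1 1 0 = 0
    · rw [bottomEntry_of_zero hc, bottomEntry_of_zero (by rw [e, hc, mul_zero]), e]; simp
    · rw [bottomEntry_of_ne hc, bottomEntry_of_ne (by rw [e]; simpa using hc), e]; simp
  rw [cocycle_of_det_eq_one hdet, cocycle_of_det_eq_one (det_toGL _), ← h, hDk, hD]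
  have hX : bottomEntry (toGL k) = bottomEntry (toGL k') ∨
      bottomEntry (toGL k) = unif ϖ ^ 2 * bottomEntry (toGL k') := by
    by_cases hc : k'.1 1 0 = 0
    · left
      apply Units.ext
      rw [bottomEntry_of_zero (by rw [toGL_apply, h10, hc]; simp),
        bottomEntry_of_zero (by rw [toGL_apply, hc]; simp), toGL_apply, toGL_apply, h11]
    · right
      have hcF : (k'.1 1 0 : F) ≠ 0 := by simpa using hc
      have hϖ : ϖ.1 ≠ 0 := ϖ.2.ne_zero
      have hc' : (k.1 1 0 : F) ≠ 0 := by
        rw [h10]; simpa [hc] using hϖ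
      apply Units.ext
      rw [Units.val_mul, bottomEntry_of_ne hc', bottomEntry_of_ne hcF, toGL_apply, toGL_apply, h10]
      rfl
  generalize bottomEntry (toGL k) = X at hX ⊢
  generalize bottomEntry (toGL k') = X' at hX ⊢
  generalize unif ϖ = w at hX ⊢
  have e1 : w⁻¹ * X / w⁻¹ = X := by rw [mul_comm, mul_div_assoc, div_self', mul_one]
  have e2 : w⁻¹ * X / X = w⁻¹ := by rw [mul_div_assoc, div_self', mul_one]
  rw [e1, e2, hilbert_symm X, hilbert_inv_left]
  rcases hX with rfl | rfl
  · rw [e2, hilbert_inv_left]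
  · have e3 : w⁻¹ * (w ^ 2 * X') / X' = w := by
      rw [pow_two, mul_assoc, inv_mul_cancel_left, mul_div_assoc, div_self', mul_one]
    rw [e3]

/-- If `h̃(ϖ)h = h'h̃(ϖ)` with `h = (κ, ζ)` and `h' = (κ', ζ')` in `K* × μ₂`, then `ζ = ζ'` and
the entries of `κ` and `κ'` are related as follows. -/
theorem torusTilde_conj {ϖ : {x : 𝒪[F] // Irreducible x}}
    {x x' : Matrix.SpecialLinearGroup (Fin 2) 𝒪[F] × ℤˣ}
    (e : torusTilde (unif ϖ) * (ktEquiv x : Mp F) = ktEquiv x' * torusTilde (unif ϖ)) :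
    x.2 = x'.2 ∧ x'.1.1 0 0 = x.1.1 0 0 ∧ x'.1.1 1 1 = x.1.1 1 1 ∧
      x'.1.1 0 1 = ϖ.1 ^ 2 * x.1.1 0 1 ∧ x.1.1 1 0 = ϖ.1 ^ 2 * x'.1.1 1 0 := by
  have hm : diag (unif ϖ) (unif ϖ)⁻¹ * toGL x.1 = toGL x'.1 * diag (unif ϖ) (unif ϖ)⁻¹ := by
    have := congrArg (fun y : Mp F => y.1.mat) e
    change (torusTilde (unif ϖ)).1.mat * toGL x.1 = toGL x'.1 * (torusTilde (unif ϖ)).1.mat at this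
    rwa [torusTilde_mat] at this
  obtain ⟨h00, h11, h01, h10⟩ := torus_conj_entries hm
  refine ⟨?_, h00, h11, h01, h10⟩
  have hs := congrArg (fun y : Mp F => y.1.sgn) e
  change (torusTilde (unif ϖ)).1.sgn * (theta x.1 * x.2) *
      cocycle (torusTilde (unif ϖ)).1.mat (toGL x.1) =
    theta x'.1 * x'.2 * (torusTilde (unif ϖ)).1.sgn *
      cocycle (toGL x'.1) (torusTilde (unif ϖ)).1.mat at hs
  rw [torusTilde_mat, cocycle_torus_conj hm h11 h10, theta_torus_conj h11 h10] at hs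
  have hs' := mul_right_cancel hs
  rw [mul_comm (theta x'.1 * x'.2)] at hs'
  exact mul_left_cancel (mul_left_cancel hs')

end Compatibility

section Finiteness

variable {F : Type*} [Field F] [ValuativeRel F] [TopologicalSpace F] [IsNonarchimedeanLocalField F]

theorem mem_Kt_iff {x : Mp F} : x ∈ Kt F ↔ ∃ k, toGL k = x.1.mat := Iff.rfl

theorem conj_mem_Kt (ϖ : {x : 𝒪[F] // Irreducible x}) {h : Mp F}
    {k : Matrix.SpecialLinearGroup (Fin 2) 𝒪[F]} (hk : toGL k = h.1.mat) {b : 𝒪[F]}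
    (hb : k.1 0 1 = ϖ.1 ^ 2 * b) :
    (torusTilde (unif ϖ))⁻¹ * h * torusTilde (unif ϖ) ∈ Kt F := by
  have hdet : (!![k.1 0 0, b; ϖ.1 ^ 2 * k.1 1 0, k.1 1 1]).det = 1 := by
    have := det_eq k
    rw [hb] at this
    rw [Matrix.det_fin_two_of]
    linear_combination this
  refine mem_Kt_iff.2 ⟨⟨!![k.1 0 0, b; ϖ.1 ^ 2 * k.1 1 0, k.1 1 1], hdet⟩, ?_⟩
  change _ = (torusTilde (unif ϖ)).1.mat⁻¹ * h.1.mat * (torusTilde (unif ϖ)).1.mat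
  rw [torusTilde_mat, ← hk, mul_assoc, eq_inv_mul_iff_mul_eq]
  have hne : (unif ϖ : F) ≠ 0 := (unif ϖ).ne_zero
  have hv : (unif ϖ : F) = ϖ.1 := rfl
  apply Units.ext
  ext i j
  rw [Units.val_mul, Units.val_mul, Matrix.mul_apply, Matrix.mul_apply, Fin.sum_univ_two,
    Fin.sum_univ_two, diag_entry]
  simp only [toGL_apply]
  fin_cases i <;> fin_cases j <;> simp [hb, ← hv] <;> field_simp <;> rfl

theorem dvd_of_mem_sq (ϖ : {x : 𝒪[F] // Irreducible x}) {x : 𝒪[F]} (hx : x ∈ 𝓂[F] ^ 2) :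
    ∃ b, x = ϖ.1 ^ 2 * b := by
  rw [Irreducible.maximalIdeal_eq ϖ.2, Ideal.span_singleton_pow, Ideal.mem_span_singleton] at hx
  exact hx

/-- `K̃ h̃(ϖ)⁻¹ K̃` is a finite union of cosets `K̃s`. -/
theorem finite_cosets (ϖ : {x : 𝒪[F] // Irreducible x}) :
    ∃ S : Set (Mp F), S.Finite ∧
      ∀ h : Kt F, ∃ s ∈ S, (torusTilde (unif ϖ))⁻¹ * h * s⁻¹ ∈ Kt F := by
  have hk : Finite (𝒪[F] ⧸ 𝓂[F]) := inferInstanceAs (Finite 𝓀[F])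
  have hfin : Finite (𝒪[F] ⧸ 𝓂[F] ^ 2) := Ideal.finite_quotient_pow (IsNoetherian.noetherian _) 2
  let red2 : Matrix.SpecialLinearGroup (Fin 2) 𝒪[F] →
      Matrix.SpecialLinearGroup (Fin 2) (𝒪[F] ⧸ 𝓂[F] ^ 2) :=
    Matrix.SpecialLinearGroup.map (Ideal.Quotient.mk (𝓂[F] ^ 2))
  refine ⟨Set.range fun q => (torusTilde (unif ϖ))⁻¹ * (ktEquiv (Function.invFun red2 q, 1)).1,
    Set.finite_range _, fun h => ?_⟩
  obtain ⟨⟨k, ζ⟩, rfl⟩ := ktEquiv.surjective h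
  refine ⟨_, ⟨red2 k, rfl⟩, ?_⟩
  set k₀ := Function.invFun red2 (red2 k) with hk₀
  have hr : red2 k₀ = red2 k := Function.invFun_eq ⟨k, rfl⟩
  have h1 : red2 (k * k₀⁻¹) = 1 := by
    change Matrix.SpecialLinearGroup.map _ (k * k₀⁻¹) = 1
    rw [map_mul, map_inv]
    change red2 k * (red2 k₀)⁻¹ = 1
    rw [hr, mul_inv_cancel]
  have h2 : (k * k₀⁻¹).1 0 1 ∈ 𝓂[F] ^ 2 := by
    rw [← Ideal.Quotient.eq_zero_iff_mem]
    exact congrArg (fun g : Matrix.SpecialLinearGroup (Fin 2) (𝒪[F] ⧸ 𝓂[F] ^ 2) => g.1 0 1) h1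
  obtain ⟨b, hb⟩ := dvd_of_mem_sq ϖ h2
  have := conj_mem_Kt ϖ (h := (ktEquiv (k, ζ) * (ktEquiv (k₀, 1))⁻¹ : Kt F)) (k := k * k₀⁻¹)
    (by rw [← map_inv, ← map_mul, ktEquiv_mat]; rfl) hb
  rw [mul_inv_rev, inv_inv]
  simpa [mul_assoc] using this

end Finiteness

section Weights

open MvPolynomial

variable {E : Type*} [Field E]

/-- The action of `g` with rows `(a, b)`, `(c, d)` on polynomials in `x, y`:
`(g · P)(x, y) = P(ax + cy, bx + dy)`. -/
noncomputable def polyAct (g : Matrix.SpecialLinearGroup (Fin 2) E) :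
    MvPolynomial (Fin 2) E →ₐ[E] MvPolynomial (Fin 2) E :=
  aeval fun j => C (g.1 0 j) * X 0 + C (g.1 1 j) * X 1

theorem polyAct_one : polyAct (1 : Matrix.SpecialLinearGroup (Fin 2) E) = AlgHom.id E _ := by
  apply MvPolynomial.algHom_ext
  intro j
  fin_cases j <;> simp [polyAct]

theorem polyAct_mul (g h : Matrix.SpecialLinearGroup (Fin 2) E) :
    polyAct (g * h) = (polyAct g).comp (polyAct h) := by
  apply MvPolynomial.algHom_ext
  intro j
  simp only [polyAct, aeval_X, AlgHom.comp_apply, map_add, map_mul, mul_entry, algHom_C]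
  simp only [algebraMap_eq]
  ring

theorem polyAct_homogeneous (g : Matrix.SpecialLinearGroup (Fin 2) E) {n : ℕ}
    {P : MvPolynomial (Fin 2) E} (hP : P.IsHomogeneous n) : (polyAct g P).IsHomogeneous n := by
  have := hP.aeval (fun j => C (g.1 0 j) * X 0 + C (g.1 1 j) * X 1 : Fin 2 → MvPolynomial (Fin 2) E)
    (n := 1) (fun j => (isHomogeneous_C_mul_X _ _).add (isHomogeneous_C_mul_X _ _))
  rwa [one_mul] at this

/-- `Sym^n E²`, realized as the space of homogeneous polynomials of degree `n` in the standard basis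
`x, y` of `E²`. -/
abbrev SymPow (E : Type*) [Field E] (n : ℕ) := homogeneousSubmodule (Fin 2) E n

/-- The representation `Sym^n E²` of `SL₂(E)`. -/
noncomputable def symRep (n : ℕ) :
    Representation E (Matrix.SpecialLinearGroup (Fin 2) E) (SymPow E n) where
  toFun g := (polyAct g).toLinearMap.restrict (p := homogeneousSubmodule (Fin 2) E n)
    (q := homogeneousSubmodule (Fin 2) E n) (fun _ hP => polyAct_homogeneous g hP)
  map_one' := by
    ext P
    simp [polyAct_one]
  map_mul' g h := by
    apply LinearMap.ext
    intro P
    apply Subtype.ext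
    exact congrArg (fun A => A P.1) (polyAct_mul g h)

theorem symRep_apply (n : ℕ) (g : Matrix.SpecialLinearGroup (Fin 2) E) (P : SymPow E n) :
    (symRep n g P).1 = polyAct g P.1 := rfl

/-- The projection of `Sym^n E²` onto the line of `x^n` along the span of the `x^{n-j} y^j`, `j > 0`:
`P ↦ P(1, 0) x^n`. -/
noncomputable def hwProj (n : ℕ) : SymPow E n →ₗ[E] SymPow E n where
  toFun P := ⟨C (eval ![1, 0] P.1) * X 0 ^ n, isHomogeneous_C_mul_X_pow _ _ _⟩
  map_add' P Q := by apply Subtype.ext; simp [add_mul]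
  map_smul' c P := by apply Subtype.ext; simp [mul_assoc, smul_eq_C_mul]

theorem hwProj_apply (n : ℕ) (P : SymPow E n) :
    (hwProj n P).1 = C (eval ![1, 0] P.1) * X 0 ^ n := rfl

theorem eval_homogeneous {n : ℕ} {P : MvPolynomial (Fin 2) E} (hP : P.IsHomogeneous n) (a : E) :
    eval ![a, 0] P = a ^ n * eval ![1, 0] P := by
  rw [eval_eq', eval_eq', Finset.mul_sum]
  apply Finset.sum_congr rfl
  intro d hd
  have hdeg := hP (mem_support_iff.1 hd)
  have hdeg' : d.degree = n := by rw [← hdeg, Finsupp.degree_eq_weight_one]; rfl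
  simp only [Fin.prod_univ_two]
  by_cases h1 : d 1 = 0
  · have h0 : d 0 = n := by
      rw [← hdeg', Finsupp.degree_eq_sum, Fin.sum_univ_two, h1, add_zero]
    simp [h1, h0, mul_comm]
  · simp [h1]

theorem hwProj_comm (n : ℕ) {g g' : Matrix.SpecialLinearGroup (Fin 2) E} (hg : g.1 1 0 = 0)
    (hg' : g'.1 0 1 = 0) (h : g'.1 0 0 = g.1 0 0) :
    symRep n g ∘ₗ hwProj n = hwProj n ∘ₗ symRep n g' := by
  apply LinearMap.ext
  intro P
  apply Subtype.ext
  have h1 : eval ![1, 0] (polyAct g' P.1) = eval ![g'.1 0 0, 0] P.1 := by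
    have h2 : (aeval (![1, 0] : Fin 2 → E)).comp (polyAct g') =
        aeval (![g'.1 0 0, 0] : Fin 2 → E) := by
      apply MvPolynomial.algHom_ext
      intro j
      fin_cases j <;> simp [polyAct, hg']
    exact congrArg (fun A : MvPolynomial (Fin 2) E →ₐ[E] E => A P.1) h2
  rw [LinearMap.comp_apply, LinearMap.comp_apply, symRep_apply, hwProj_apply, hwProj_apply, symRep_apply]
  rw [h1, eval_homogeneous P.2 (g'.1 0 0), h, polyAct]
  simp only [map_mul, map_pow, aeval_X, algHom_C, algebraMap_eq, hg, C_0, zero_mul, add_zero]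
  ring

end Weights

section SerreWeights

variable {F : Type*} [Field F] [ValuativeRel F] [TopologicalSpace F] [IsNonarchimedeanLocalField F]
variable {p : ℕ} [Fact p.Prime] [CharP 𝓀[F] p] {f : ℕ}
variable {E : Type*} [Field E] (ι : 𝓀[F] →+* E) (r : Fin f → Fin p)

/-- The space `⊗_{i<f} Sym^{r_i} E²`. -/
def WeightSpace (E : Type*) [Field E] (r : Fin f → Fin p) : Type _ :=
  PiTensorProduct E fun i : Fin f => SymPow E (r i : ℕ)

noncomputable instance : AddCommGroup (WeightSpace E r) :=
  inferInstanceAs (AddCommGroup (PiTensorProduct E fun i : Fin f => SymPow E (r i : ℕ)))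

noncomputable instance : Module E (WeightSpace E r) :=
  inferInstanceAs (Module E (PiTensorProduct E fun i : Fin f => SymPow E (r i : ℕ)))

/-- The endomorphism `⊗ A_i` of `⊗_{i<f} Sym^{r_i} E²`. -/
noncomputable def weightMap (A : ∀ i : Fin f, SymPow E (r i : ℕ) →ₗ[E] SymPow E (r i : ℕ)) :
    WeightSpace E r →ₗ[E] WeightSpace E r :=
  PiTensorProduct.map A

theorem weightMap_one : weightMap r (fun _ => (1 : SymPow E _ →ₗ[E] SymPow E _)) = 1 :=
  PiTensorProduct.map_one

theorem weightMap_mul (A B : ∀ i : Fin f, SymPow E (r i : ℕ) →ₗ[E] SymPow E (r i : ℕ)) :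
    weightMap r (fun i => A i * B i) = weightMap r A * weightMap r B :=
  PiTensorProduct.map_mul A B

/-- The ring homomorphism `𝒪_F → 𝔨 → E`, `x ↦ ι(x mod ϖ)^{p^i}`. -/
noncomputable def twistedRed (p : ℕ) [Fact p.Prime] [CharP 𝓀[F] p] {E : Type*} [Field E]
    (ι : 𝓀[F] →+* E) (i : ℕ) : 𝒪[F] →+* E :=
  ι.comp ((iterateFrobenius 𝓀[F] p i).comp (IsLocalRing.residue 𝒪[F]))

/-- The representation `σ_r = ⊗_{i<f} (Sym^{r_i} E²)^{Fr^i}` of `SL₂(𝔨)`, inflated to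
`K = SL₂(𝒪_F)`. -/
noncomputable def weightRep :
    Representation E (Matrix.SpecialLinearGroup (Fin 2) 𝒪[F]) (WeightSpace E r) where
  toFun k := weightMap r fun i : Fin f =>
    symRep (r i : ℕ) (Matrix.SpecialLinearGroup.map (twistedRed p ι i) k)
  map_one' := by
    simp only [map_one]
    exact weightMap_one r
  map_mul' k k' := by
    simp only [map_mul]
    exact weightMap_mul r _ _

/-- The sign `ε : μ₂ → Eˣ`, as an endomorphism of the trivial representation. -/
noncomputable def genuineSign (E : Type*) [Field E] (ζ : ℤˣ) : E := ((ζ : ℤ) : E)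

/-- The genuine representation `σ̃_r = σ_r ⊗ ε` of `K̃ ≅ K* × μ₂`. -/
noncomputable def weightRepTilde : Representation E (Kt F) (WeightSpace E r) where
  toFun h := genuineSign E (ktEquiv.symm h).2 • weightRep ι r (ktEquiv.symm h).1
  map_one' := by simp [genuineSign]
  map_mul' h h' := by
    simp [genuineSign, smul_smul, mul_comm]

/-- The projection of `σ_r` onto its highest weight line. It is the composition of
`V → V_{Ū(𝔨)} ≅ V^{U(𝔨)} ⊆ V`, the isomorphism in the middle being the inverse of the map induced by
the identity of `V`. -/
noncomputable def weightProj (E : Type*) [Field E] (r : Fin f → Fin p) :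
    WeightSpace E r →ₗ[E] WeightSpace E r :=
  weightMap r fun i : Fin f => hwProj (r i : ℕ)

theorem weightProj_comm (ϖ : {x : 𝒪[F] // Irreducible x})
    {k k' : Matrix.SpecialLinearGroup (Fin 2) 𝒪[F]} (h00 : k'.1 0 0 = k.1 0 0)
    (h01 : k'.1 0 1 = ϖ.1 ^ 2 * k.1 0 1) (h10 : k.1 1 0 = ϖ.1 ^ 2 * k'.1 1 0) :
    weightRep ι r k ∘ₗ weightProj E r = weightProj E r ∘ₗ weightRep ι r k' := by
  have hred : ∀ (i : ℕ) (x : 𝒪[F]), twistedRed p ι i (ϖ.1 ^ 2 * x) = 0 := by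
    intro i x
    have : IsLocalRing.residue 𝒪[F] ϖ.1 = 0 := by
      rw [IsLocalRing.residue_eq_zero_iff]; exact ϖ.2.not_isUnit
    simp [twistedRed, this]
  change weightMap r _ * weightMap r _ = weightMap r _ * weightMap r _
  rw [← weightMap_mul, ← weightMap_mul]
  congr 1
  funext i
  refine hwProj_comm _ ?_ ?_ ?_
  · change twistedRed p ι i (k.1 1 0) = 0
    rw [h10, hred]
  · change twistedRed p ι i (k'.1 0 1) = 0
    rw [h01, hred]
  · change twistedRed p ι i (k'.1 0 0) = twistedRed p ι i (k.1 0 0)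
    rw [h00]

theorem weightProj_compat (ϖ : {x : 𝒪[F] // Irreducible x}) (h h' : Kt F)
    (e : (h : Mp F) * (torusTilde (unif ϖ))⁻¹ = (torusTilde (unif ϖ))⁻¹ * h') :
    weightRepTilde ι r h ∘ₗ weightProj E r = weightProj E r ∘ₗ weightRepTilde ι r h' := by
  obtain ⟨x, rfl⟩ := ktEquiv.surjective h
  obtain ⟨x', rfl⟩ := ktEquiv.surjective h'
  rw [eq_inv_mul_iff_mul_eq, ← mul_assoc, mul_inv_eq_iff_eq_mul] at e
  obtain ⟨hs, h00, -, h01, h10⟩ := torusTilde_conj e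
  change (genuineSign E (ktEquiv.symm _).2 • weightRep ι r (ktEquiv.symm _).1) ∘ₗ _ =
    _ ∘ₗ (genuineSign E (ktEquiv.symm _).2 • weightRep ι r (ktEquiv.symm _).1)
  rw [ktEquiv.symm_apply_apply, ktEquiv.symm_apply_apply, hs, LinearMap.smul_comp, LinearMap.comp_smul,
    weightProj_comm ι r ϖ h00 h01 h10]

end SerreWeights

section Cokernels

variable {F : Type*} [Field F] [ValuativeRel F] [TopologicalSpace F] [IsNonarchimedeanLocalField F]
variable {p : ℕ} [Fact p.Prime] [CharP 𝓀[F] p] {f : ℕ}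
variable {E : Type*} [Field E] (ι : 𝓀[F] →+* E) (ϖ : {x : 𝒪[F] // Irreducible x})
  (r : Fin f → Fin p)

/-- The element of the Hecke algebra of `(G̃, K̃, σ̃_r)` supported on `K̃ h̃(ϖ)⁻¹ K̃` whose value at
`h̃(ϖ)⁻¹` is the projection onto the highest weight line. -/
noncomputable def heckeGen : HeckeFun (Kt F) (weightRepTilde ι r) :=
  heckeSingle (torusTilde (unif ϖ))⁻¹ (weightProj E r) (weightProj_compat ι r ϖ) (finite_cosets ϖ)

/-- The representation `ind_{K̃} σ̃_r` of `G̃`. -/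
noncomputable abbrev indWeight :
    Representation E (Mp F) (compactInd (Kt F) (weightRepTilde ι r)) :=
  indRep (Kt F) (weightRepTilde ι r)

/-- The representation `(σ̃_r)^α̃` of `K̃'`. -/
noncomputable abbrev weightRepTilde' : Representation E (Kt' ϖ) (WeightSpace E r) :=
  conjRep (conjAlpha ϖ) (weightRepTilde ι r)

/-- The representation `ind_{K̃'} (σ̃_r)^α̃` of `G̃`. -/
noncomputable abbrev indWeight' :
    Representation E (Mp F) (compactInd (Kt' ϖ) (weightRepTilde' ι ϖ r)) :=
  indRep (Kt' ϖ) (weightRepTilde' ι ϖ r)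

/-- The Hecke operator `T` on `ind_{K̃} σ̃_r`. -/
noncomputable def heckeT : (indWeight ι r).IntertwiningMap (indWeight ι r) :=
  heckeOp (heckeGen ι ϖ r)

/-- The Hecke operator `T' = Φ ∘ T ∘ Φ⁻¹` on `ind_{K̃'} (σ̃_r)^α̃`. -/
noncomputable def heckeT' : (indWeight' ι ϖ r).IntertwiningMap (indWeight' ι ϖ r) :=
  conjOp (conjAlpha ϖ) (heckeT ι ϖ r)

/-- The cokernel module `π(r, λ) = ind_{K̃} σ̃_r / (T - λ)`. -/
noncomputable def cokerModule (lam : E) : Representation E (Mp F)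
    (Coker (heckeT ι ϖ r) lam) :=
  cokerRep (heckeT ι ϖ r) lam

/-- The cokernel module `π'(r, λ) = ind_{K̃'} (σ̃_r)^α̃ / (T' - λ)`. -/
noncomputable def cokerModule' (lam : E) : Representation E (Mp F)
    (Coker (heckeT' ι ϖ r) lam) :=
  cokerRep (heckeT' ι ϖ r) lam

end Cokernels

section Properties

variable {F : Type*} [Field F] [ValuativeRel F] [TopologicalSpace F] [IsNonarchimedeanLocalField F]
variable {E : Type*} [Field E] {W : Type*} [AddCommGroup W] [Module E W]

/-- A representation of `G̃` is smooth if the stabilizer of every vector is open. -/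
def IsSmooth (ρ : Representation E (Mp F) W) : Prop :=
  ∀ v : W, IsOpen {g : Mp F | ρ g v = v}

/-- A representation of `G̃` is genuine if `(1, ζ)` acts by the scalar `ζ` for `ζ ∈ μ₂`. -/
def IsGenuine (ρ : Representation E (Mp F) W) : Prop :=
  ∀ (ζ : ℤˣ) (v : W), ρ (central ζ) v = genuineSign E ζ • v

/-- A representation of `G̃` is admissible if the space of vectors fixed by any open subgroup is
finite-dimensional. -/
def IsAdmissible (ρ : Representation E (Mp F) W) : Prop :=
  ∀ H : Subgroup (Mp F), IsOpen (H : Set (Mp F)) →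
    Module.Finite E (Representation.invariants (ρ.comp H.subtype))

end Properties

end MetaplecticSL2

/-!
Let `V = ρ^{K(1)}`, where `K(1)` is the first principal congruence subgroup of `K = SL₂(𝒪_F)`, lifted to
`G̃` by the splitting. It is nonzero because `K(1)` is pro-`p` and `E` has characteristic `p`
(`exists_congruenceFixed_ne_zero`), finite-dimensional by admissibility, and a representation of
`SL₂(𝔨) = K/K(1)`.

Every nonzero finite-dimensional representation of `SL₂(𝔨)` receives a nonzero map from some weight
`σ_r` (`exists_hom_of_finite`). The classification of the irreducible representations is not needed for
this. On a minimal subrepresentation, a functional invariant under lower unipotents gives an embedding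
into the functions of `(a, b) ∈ 𝔨² ∖ 0`, the top row of a matrix. Averages over the upper unipotents and
over the torus show that the image contains the function `aⁿ` for some `0 ≤ n < q`
(`exists_pow_mem_of_invariant`). With `n = ∑ r_i p^i` this is the image of the highest weight vector under
`σ_r → Fun`, `⊗ P_i ↦ ∏ P_i(a^{p^i}, b^{p^i})`, and `σ_r` is generated by its highest weight vector
(`span_highestWeight`), so that the image of `σ_r` lies in that of the subrepresentation.

Since `ρ` is genuine, this gives a nonzero `K̃`-map `σ̃_r → ρ`, hence by Frobenius reciprocity a nonzero
element of `Hom(ind σ̃_r, ρ)`. A homomorphism `ind σ̃_r → ρ` is determined by its value at the function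
supported on `K̃` that is given by the highest weight vector, and this value lies in `V`; so the space of
homomorphisms is finite-dimensional, and the Hecke operator has an eigenvector in it. An eigenvector with
eigenvalue `λ` factors through `π(r, λ)`, and is surjective as `ρ` is irreducible
(`exists_isQuotientOf_cokerRep`).

A parameter with respect to `K̃'` is a parameter with respect to `K̃` of the twist of `ρ` by conjugation
with `α̃` (`IsQuotientOf.conj`). The twist is treated like `ρ`, because conjugation with `α̃` is compatible
with the splitting on small congruence subgroups (`conjAlpha_split`).
-/

namespace MetaplecticSL2

/-! ### Fixed vectors of `p`-groups in characteristic `p` -/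

section FixedVectors

variable {E : Type*} [Field E]
variable {P : Type*} [Group P] {V : Type*} [AddCommGroup V] [Module E V]

/-- In characteristic `p`, a group acting through a `p`-group on a nonzero finite orbit has a nonzero
fixed vector: it acts on the finite `𝔽_p`-span of the orbit, whose number of fixed points is
divisible by `p`. -/
theorem exists_fixed_vector (p : ℕ) [Fact p.Prime] [CharP E p] (ρ : Representation E P V) {v : V}
    (hv : v ≠ 0) (hfin : (Set.range fun g => ρ g v).Finite)
    (hp : ∀ g, ∃ m : ℕ, ∀ h, ρ (g ^ p ^ m) (ρ h v) = ρ h v) :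
    ∃ w ≠ 0, ∀ g, ρ g w = w := by
  let _ : Module (ZMod p) V := Module.compHom V (ZMod.castHom dvd_rfl E)
  have hcast : ∀ (c : ZMod p) (w : V), c • w = (ZMod.castHom dvd_rfl E c : E) • w := fun _ _ => rfl
  let ρ' : P → V →ₗ[ZMod p] V := fun g =>
    { toFun := ρ g
      map_add' := map_add _
      map_smul' := fun c w => by simp only [hcast, map_smul, RingHom.id_apply] }
  set A : Submodule (ZMod p) V := Submodule.span (ZMod p) (Set.range fun g => ρ g v) with hA
  have hstab : ∀ g, A ≤ A.comap (ρ' g) := by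
    intro g
    rw [hA, Submodule.span_le]
    rintro _ ⟨h, rfl⟩
    refine Submodule.subset_span ⟨g * h, ?_⟩
    simp [ρ']
  have : Module.Finite (ZMod p) A := Module.Finite.span_of_finite _ hfin
  have : Finite A := Module.finite_of_finite (ZMod p)
  let act : MulAction P A :=
    { smul := fun g w => ⟨ρ g w, hstab g w.2⟩
      one_smul := fun w => Subtype.ext (by change ρ 1 (w : V) = w; simp)
      mul_smul := fun g h w => Subtype.ext (by
        change ρ (g * h) (w : V) = ρ g (ρ h w); simp) }
  let Q : Subgroup (Equiv.Perm A) := (MulAction.toPermHom P A).range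
  have hQ : IsPGroup p Q := by
    rintro ⟨_, g, rfl⟩
    obtain ⟨m, hm⟩ := hp g
    refine ⟨m, Subtype.ext ?_⟩
    change (MulAction.toPermHom P A g) ^ p ^ m = 1
    rw [← map_pow]
    ext w
    change ρ (g ^ p ^ m) (w : V) = w
    have h1 : A ≤ LinearMap.eqLocus (ρ' (g ^ p ^ m)) LinearMap.id := by
      rw [hA, Submodule.span_le]
      rintro _ ⟨h, rfl⟩
      exact hm h
    exact h1 w.2
  have hvA : v ∈ A := Submodule.subset_span ⟨1, by simp⟩
  have hcard : p ∣ Nat.card A := by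
    have h1 : addOrderOf (⟨v, hvA⟩ : A) = p := by
      refine addOrderOf_eq_prime ?_ (by simpa [Subtype.ext_iff] using hv)
      rw [← Nat.cast_smul_eq_nsmul (ZMod p)]
      simp
    exact h1.symm.dvd.trans (addOrderOf_dvd_natCard _)
  have h0 : (0 : A) ∈ MulAction.fixedPoints Q A := by
    rintro ⟨_, g, rfl⟩
    apply Subtype.ext
    change ρ g ((0 : A) : V) = 0
    simp
  obtain ⟨w, hw, hne⟩ := hQ.exists_fixed_point_of_prime_dvd_card_of_fixed_point A hcard h0
  refine ⟨w, fun h => hne (Subtype.ext h.symm), fun g => ?_⟩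
  exact congrArg Subtype.val (hw ⟨_, g, rfl⟩)

end FixedVectors

/-! ### Frobenius reciprocity and eigenvectors of Hecke operators -/

section FrobeniusReciprocity

variable {G : Type*} [Group G] {E : Type*} [Field E]
variable {V : Type*} [AddCommGroup V] [Module E V] {W : Type*} [AddCommGroup W] [Module E W]
variable {H : Subgroup G} (σ : Representation E H V) (ρ : Representation E G W)

/-- The function `[1, v]` in `ind_H^G σ`: it is supported on `H` and has the value `σ(h)v` at `h`. -/
noncomputable def indSingle (v : V) : compactInd H σ :=
  open Classical in
  ⟨fun g => if h : g ∈ H then σ ⟨g, h⟩ v else 0, by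
    constructor
    · intro h g
      beta_reduce
      by_cases hg : g ∈ H
      · rw [dif_pos hg, dif_pos (H.mul_mem h.2 hg), ← Module.End.mul_apply, ← map_mul]
        rfl
      · rw [dif_neg hg, dif_neg (fun h' => hg ((H.mul_mem_cancel_left h.2).1 h')), map_zero]
    · refine ⟨{1}, Set.finite_singleton _, fun g hg => ⟨1, rfl, ?_⟩⟩
      by_contra h
      exact hg (dif_neg (by simpa using h))⟩

theorem indSingle_of_mem (v : V) {g : G} (hg : g ∈ H) : (indSingle σ v).1 g = σ ⟨g, hg⟩ v :=
  dif_pos hg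

theorem indSingle_of_notMem (v : V) {g : G} (hg : g ∉ H) : (indSingle σ v).1 g = 0 :=
  dif_neg hg

theorem indSingle_smul (h : H) (v : V) : indSingle σ (σ h v) = indRep H σ h (indSingle σ v) := by
  apply Subtype.ext
  funext g
  rw [indRep_apply]
  by_cases hg : g ∈ H
  · rw [indSingle_of_mem σ _ hg, indSingle_of_mem σ _ (H.mul_mem hg h.2), ← Module.End.mul_apply,
      ← map_mul]
    rfl
  · rw [indSingle_of_notMem σ _ hg,
      indSingle_of_notMem σ _ (fun h' => hg ((H.mul_mem_cancel_right h.2).1 h'))]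

/-- `v ↦ [1, v]` as a linear map. -/
noncomputable def indSingleHom : V →ₗ[E] compactInd H σ where
  toFun := indSingle σ
  map_add' v w := by
    apply Subtype.ext
    funext g
    change _ = (indSingle σ v).1 g + (indSingle σ w).1 g
    by_cases hg : g ∈ H
    · simp only [indSingle_of_mem σ _ hg, map_add]
    · simp only [indSingle_of_notMem σ _ hg, add_zero]
  map_smul' c v := by
    apply Subtype.ext
    funext g
    change _ = c • (indSingle σ v).1 g
    by_cases hg : g ∈ H
    · simp only [indSingle_of_mem σ _ hg, map_smul]
    · simp only [indSingle_of_notMem σ _ hg, smul_zero]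

/-- Every `f ∈ ind_H^G σ` is the sum of the `x⁻¹ · [1, f(x)]` over representatives `x` of finitely many
cosets `Hx`. -/
theorem eq_sum_indSingle (f : compactInd H σ) : ∃ S : Finset (Quotient (QuotientGroup.rightRel H)),
    f = ∑ q ∈ S, indRep H σ q.out⁻¹ (indSingle σ (f.1 q.out)) := by
  classical
  obtain ⟨S, hS, hf⟩ := f.2.2
  refine ⟨(hS.image (Quotient.mk (QuotientGroup.rightRel H))).toFinset, ?_⟩
  apply Subtype.ext
  funext g
  have hsum : ∀ T : Finset (Quotient (QuotientGroup.rightRel H)),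
      (∑ q ∈ T, indRep H σ q.out⁻¹ (indSingle σ (f.1 q.out))).1 g =
        ∑ q ∈ T, (indSingle σ (f.1 q.out)).1 (g * q.out⁻¹) := by
    intro T
    rw [AddSubmonoidClass.coe_finsetSum, Finset.sum_apply]
    rfl
  have hval : ∀ q : Quotient (QuotientGroup.rightRel H), Quotient.mk _ g = q →
      (indSingle σ (f.1 q.out)).1 (g * q.out⁻¹) = f.1 g := by
    intro q hq
    have h1 : g * q.out⁻¹ ∈ H := by
      apply QuotientGroup.rightRel_apply.1
      apply Quotient.exact
      rw [Quotient.out_eq, hq]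
    rw [indSingle_of_mem σ _ h1, ← f.2.1]
    simp
  rw [hsum, Finset.sum_eq_single (Quotient.mk _ g), hval _ rfl]
  · intro q _ hq
    apply indSingle_of_notMem
    intro h1
    apply hq
    rw [← Quotient.out_eq q]
    exact Quotient.sound (QuotientGroup.rightRel_apply.2 h1)
  · intro hq
    rw [hval _ rfl]
    by_contra h0
    obtain ⟨s, hs, hgs⟩ := hf g h0
    apply hq
    rw [Set.Finite.mem_toFinset]
    refine ⟨s, hs, Quotient.sound (QuotientGroup.rightRel_apply.2 hgs)⟩

variable {σ ρ}

/-- The term `ρ(x⁻¹)φ(f(x))`, which depends only on the coset `Hx`. -/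
noncomputable def frobeniusTerm (φ : V →ₗ[E] W) (hφ : ∀ (h : H) v, φ (σ h v) = ρ h (φ v))
    (f : compactInd H σ) : Quotient (QuotientGroup.rightRel H) → W :=
  Quotient.lift (fun x => ρ x⁻¹ (φ (f.1 x))) (by
    intro x y hxy
    have h : y * x⁻¹ ∈ H := QuotientGroup.rightRel_apply.1 hxy
    have e1 : f.1 y = σ ⟨y * x⁻¹, h⟩ (f.1 x) := by
      rw [← f.2.1]; simp
    change ρ x⁻¹ (φ (f.1 x)) = ρ y⁻¹ (φ (f.1 y))
    rw [e1, hφ, ← Module.End.mul_apply, ← map_mul]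
    simp)

theorem frobeniusTerm_mk (φ : V →ₗ[E] W) (hφ : ∀ (h : H) v, φ (σ h v) = ρ h (φ v))
    (f : compactInd H σ) (x : G) :
    frobeniusTerm φ hφ f (Quotient.mk _ x) = ρ x⁻¹ (φ (f.1 x)) := rfl

theorem frobeniusTerm_support (φ : V →ₗ[E] W) (hφ : ∀ (h : H) v, φ (σ h v) = ρ h (φ v))
    (f : compactInd H σ) : (Function.support (frobeniusTerm φ hφ f)).Finite := by
  obtain ⟨S, hS, h⟩ := f.2.2
  refine (hS.image (Quotient.mk (QuotientGroup.rightRel H))).subset ?_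
  intro q
  induction q using Quotient.inductionOn with
  | h x =>
    intro hq
    have hx : f.1 x ≠ 0 := by
      intro h0
      apply hq
      rw [frobeniusTerm_mk, h0, map_zero, map_zero]
    obtain ⟨s, hs, h'⟩ := h x hx
    exact ⟨s, hs, Quotient.sound (QuotientGroup.rightRel_apply.2 h')⟩

/-- Frobenius reciprocity: the `G`-homomorphism `f ↦ ∑_{x ∈ H\G} ρ(x⁻¹)φ(f(x))` from `ind_H^G σ` to
`ρ` given by an `H`-homomorphism `φ : σ → ρ`. -/
noncomputable def frobenius (φ : V →ₗ[E] W) (hφ : ∀ (h : H) v, φ (σ h v) = ρ h (φ v)) :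
    (indRep H σ).IntertwiningMap ρ where
  toFun f := ∑ᶠ q, frobeniusTerm φ hφ f q
  map_add' f f' := by
    rw [← finsum_add_distrib (frobeniusTerm_support φ hφ f) (frobeniusTerm_support φ hφ f')]
    apply finsum_congr
    intro q
    induction q using Quotient.inductionOn with
    | h x =>
      simp only [frobeniusTerm_mk, ← map_add]
      rfl
  map_smul' c f := by
    rw [RingHom.id_apply, smul_finsum' c (frobeniusTerm_support φ hφ f)]
    apply finsum_congr
    intro q
    induction q using Quotient.inductionOn with
    | h x =>
      simp only [frobeniusTerm_mk, ← map_smul]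
      rfl
  isIntertwining' y := by
    apply LinearMap.ext
    intro f
    change ∑ᶠ q, frobeniusTerm φ hφ (indRep H σ y f) q = ρ y (∑ᶠ q, frobeniusTerm φ hφ f q)
    -- substitute `x ↦ xy` in the sum
    let e : Quotient (QuotientGroup.rightRel H) ≃ Quotient (QuotientGroup.rightRel H) :=
      Quotient.congr (Equiv.mulRight y) (fun a b => by
        change (QuotientGroup.rightRel H) a b ↔ (QuotientGroup.rightRel H) (a * y) (b * y)
        rw [QuotientGroup.rightRel_apply, QuotientGroup.rightRel_apply]
        simp [mul_assoc])
    have h1 := (ρ y).toAddMonoidHom.map_finsum (frobeniusTerm_support φ hφ f)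
    refine Eq.trans ?_ h1.symm
    rw [← finsum_comp_equiv e (f := fun q => (ρ y).toAddMonoidHom (frobeniusTerm φ hφ f q))]
    apply finsum_congr
    intro q
    induction q using Quotient.inductionOn with
    | h x =>
      change ρ x⁻¹ (φ (f.1 (x * y))) = ρ y (ρ (x * y)⁻¹ (φ (f.1 (x * y))))
      rw [← Module.End.mul_apply, ← map_mul]
      simp

theorem frobenius_indSingle (φ : V →ₗ[E] W) (hφ : ∀ (h : H) v, φ (σ h v) = ρ h (φ v)) (v : V) :
    frobenius φ hφ (indSingle σ v) = φ v := by
  change ∑ᶠ q, frobeniusTerm φ hφ (indSingle σ v) q = φ v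
  rw [finsum_eq_single _ (Quotient.mk _ 1)]
  · rw [frobeniusTerm_mk, indSingle_of_mem σ _ (one_mem H)]
    have : (⟨1, one_mem H⟩ : H) = 1 := rfl
    rw [this]
    simp
  · intro q
    induction q using Quotient.inductionOn with
    | h x =>
      intro hx
      rw [frobeniusTerm_mk, indSingle_of_notMem, map_zero, map_zero]
      intro h
      apply hx
      exact Quotient.sound (QuotientGroup.rightRel_apply.2 (by simpa using H.inv_mem h))

/-- If `σ` is generated by `v₀`, a `G`-homomorphism from `ind_H^G σ` is determined by its value at
`[1, v₀]`. -/
theorem intertwining_eq_zero {v₀ : V} (hcyc : Submodule.span E (Set.range fun h => σ h v₀) = ⊤)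
    (L : (indRep H σ).IntertwiningMap ρ) (hL : L (indSingle σ v₀) = 0) : L = 0 := by
  have hL' : ∀ (g : G) f, L (indRep H σ g f) = ρ g (L f) := fun g f =>
    LinearMap.congr_fun (L.isIntertwining' g) f
  have h1 : ∀ v, L (indSingle σ v) = 0 := by
    have : Submodule.span E (Set.range fun h => σ h v₀) ≤
        LinearMap.ker (L.toLinearMap ∘ₗ indSingleHom σ) := by
      rw [Submodule.span_le]
      rintro _ ⟨h, rfl⟩
      change L (indSingle σ (σ h v₀)) = 0
      rw [indSingle_smul, hL', hL, map_zero]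
    rw [hcyc] at this
    exact fun v => this (Submodule.mem_top (x := v))
  ext f
  obtain ⟨S, hS⟩ := eq_sum_indSingle σ f
  change L f = 0
  rw [hS]
  change L.toLinearMap _ = 0
  rw [map_sum]
  apply Finset.sum_eq_zero
  intro q _
  exact (hL' _ _).trans (by rw [h1, map_zero])

/-- If a nonzero `H`-homomorphism `σ → ρ` exists, where `σ` is generated by a vector `v₀`, and the
vectors of the irreducible representation `ρ` fixed by the stabilizer of `v₀` form a
finite-dimensional space, then `ρ` is a quotient of some `ind_H^G σ / (T - λ)`: the operator `T` acts
on the finite-dimensional space `Hom_G(ind_H^G σ, ρ) ≠ 0`, hence has an eigenvector there. -/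
theorem exists_isQuotientOf_cokerRep [IsAlgClosed E] (hirr : ρ.IsIrreducible)
    (T : (indRep H σ).IntertwiningMap (indRep H σ)) {v₀ : V}
    (hcyc : Submodule.span E (Set.range fun h => σ h v₀) = ⊤) (D : Submodule E W)
    [Module.Finite E D] (hD : ∀ w : W, (∀ h : H, σ h v₀ = v₀ → ρ h w = w) → w ∈ D)
    {φ : V →ₗ[E] W} (hφ : ∀ (h : H) v, φ (σ h v) = ρ h (φ v)) (hne : φ ≠ 0) :
    ∃ lam : E, IsQuotientOf ρ (cokerRep T lam) := by
  have := hirr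
  have hL' : ∀ (L : (indRep H σ).IntertwiningMap ρ) (g : G) f, L (indRep H σ g f) = ρ g (L f) :=
    fun L g f => LinearMap.congr_fun (L.isIntertwining' g) f
  -- evaluation at `[1, v₀]` makes the space of homomorphisms finite-dimensional
  let ev : (indRep H σ).IntertwiningMap ρ →ₗ[E] D :=
    { toFun := fun L => ⟨L (indSingle σ v₀), hD _ (fun h hh => by
        rw [← hL', ← indSingle_smul, hh])⟩
      map_add' := fun _ _ => rfl
      map_smul' := fun _ _ => rfl }
  have hev : Function.Injective ev := by
    rw [injective_iff_map_eq_zero]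
    intro L hL
    exact intertwining_eq_zero hcyc L (congrArg Subtype.val hL)
  have : Module.Finite E ((indRep H σ).IntertwiningMap ρ) := Module.Finite.of_injective ev hev
  have hΦ : frobenius φ hφ ≠ 0 := by
    intro h0
    apply hne
    ext v
    rw [← frobenius_indSingle φ hφ v, h0]
    rfl
  have : Nontrivial ((indRep H σ).IntertwiningMap ρ) := ⟨⟨_, _, hΦ⟩⟩
  let pre : Module.End E ((indRep H σ).IntertwiningMap ρ) :=
    { toFun := fun L => L.comp T
      map_add' := fun _ _ => rfl
      map_smul' := fun _ _ => rfl }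
  obtain ⟨lam, hlam⟩ := Module.End.exists_eigenvalue pre
  obtain ⟨L, hL⟩ := hlam.exists_hasEigenvector
  have hLT : ∀ f, L (T f) = lam • L f := fun f =>
    congrArg (fun A : (indRep H σ).IntertwiningMap ρ => A f) hL.apply_eq_smul
  refine ⟨lam, ⟨?_, ?_⟩, ?_⟩
  · refine Submodule.liftQ _ L.toLinearMap ?_
    rintro _ ⟨f, rfl⟩
    rw [LinearMap.mem_ker, LinearMap.sub_apply, map_sub, LinearMap.smul_apply, map_smul, sub_eq_zero]
    exact hLT f
  · intro g
    apply LinearMap.ext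
    intro q
    obtain ⟨f, rfl⟩ := Submodule.Quotient.mk_surjective _ q
    exact hL' L g f
  · have hs := (Representation.IsIrreducible.surjective_or_eq_zero L).resolve_right hL.2
    intro w
    obtain ⟨f, rfl⟩ := hs w
    exact ⟨Submodule.Quotient.mk f, rfl⟩

end FrobeniusReciprocity

/-! ### Principal congruence subgroups of `SL₂(𝒪_F)` -/

section CongruenceSubgroups

variable (F : Type*) [Field F] [ValuativeRel F] [TopologicalSpace F] [IsNonarchimedeanLocalField F]

/-- The principal congruence subgroup `K(n)` of `K = SL₂(𝒪_F)`, the kernel of reduction modulo `𝔪ⁿ`. -/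
noncomputable def congruence (n : ℕ) : Subgroup (Matrix.SpecialLinearGroup (Fin 2) 𝒪[F]) :=
  (Matrix.SpecialLinearGroup.map (Ideal.Quotient.mk (𝓂[F] ^ n))).ker

variable {F}

theorem mem_congruence_iff {n : ℕ} {k : Matrix.SpecialLinearGroup (Fin 2) 𝒪[F]} :
    k ∈ congruence F n ↔ ∀ i j, (k.1 - 1) i j ∈ 𝓂[F] ^ n := by
  rw [congruence, MonoidHom.mem_ker, Matrix.SpecialLinearGroup.ext_iff]
  refine forall_congr' fun i => forall_congr' fun j => ?_
  rw [Matrix.sub_apply, ← Ideal.Quotient.eq]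
  have h1 : ((1 : Matrix.SpecialLinearGroup (Fin 2) (𝒪[F] ⧸ 𝓂[F] ^ n)).1 i j) =
      Ideal.Quotient.mk (𝓂[F] ^ n) ((1 : Matrix (Fin 2) (Fin 2) 𝒪[F]) i j) := by
    change (1 : Matrix (Fin 2) (Fin 2) (𝒪[F] ⧸ 𝓂[F] ^ n)) i j = _
    simp only [Matrix.one_apply]
    split_ifs <;> simp
  change Ideal.Quotient.mk (𝓂[F] ^ n) (k.1 i j) = (1 : Matrix.SpecialLinearGroup _ _).1 i j ↔ _
  rw [h1]

theorem congruence_antitone : Antitone (congruence F) := by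
  intro m n h k hk
  rw [mem_congruence_iff] at hk ⊢
  exact fun i j => Ideal.pow_le_pow_right h (hk i j)

instance : T2Space F := by
  let _ := IsTopologicalAddGroup.rightUniformSpace F
  have := isUniformAddGroup_of_addCommGroup (G := F)
  infer_instance

theorem isOpen_maximalIdeal_pow (n : ℕ) : IsOpen ((𝓂[F] ^ n : Ideal 𝒪[F]) : Set 𝒪[F]) := by
  have : Finite (𝒪[F] ⧸ 𝓂[F]) := inferInstanceAs (Finite 𝓀[F])
  have hfin : Finite (𝒪[F] ⧸ 𝓂[F] ^ n) := Ideal.finite_quotient_pow (IsNoetherian.noetherian _) n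
  have : Finite (𝒪[F] ⧸ (𝓂[F] ^ n).toAddSubgroup) := hfin
  have : (𝓂[F] ^ n).toAddSubgroup.FiniteIndex := AddSubgroup.finiteIndex_of_finite_quotient
  exact (𝓂[F] ^ n).toAddSubgroup.isOpen_of_isClosed_of_finiteIndex
    (IsNoetherianRing.isClosed_ideal _)

theorem continuous_entry (i j : Fin 2) :
    Continuous fun k : Matrix.SpecialLinearGroup (Fin 2) 𝒪[F] => k.1 i j :=
  continuous_subtype_val.matrix_elem i j

theorem isOpen_congruence (n : ℕ) :
    IsOpen (congruence F n : Set (Matrix.SpecialLinearGroup (Fin 2) 𝒪[F])) := by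
  have : (congruence F n : Set (Matrix.SpecialLinearGroup (Fin 2) 𝒪[F])) =
      ⋂ i, ⋂ j, (fun k => (k.1 - 1) i j) ⁻¹' ((𝓂[F] ^ n : Ideal 𝒪[F]) : Set 𝒪[F]) := by
    ext k
    simp only [SetLike.mem_coe, mem_congruence_iff, Set.mem_iInter, Set.mem_preimage]
  rw [this]
  exact isOpen_iInter_of_finite fun i => isOpen_iInter_of_finite fun j =>
    (isOpen_maximalIdeal_pow n).preimage ((continuous_entry i j).sub continuous_const)

instance : CompactSpace (Matrix.SpecialLinearGroup (Fin 2) 𝒪[F]) := by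
  have : CompactSpace (Matrix (Fin 2) (Fin 2) 𝒪[F]) :=
    inferInstanceAs (CompactSpace (Fin 2 → Fin 2 → 𝒪[F]))
  have h : IsClosed {A : Matrix (Fin 2) (Fin 2) 𝒪[F] | A.det = 1} :=
    isClosed_eq (continuous_id.matrix_det) continuous_const
  exact isCompact_iff_compactSpace.1 h.isCompact

theorem iInf_congruence {k : Matrix.SpecialLinearGroup (Fin 2) 𝒪[F]}
    (hk : ∀ n, k ∈ congruence F n) : k = 1 := by
  apply Subtype.ext
  rw [← sub_eq_zero]
  ext1 i j
  have h : (k.1 - 1) i j ∈ (⨅ n : ℕ, 𝓂[F] ^ n : Ideal 𝒪[F]) :=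
    Ideal.mem_iInf.2 fun n => mem_congruence_iff.1 (hk n) i j
  rwa [Ideal.iInf_pow_eq_bot_of_isLocalRing _ (Ideal.IsPrime.ne_top inferInstance)] at h

/-- The congruence subgroups form a neighbourhood basis of `1`. By compactness of `K` this follows from
`⋂ K(n) = 1`. -/
theorem exists_congruence_subset {U : Set (Matrix.SpecialLinearGroup (Fin 2) 𝒪[F])} (hU : IsOpen U)
    (h1 : 1 ∈ U) : ∃ n, (congruence F n : Set (Matrix.SpecialLinearGroup (Fin 2) 𝒪[F])) ⊆ U := by
  refine exists_subset_nhds_of_compactSpace (V := fun n : ℕ =>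
    (congruence F n : Set (Matrix.SpecialLinearGroup (Fin 2) 𝒪[F]))) ?_ ?_ ?_
  · exact directed_of_isDirected_le fun m n h => congruence_antitone h
  · exact fun n => (congruence F n).isClosed_of_isOpen (isOpen_congruence n)
  · intro k hk
    rw [iInf_congruence (fun n => Set.mem_iInter.1 hk n)]
    exact hU.mem_nhds h1

theorem congruence_finite_quotient (n : ℕ) :
    Finite (Matrix.SpecialLinearGroup (Fin 2) 𝒪[F] ⧸ congruence F n) := by
  have : Finite (𝒪[F] ⧸ 𝓂[F]) := inferInstanceAs (Finite 𝓀[F])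
  have : Finite (𝒪[F] ⧸ 𝓂[F] ^ n) := Ideal.finite_quotient_pow (IsNoetherian.noetherian _) n
  have : Finite (Matrix (Fin 2) (Fin 2) (𝒪[F] ⧸ 𝓂[F] ^ n)) :=
    inferInstanceAs (Finite (Fin 2 → Fin 2 → 𝒪[F] ⧸ 𝓂[F] ^ n))
  have : Finite (Matrix.SpecialLinearGroup (Fin 2) (𝒪[F] ⧸ 𝓂[F] ^ n)) :=
    inferInstanceAs (Finite {A : Matrix (Fin 2) (Fin 2) (𝒪[F] ⧸ 𝓂[F] ^ n) // A.det = 1})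
  exact Finite.of_injective _ (QuotientGroup.kerLift_injective
    (Matrix.SpecialLinearGroup.map (n := Fin 2) (Ideal.Quotient.mk (𝓂[F] ^ n))))

theorem mul_entry_mem {R : Type*} [CommRing R] {I J : Ideal R} {A B : Matrix (Fin 2) (Fin 2) R}
    (hA : ∀ i j, A i j ∈ I) (hB : ∀ i j, B i j ∈ J) (i j : Fin 2) : (A * B) i j ∈ I * J := by
  rw [Matrix.mul_apply]
  exact Ideal.sum_mem _ fun l _ => Ideal.mul_mem_mul (hA i l) (hB l j)

/-- `(1 + X)ᵖ ≡ 1 + Xᵖ` modulo `pX`. -/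
theorem pow_sub_one_entry_mem {R : Type*} [CommRing R] {I : Ideal R} {p : ℕ} (hp : p.Prime)
    (hpI : (p : R) ∈ I) {n : ℕ} {A : Matrix (Fin 2) (Fin 2) R}
    (hA : ∀ i j, (A - 1) i j ∈ I ^ (n + 1)) (i j : Fin 2) : (A ^ p - 1) i j ∈ I ^ (n + 2) := by
  set X := A - 1 with hX
  obtain ⟨r, hr⟩ := (Commute.one_left X).exists_add_pow_prime_eq hp
  have hk1 : A ^ p - 1 = X * X ^ (p - 1) + (p : Matrix (Fin 2) (Fin 2) R) * (X * r) := by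
    rw [show A = 1 + X by rw [hX]; abel, hr, one_pow, mul_one,
      ← pow_succ', Nat.sub_add_cancel hp.one_le, mul_assoc]
    abel
  have hright : ∀ (J : Ideal R) (B C : Matrix (Fin 2) (Fin 2) R), (∀ i j, B i j ∈ J) →
      ∀ i j, (B * C) i j ∈ J := by
    intro J B C hB i j
    rw [Matrix.mul_apply]
    exact J.sum_mem fun l _ => J.mul_mem_right _ (hB i l)
  have hX1 : ∀ i j, X i j ∈ I := fun i j => Ideal.pow_le_self (Nat.succ_ne_zero n) (hA i j)
  rw [hk1, Matrix.add_apply]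
  refine add_mem ?_ ?_
  · rw [pow_succ]
    refine mul_entry_mem hA ?_ i j
    rw [show p - 1 = (p - 2) + 1 by have := hp.two_le; omega, pow_succ']
    exact hright I X _ hX1
  · rw [← nsmul_eq_mul, Matrix.smul_apply, nsmul_eq_mul, pow_succ']
    exact Ideal.mul_mem_mul hpI (hright _ X r hA i j)

variable (p : ℕ) [Fact p.Prime] [CharP 𝓀[F] p]

theorem natCast_mem_maximalIdeal : (p : 𝒪[F]) ∈ 𝓂[F] := by
  rw [← IsLocalRing.residue_eq_zero_iff, map_natCast, CharP.cast_eq_zero]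

theorem pow_mem_congruence {n : ℕ} {k : Matrix.SpecialLinearGroup (Fin 2) 𝒪[F]}
    (hk : k ∈ congruence F (n + 1)) : k ^ p ∈ congruence F (n + 2) := by
  rw [mem_congruence_iff] at hk ⊢
  rw [Matrix.SpecialLinearGroup.coe_pow]
  exact pow_sub_one_entry_mem Fact.out (natCast_mem_maximalIdeal p) hk

theorem pow_pow_mem_congruence {k : Matrix.SpecialLinearGroup (Fin 2) 𝒪[F]}
    (hk : k ∈ congruence F 1) (n : ℕ) : k ^ p ^ n ∈ congruence F (n + 1) := by
  induction n with
  | zero => simpa using hk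
  | succ n ih =>
    rw [pow_succ, pow_mul]
    exact pow_mem_congruence p ih

end CongruenceSubgroups

/-! ### Surjectivity of reduction on `SL₂` -/

section Reduction

variable {F : Type*} [Field F] [ValuativeRel F] [TopologicalSpace F] [IsNonarchimedeanLocalField F]

theorem congruence_one : congruence F 1 =
    (Matrix.SpecialLinearGroup.map (n := Fin 2) (IsLocalRing.residue 𝒪[F])).ker := by
  ext k
  rw [mem_congruence_iff, MonoidHom.mem_ker, Matrix.SpecialLinearGroup.ext_iff]
  refine forall_congr' fun i => forall_congr' fun j => ?_
  have h1 : ((1 : Matrix.SpecialLinearGroup (Fin 2) 𝓀[F]).1 i j) =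
      IsLocalRing.residue 𝒪[F] ((1 : Matrix (Fin 2) (Fin 2) 𝒪[F]) i j) := by
    change (1 : Matrix (Fin 2) (Fin 2) 𝓀[F]) i j = _
    simp only [Matrix.one_apply]
    split_ifs <;> simp
  rw [pow_one, Matrix.sub_apply, ← IsLocalRing.residue_eq_zero_iff, map_sub, ← h1, sub_eq_zero]
  rfl

theorem SL_map_surjective {R k : Type*} [CommRing R] [Field k] (π : R →+* k)
    (hπ : Function.Surjective π) :
    Function.Surjective (Matrix.SpecialLinearGroup.map (n := Fin 2) π) := by
  rw [← MonoidHom.range_eq_top, Subgroup.eq_top_iff']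
  set M := (Matrix.SpecialLinearGroup.map (n := Fin 2) π).range
  have hu : ∀ x : k, upper x ∈ M := by
    intro x
    obtain ⟨y, rfl⟩ := hπ x
    refine ⟨upper y, ?_⟩
    ext i j
    fin_cases i <;> fin_cases j <;>
      simp [Matrix.SpecialLinearGroup.map_apply_coe, upper_entry]
  have hl : ∀ x : k, lower x ∈ M := by
    intro x
    obtain ⟨y, rfl⟩ := hπ x
    refine ⟨lower y, ?_⟩
    ext i j
    fin_cases i <;> fin_cases j <;>
      simp [Matrix.SpecialLinearGroup.map_apply_coe, lower_entry]
  have hne : ∀ g : Matrix.SpecialLinearGroup (Fin 2) k, g.1 1 0 ≠ 0 → g ∈ M := by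
    intro g hg
    have hdet : g.1 0 0 * g.1 1 1 - g.1 0 1 * g.1 1 0 = 1 := by
      rw [← Matrix.det_fin_two]; exact g.2
    have : g = upper ((g.1 0 0 - 1) / g.1 1 0) * lower (g.1 1 0) *
        upper ((g.1 1 1 - 1) / g.1 1 0) := by
      apply Subtype.ext
      ext i j
      fin_cases i <;> fin_cases j <;> simp only [mul_entry, lower_entry, upper_entry] <;> simp
      · field_simp; ring
      · field_simp; linear_combination -hdet
      · field_simp; ring
    rw [this]
    exact mul_mem (mul_mem (hu _) (hl _)) (hu _)
  intro g
  by_cases hg : g.1 1 0 = 0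
  · have h1 : lower 1 * g ∈ M := by
      apply hne
      have hdet : g.1 0 0 * g.1 1 1 - g.1 0 1 * g.1 1 0 = 1 := by
        rw [← Matrix.det_fin_two]; exact g.2
      rw [mul_entry, lower_entry]
      simp only [Matrix.of_apply, Matrix.cons_val', Matrix.cons_val_zero, Matrix.cons_val_one]
      intro h0
      rw [hg] at hdet h0
      simp only [mul_zero, add_zero, sub_zero, one_mul] at hdet h0
      rw [h0] at hdet
      simp at hdet
    exact (Subgroup.mul_mem_cancel_left _ (hl 1)).1 h1
  · exact hne g hg

end Reduction

/-! ### Vectors fixed by congruence subgroups -/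

section Smoothness

variable {F : Type*} [Field F] [ValuativeRel F] [TopologicalSpace F] [IsNonarchimedeanLocalField F]
variable {E : Type*} [Field E] {W : Type*} [AddCommGroup W] [Module E W]
variable {ρ : Representation E (Mp F) W}

/-- The subgroup of `K*` corresponding to `K(n)` is open in `G̃`. -/
theorem isOpen_map_congruence (n : ℕ) : IsOpen ((congruence F n).map split : Set (Mp F)) := by
  rw [Mp_isOpen_iff]
  intro g
  rw [isOpen_iff_mem_nhds]
  intro k hk
  have h1 : IsOpen ((fun x => k⁻¹ * x) ⁻¹'
      (congruence F n : Set (Matrix.SpecialLinearGroup (Fin 2) 𝒪[F]))) :=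
    (isOpen_congruence n).preimage (continuous_const.mul continuous_id)
  refine Filter.mem_of_superset (h1.mem_nhds (by simp [one_mem])) fun x hx => ?_
  have h2 : g * split x = g * split k * split (k⁻¹ * x) := by
    rw [mul_assoc, ← map_mul, mul_inv_cancel_left]
  change g * split x ∈ (congruence F n).map split
  rw [h2]
  exact mul_mem hk ⟨_, hx, rfl⟩

theorem IsSmooth.exists_congruence (h : IsSmooth ρ) (v : W) :
    ∃ n, ∀ k ∈ congruence F n, ρ (split k) v = v := by
  have h1 := (Mp_isOpen_iff _).1 (h v) 1
  simp only [one_mul] at h1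
  obtain ⟨n, hn⟩ := exists_congruence_subset h1 (by simp)
  exact ⟨n, fun k hk => hn hk⟩

/-- The space of vectors fixed by `K(n)`. -/
def congruenceFixed (ρ : Representation E (Mp F) W) (n : ℕ) : Submodule E W where
  carrier := {w | ∀ k ∈ congruence F n, ρ (split k) w = w}
  zero_mem' := fun k _ => map_zero _
  add_mem' hv hw k hk := by rw [map_add, hv k hk, hw k hk]
  smul_mem' c w hw k hk := by rw [map_smul, hw k hk]

theorem IsAdmissible.finite_congruenceFixed (h : IsAdmissible ρ) (n : ℕ) :
    Module.Finite E (congruenceFixed ρ n) := by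
  have h1 := h _ (isOpen_map_congruence n)
  have h2 : congruenceFixed ρ n =
      Representation.invariants (ρ.comp ((congruence F n).map split).subtype) := by
    ext w
    rw [Representation.mem_invariants]
    constructor
    · rintro hw ⟨_, k, hk, rfl⟩
      exact hw k hk
    · intro hw k hk
      exact hw ⟨_, k, hk, rfl⟩
  rw [h2]
  exact h1

/-- A nonzero smooth representation has nonzero vectors fixed by `K(1)`, because `K(1)` is a pro-`p`
group. -/
theorem exists_congruenceFixed_ne_zero (p : ℕ) [Fact p.Prime] [CharP 𝓀[F] p] [CharP E p]
    [Nontrivial W] (h : ∀ v : W, ∃ n, ∀ k ∈ congruence F n, ρ (split k) v = v) :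
    ∃ w ∈ congruenceFixed ρ 1, w ≠ 0 := by
  obtain ⟨v, hv⟩ := exists_ne (0 : W)
  obtain ⟨n, hn⟩ := h v
  have hnormal : (congruence F n).Normal := by rw [congruence]; infer_instance
  have hfix : ∀ g ∈ congruence F n, ∀ k, ρ (split g) (ρ (split k) v) = ρ (split k) v := by
    intro g hg k
    have h1 := hn (k⁻¹ * g * k) (by simpa using hnormal.conj_mem g hg k⁻¹)
    rw [← Module.End.mul_apply, ← map_mul, ← map_mul, show g * k = k * (k⁻¹ * g * k) by group,
      map_mul, map_mul, Module.End.mul_apply, h1]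
  let τ : Representation E (congruence F 1) W := ρ.comp (split.comp (congruence F 1).subtype)
  obtain ⟨w, hw, hw'⟩ := exists_fixed_vector p τ hv (by
    have := congruence_finite_quotient (F := F) n
    let q : Matrix.SpecialLinearGroup (Fin 2) 𝒪[F] ⧸ congruence F n → W :=
      Quotient.lift (fun k => ρ (split k) v) (by
        intro a b hab
        have h2 := hn _ (QuotientGroup.leftRel_apply.1 hab)
        change ρ (split a) v = ρ (split b) v
        rw [map_mul, map_inv, map_mul, Module.End.mul_apply] at h2
        have h3 := congrArg (ρ (split a)) h2
        rw [← Module.End.mul_apply, ← map_mul, mul_inv_cancel, map_one] at h3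
        exact h3.symm)
    refine (Set.finite_range q).subset ?_
    rintro _ ⟨k, rfl⟩
    exact ⟨Quotient.mk _ k.1, rfl⟩) (by
    intro g
    refine ⟨n, fun k => ?_⟩
    have h2 : (g ^ p ^ n).1 ∈ congruence F n :=
      congruence_antitone (Nat.le_succ n) (pow_pow_mem_congruence p g.2 n)
    exact hfix _ h2 k.1)
  exact ⟨w, fun k hk => hw' ⟨k, hk⟩, hw⟩

end Smoothness

/-! ### Weights as representations of `SL₂(k)` -/

section FiniteWeights

open MvPolynomial

variable {k : Type*} [Field k] {p : ℕ} [Fact p.Prime] [CharP k p] {f : ℕ}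
variable {E : Type*} [Field E] (ι : k →+* E) (r : Fin f → Fin p)

/-- The embedding `x ↦ ι(x)^{p^i}` of `k` into `E`. -/
noncomputable def twistedEmb (p : ℕ) [Fact p.Prime] [CharP k p] (ι : k →+* E) (i : ℕ) : k →+* E :=
  ι.comp (iterateFrobenius k p i)

theorem twistedEmb_apply (i : ℕ) (x : k) : twistedEmb p ι i x = ι x ^ p ^ i := by
  simp [twistedEmb, iterateFrobenius_def]

/-- The representation `⊗_{i<f} (Sym^{r_i} E²)^{Fr^i}` of `SL₂(k)`. -/
noncomputable def finiteWeightRep :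
    Representation E (Matrix.SpecialLinearGroup (Fin 2) k) (WeightSpace E r) where
  toFun g := weightMap r fun i : Fin f =>
    symRep (r i : ℕ) (Matrix.SpecialLinearGroup.map (twistedEmb p ι i) g)
  map_one' := by
    simp only [map_one]
    exact weightMap_one r
  map_mul' g g' := by
    simp only [map_mul]
    exact weightMap_mul r _ _

/-- Pure tensors in `⊗_{i<f} Sym^{r_i} E²`. -/
noncomputable def pureTensor (E : Type*) [Field E] (r : Fin f → Fin p) :
    MultilinearMap E (fun i : Fin f => SymPow E (r i : ℕ)) (WeightSpace E r) :=
  PiTensorProduct.tprod E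

theorem span_pureTensor : Submodule.span E (Set.range (pureTensor E r)) = ⊤ :=
  PiTensorProduct.span_tprod_eq_top

theorem finiteWeightRep_pureTensor (g : Matrix.SpecialLinearGroup (Fin 2) k)
    (P : ∀ i : Fin f, SymPow E (r i : ℕ)) :
    finiteWeightRep ι r g (pureTensor E r P) = pureTensor E r fun i =>
      symRep (r i : ℕ) (Matrix.SpecialLinearGroup.map (twistedEmb p ι i) g) (P i) :=
  PiTensorProduct.map_tprod _ _

/-- The monomial `x^{n-j} y^j` of `Sym^n E²`, and zero if `j > n`. -/
noncomputable def symMonomial (E : Type*) [Field E] (n j : ℕ) : SymPow E n :=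
  if h : j ≤ n then ⟨X 0 ^ (n - j) * X 1 ^ j, by
    have := (isHomogeneous_X_pow (R := E) (0 : Fin 2) (n - j)).mul
      (isHomogeneous_X_pow (R := E) (1 : Fin 2) j)
    rwa [Nat.sub_add_cancel h] at this⟩ else 0

theorem symMonomial_val {n j : ℕ} (h : j ≤ n) :
    (symMonomial E n j).1 = X 0 ^ (n - j) * X 1 ^ j := by
  rw [symMonomial, dif_pos h]

theorem symMonomial_of_lt {n j : ℕ} (h : n < j) : symMonomial E n j = 0 :=
  dif_neg (not_le.2 h)

theorem symRep_lower {n : ℕ} (hn : n < p) (c : E) :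
    symRep n (lower c) (symMonomial E n 0) =
      ∑ j : Fin p, c ^ (j : ℕ) • ((n.choose j : E) • symMonomial E n j) := by
  apply Subtype.ext
  rw [AddSubmonoidClass.coe_finsetSum]
  have h1 : polyAct (lower c) (symMonomial E n 0).1 = (C c * X 1 + X 0) ^ n := by
    rw [symMonomial_val (Nat.zero_le n)]
    simp [polyAct, lower_entry, add_comm]
  rw [symRep_apply, h1, add_pow]
  rw [Fin.sum_univ_eq_sum_range
    (fun j => ((c ^ j • ((n.choose j : E) • symMonomial E n j) : SymPow E n) : MvPolynomial (Fin 2) E)) p]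
  rw [← Finset.sum_subset (Finset.range_mono hn)]
  · apply Finset.sum_congr rfl
    intro j hj
    have hj' : j ≤ n := Nat.lt_succ_iff.1 (Finset.mem_range.1 hj)
    rw [Submodule.coe_smul, Submodule.coe_smul, symMonomial_val hj', smul_eq_C_mul, smul_eq_C_mul,
      mul_pow, map_pow, map_natCast]
    ring
  · intro j _ hj
    have hj' : n < j := by simpa [Nat.lt_succ_iff] using hj
    rw [symMonomial_of_lt hj']
    simp

theorem eq_sum_symMonomial {n : ℕ} (hn : n < p) (P : SymPow E n) :
    ∃ a : Fin p → E, P = ∑ j, a j • symMonomial E n j := by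
  refine ⟨fun j => coeff (Finsupp.single 0 (n - j) + Finsupp.single 1 (j : ℕ)) P.1, ?_⟩
  apply Subtype.ext
  rw [AddSubmonoidClass.coe_finsetSum]
  have hval : ∀ j, j ≤ n → (symMonomial E n j).1 =
      monomial (Finsupp.single 0 (n - j) + Finsupp.single 1 j) 1 := by
    intro j hj
    rw [symMonomial_val hj, X_pow_eq_monomial, X_pow_eq_monomial, monomial_mul, one_mul]
  ext d
  rw [coeff_sum]
  by_cases hd : d.degree = n
  · have hd2 : d 0 + d 1 = n := by rw [← hd, Finsupp.degree_eq_sum, Fin.sum_univ_two]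
    have hd1 : d 1 ≤ n := by omega
    have hdd : Finsupp.single 0 (n - d 1) + Finsupp.single 1 (d 1) = d := by
      ext i
      fin_cases i
      · simp; omega
      · simp
    rw [Finset.sum_eq_single (⟨d 1, by omega⟩ : Fin p)]
    · rw [Submodule.coe_smul, hval _ hd1]
      simp only [hdd, coeff_smul, coeff_monomial, if_true, smul_eq_mul, mul_one]
    · intro j _ hj
      rw [Submodule.coe_smul, coeff_smul]
      by_cases hjn : (j : ℕ) ≤ n
      · rw [hval _ hjn, coeff_monomial, if_neg, smul_zero]
        intro h
        apply hj
        apply Fin.ext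
        have := DFunLike.congr_fun h 1
        simpa using this
      · rw [symMonomial_of_lt (not_le.1 hjn)]
        simp
    · simp
  · rw [show coeff d P.1 = 0 from ?_]
    · symm
      apply Finset.sum_eq_zero
      intro j _
      by_cases hjn : (j : ℕ) ≤ n
      · rw [Submodule.coe_smul, hval _ hjn, coeff_smul, coeff_monomial, if_neg, smul_zero]
        rintro rfl
        apply hd
        rw [Finsupp.degree_eq_sum, Fin.sum_univ_two]
        simp
        omega
      · rw [symMonomial_of_lt (not_le.1 hjn)]
        simp
    · by_contra h
      have := P.2 h
      apply hd
      rw [← this, Finsupp.degree_eq_weight_one]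
      rfl

/-- The highest weight vector `⊗ x^{r_i}`. -/
noncomputable def highestWeight (E : Type*) [Field E] (r : Fin f → Fin p) : WeightSpace E r :=
  pureTensor E r fun i => symMonomial E (r i) 0

/-- If `∑_m x^m w_m` lies in a submodule for `n` distinct values of `x`, where `m < n`, all `w_m` lie in
it, by inverting a Vandermonde matrix. -/
theorem mem_of_forall_sum_pow_smul_mem {V : Type*} [AddCommGroup V] [Module E V] {n : ℕ}
    {x : Fin n → E} (hx : Function.Injective x) (w : Fin n → V) (S : Submodule E V)
    (h : ∀ a, ∑ m : Fin n, x a ^ (m : ℕ) • w m ∈ S) (m : Fin n) : w m ∈ S := by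
  have hdet : IsUnit (Matrix.vandermonde x).det :=
    (Matrix.det_vandermonde_ne_zero_iff.2 hx).isUnit
  have h1 := Matrix.nonsing_inv_mul _ hdet
  have h2 : w m = ∑ a, (Matrix.vandermonde x)⁻¹ m a • ∑ l : Fin n, x a ^ (l : ℕ) • w l := by
    have h3 : ∀ l : Fin n, ∑ a, (Matrix.vandermonde x)⁻¹ m a * x a ^ (l : ℕ) =
        (1 : Matrix (Fin n) (Fin n) E) m l := by
      intro l
      rw [← h1, Matrix.mul_apply]
      rfl
    simp only [Finset.smul_sum, smul_smul]
    rw [Finset.sum_comm]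
    simp only [← Finset.sum_smul, h3, Matrix.one_apply, ite_smul, one_smul, zero_smul]
    simp
  rw [h2]
  exact S.sum_mem fun a _ => S.smul_mem _ (h a)

/-- The weight `⊗_{i<f} (Sym^{r_i} E²)^{Fr^i}` is generated by its highest weight vector: the
translates by lower unipotents are `∑_j c^{∑ j_i p^i} ∏ (r_i choose j_i) ⊗ x^{r_i - j_i} y^{j_i}`, where
the exponents of `c` are distinct and less than `q`, so that each term lies in their span. -/
theorem span_highestWeight (hq : Nat.card k = p ^ f) :
    Submodule.span E (Set.range fun g => finiteWeightRep ι r g (highestWeight E r)) = ⊤ := by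
  have hp := Fact.out (p := p.Prime)
  have : Finite k := Nat.finite_of_card_ne_zero (by rw [hq]; exact (pow_pos hp.pos f).ne')
  have : CharP E p := charP_of_injective_ringHom ι.injective p
  set S := Submodule.span E (Set.range fun g => finiteWeightRep ι r g (highestWeight E r)) with hS
  let mon : (Fin f → Fin p) → WeightSpace E r := fun j =>
    pureTensor E r fun i => symMonomial E (r i) (j i)
  let bin : (Fin f → Fin p) → E := fun j => ∏ i, ((r i : ℕ).choose (j i) : E)
  have hact : ∀ c : k, finiteWeightRep ι r (lower c) (highestWeight E r) =
      ∑ m : Fin (p ^ f), ι c ^ (m : ℕ) •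
        (bin (finFunctionFinEquiv.symm m) • mon (finFunctionFinEquiv.symm m)) := by
    intro c
    have h1 : ∀ i : ℕ, Matrix.SpecialLinearGroup.map (twistedEmb p ι i) (lower c) =
        lower (ι c ^ p ^ i) := by
      intro i
      ext a b
      fin_cases a <;> fin_cases b <;>
        simp [Matrix.SpecialLinearGroup.map_apply_coe, lower_entry, twistedEmb_apply, hp.ne_zero]
    rw [highestWeight, finiteWeightRep_pureTensor]
    simp only [h1, symRep_lower (r _).2]
    rw [MultilinearMap.map_sum, ← finFunctionFinEquiv.sum_comp]
    apply Finset.sum_congr rfl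
    intro j _
    rw [Equiv.symm_apply_apply, MultilinearMap.map_smul_univ, MultilinearMap.map_smul_univ,
      finFunctionFinEquiv_apply, ← Finset.prod_pow_eq_pow_sum]
    congr 1
    exact Finset.prod_congr rfl fun i _ => by rw [← pow_mul, mul_comm]
  let e : k ≃ Fin (p ^ f) := Finite.equivFinOfCardEq hq
  have hmem : ∀ m : Fin (p ^ f),
      bin (finFunctionFinEquiv.symm m) • mon (finFunctionFinEquiv.symm m) ∈ S := by
    refine mem_of_forall_sum_pow_smul_mem (x := fun a => ι (e.symm a))
      (ι.injective.comp e.symm.injective) _ S fun a => ?_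
    rw [← hact]
    exact Submodule.subset_span ⟨_, rfl⟩
  have hmon : ∀ j, mon j ∈ S := by
    intro j
    by_cases hj : ∀ i, j i ≤ r i
    · have h1 := hmem (finFunctionFinEquiv j)
      rw [Equiv.symm_apply_apply] at h1
      refine (S.smul_mem_iff ?_).1 h1
      refine Finset.prod_ne_zero_iff.2 fun i _ => ?_
      rw [Ne, CharP.cast_eq_zero_iff E p]
      intro hdvd
      have h2 := (Nat.choose_pos (show (j i : ℕ) ≤ r i from hj i)).ne'
      have h3 : p ∣ (r i : ℕ).factorial := by
        rw [← Nat.choose_mul_factorial_mul_factorial (show (j i : ℕ) ≤ r i from hj i), mul_assoc]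
        exact Dvd.dvd.mul_right hdvd _
      exact absurd (hp.dvd_factorial.1 h3) (not_le.2 (r i).2)
    · push Not at hj
      obtain ⟨i, hi⟩ := hj
      have : mon j = 0 := MultilinearMap.map_coord_zero _ i (symMonomial_of_lt hi)
      rw [this]
      exact S.zero_mem
  rw [eq_top_iff, ← span_pureTensor, Submodule.span_le]
  rintro _ ⟨P, rfl⟩
  choose a ha using fun i => eq_sum_symMonomial (E := E) (r i).2 (P i)
  rw [show P = fun i => ∑ j, a i j • symMonomial E (r i) j from funext ha, MultilinearMap.map_sum]
  refine S.sum_mem fun j _ => ?_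
  rw [MultilinearMap.map_smul_univ]
  exact S.smul_mem _ (hmon j)

/-- The map from `⊗_{i<f} Sym^{r_i} E²` to functions on `SL₂(k)` sending `⊗ P_i` to
`h ↦ ∏ P_i(a^{p^i}, b^{p^i})`, where `(a, b)` is the top row of `h`. -/
noncomputable def weightFun :
    WeightSpace E r →ₗ[E] (Matrix.SpecialLinearGroup (Fin 2) k → E) :=
  LinearMap.pi fun h => PiTensorProduct.lift
    ((MultilinearMap.mkPiAlgebra E (Fin f) E).compLinearMap fun i =>
      (aeval (fun j => twistedEmb p ι i (h.1 0 j)) : MvPolynomial (Fin 2) E →ₐ[E] E).toLinearMap ∘ₗ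
        (homogeneousSubmodule (Fin 2) E (r i : ℕ)).subtype)

theorem weightFun_pureTensor (P : ∀ i : Fin f, SymPow E (r i : ℕ))
    (h : Matrix.SpecialLinearGroup (Fin 2) k) :
    weightFun ι r (pureTensor E r P) h =
      ∏ i : Fin f, aeval (fun j => twistedEmb p ι i (h.1 0 j)) (P i).1 :=
  PiTensorProduct.lift.tprod _

theorem weightFun_highestWeight (h : Matrix.SpecialLinearGroup (Fin 2) k) :
    weightFun ι r (highestWeight E r) h = ι (h.1 0 0) ^ (finFunctionFinEquiv r : ℕ) := by
  rw [highestWeight, weightFun_pureTensor, finFunctionFinEquiv_apply, ← Finset.prod_pow_eq_pow_sum]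
  refine Finset.prod_congr rfl fun i _ => ?_
  rw [symMonomial_val (Nat.zero_le _)]
  simp [twistedEmb_apply, ← pow_mul, mul_comm]

/-- `weightFun` intertwines the action on the weight with right translation. -/
theorem weightFun_equivariant (g : Matrix.SpecialLinearGroup (Fin 2) k) (s : WeightSpace E r)
    (h : Matrix.SpecialLinearGroup (Fin 2) k) :
    weightFun ι r (finiteWeightRep ι r g s) h = weightFun ι r s (h * g) := by
  have h1 : LinearMap.proj h ∘ₗ weightFun ι r ∘ₗ finiteWeightRep ι r g =
      LinearMap.proj (h * g) ∘ₗ weightFun ι r := by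
    refine LinearMap.ext_on_range (span_pureTensor (E := E) r) fun P => ?_
    change weightFun ι r (finiteWeightRep ι r g (pureTensor E r P)) h =
      weightFun ι r (pureTensor E r P) (h * g)
    rw [finiteWeightRep_pureTensor, weightFun_pureTensor, weightFun_pureTensor]
    refine Finset.prod_congr rfl fun i _ => ?_
    rw [symRep_apply]
    refine congrArg (fun A : MvPolynomial (Fin 2) E →ₐ[E] E => A (P i).1)
      (?_ : AlgHom.comp (aeval _) (polyAct _) = aeval _)
    apply MvPolynomial.algHom_ext
    intro j
    simp only [polyAct, AlgHom.comp_apply, aeval_X, map_add, map_mul, algHom_C, mul_entry,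
      Matrix.SpecialLinearGroup.map_apply_coe, RingHom.mapMatrix_apply, Matrix.map_apply,
      Algebra.algebraMap_self, RingHom.id_apply]
    ring
  exact LinearMap.congr_fun h1 s

end FiniteWeights

/-! ### Functions on `SL₂(k)` modulo lower unipotents -/

section FunctionsOnSL2

open Matrix (SpecialLinearGroup)

variable {k : Type*} [Field k] {E : Type*} [Field E] (ι : k →+* E)

/-- The element `diag(t, t⁻¹)`. -/
def torus (t : kˣ) : SpecialLinearGroup (Fin 2) k :=
  ⟨!![(t : k), 0; 0, ((t⁻¹ : kˣ) : k)], by simp [Matrix.det_fin_two_of]⟩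

/-- The element with rows `(0, t)`, `(-t⁻¹, 0)`. -/
def antitorus (t : kˣ) : SpecialLinearGroup (Fin 2) k :=
  ⟨!![0, (t : k); -((t⁻¹ : kˣ) : k), 0], by simp [Matrix.det_fin_two_of]⟩

theorem torus_entry (t : kˣ) : (torus t).1 = !![(t : k), 0; 0, ((t⁻¹ : kˣ) : k)] := rfl

theorem antitorus_entry (t : kˣ) : (antitorus t).1 = !![0, (t : k); -((t⁻¹ : kˣ) : k), 0] := rfl

/-- A function on `SL₂(k)` that is left invariant under lower unipotents depends only on the top row. -/
theorem eq_of_top_row_eq {α : Type*} {φ : SpecialLinearGroup (Fin 2) k → α}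
    (hφ : ∀ c h, φ (lower c * h) = φ h) {h h' : SpecialLinearGroup (Fin 2) k}
    (h0 : h.1 0 0 = h'.1 0 0) (h1 : h.1 0 1 = h'.1 0 1) : φ h = φ h' := by
  have d : h.1 0 0 * h.1 1 1 - h.1 0 1 * h.1 1 0 = 1 := by
    rw [← Matrix.det_fin_two]; exact h.2
  have d' : h'.1 0 0 * h'.1 1 1 - h'.1 0 1 * h'.1 1 0 = 1 := by
    rw [← Matrix.det_fin_two]; exact h'.2
  rw [← h0, ← h1] at d'
  have : h = lower (h.1 1 0 * h'.1 1 1 - h.1 1 1 * h'.1 1 0) * h' := by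
    apply Subtype.ext
    ext i j
    fin_cases i <;> fin_cases j <;> simp only [mul_entry, lower_entry] <;> simp
    · exact h0
    · exact h1
    · rw [← h0]; linear_combination h'.1 1 0 * d - h.1 1 0 * d'
    · rw [← h1]; linear_combination h'.1 1 1 * d - h.1 1 1 * d'
  rw [this, hφ]

theorem eq_torus {α : Type*} {φ : SpecialLinearGroup (Fin 2) k → α}
    (hφ : ∀ c h, φ (lower c * h) = φ h) (hU : ∀ c h, φ (h * upper c) = φ h)
    {h : SpecialLinearGroup (Fin 2) k} {t : kˣ} (ht : h.1 0 0 = t) : φ h = φ (torus t) := by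
  rw [← hU (((t⁻¹ : kˣ) : k) * h.1 0 1) (torus t)]
  apply eq_of_top_row_eq hφ <;> simp [mul_entry, torus_entry, upper_entry, ht]

theorem eq_antitorus {α : Type*} {φ : SpecialLinearGroup (Fin 2) k → α}
    (hφ : ∀ c h, φ (lower c * h) = φ h) {h : SpecialLinearGroup (Fin 2) k} {t : kˣ}
    (h0 : h.1 0 0 = 0) (ht : h.1 0 1 = t) : φ h = φ (antitorus t) := by
  apply eq_of_top_row_eq hφ <;> simp [antitorus_entry, ht, h0]

theorem exists_unit_of_top_left_eq_zero {h : SpecialLinearGroup (Fin 2) k} (h0 : h.1 0 0 = 0) :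
    ∃ t : kˣ, h.1 0 1 = t := by
  have d : h.1 0 0 * h.1 1 1 - h.1 0 1 * h.1 1 0 = 1 := by
    rw [← Matrix.det_fin_two]; exact h.2
  refine ⟨Units.mk0 (h.1 0 1) ?_, rfl⟩
  intro h1
  rw [h0, h1] at d
  simp at d

variable [Fintype k] [DecidableEq k]

/-- A nonzero function on `kˣ` has a nonzero Mellin coefficient. -/
theorem exists_mellin_ne_zero {a : kˣ → E} (ha : a ≠ 0) :
    ∃ m < Fintype.card k - 1, ∑ t : kˣ, ι t ^ m * a t ≠ 0 := by
  by_contra! h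
  let e : kˣ ≃ Fin (Fintype.card k - 1) := Fintype.equivFinOfCardEq (Fintype.card_units k)
  have hinj : Function.Injective fun i => ι (e.symm i : kˣ) :=
    ι.injective.comp (Units.val_injective.comp e.symm.injective)
  have h1 : (fun i => a (e.symm i)) = 0 := by
    refine Matrix.eq_zero_of_forall_pow_sum_mul_pow_eq_zero hinj fun m => ?_
    rw [← h m m.2, ← e.symm.sum_comp]
    exact Finset.sum_congr rfl fun i _ => mul_comm _ _
  apply ha
  ext t
  have := congrFun h1 (e t)
  simpa using this

variable (S : Submodule E (SpecialLinearGroup (Fin 2) k → E))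

/-- A right translation stable space of functions on `SL₂(k)` that contains a nonzero function
`h ↦ G(a)` supported on `a ≠ 0`, where `a` is the top left entry of `h`, contains some
`h ↦ aⁿ` with `n < q`: with `m` such that the Mellin coefficient `∑ t^m G(t)` is nonzero, average the
translates by `diag(t, t⁻¹)` with weights `t^m`; then `n = q - 1 - m`. -/
theorem exists_pow_mem_of_torus
    (hS : ∀ g, ∀ φ ∈ S, (fun h => φ (h * g)) ∈ S) {φ : SpecialLinearGroup (Fin 2) k → E}
    (hφS : φ ∈ S) {a : kˣ → E} (ha : a ≠ 0) (hφ0 : ∀ h, h.1 0 0 = 0 → φ h = 0)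
    (hφ : ∀ h (t : kˣ), h.1 0 0 = (t : k) → φ h = a t) :
    ∃ n < Fintype.card k, (fun h => ι (h.1 0 0) ^ n) ∈ S := by
  obtain ⟨m, hm, hne⟩ := exists_mellin_ne_zero ι ha
  refine ⟨Fintype.card k - 1 - m, by omega, ?_⟩
  have h1 : (∑ t : kˣ, ι t ^ m • fun h => φ (h * torus t)) ∈ S :=
    S.sum_mem fun t _ => S.smul_mem _ (hS _ _ hφS)
  rw [← S.smul_mem_iff hne]
  convert h1 using 1
  funext h
  rw [Finset.sum_apply]
  simp only [Pi.smul_apply, smul_eq_mul]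
  have hent : ∀ t : kˣ, (h * torus t).1 0 0 = h.1 0 0 * t := by
    intro t
    simp [mul_entry, torus_entry]
  by_cases h0 : h.1 0 0 = 0
  · rw [h0, map_zero, zero_pow (by omega), mul_zero]
    symm
    refine Finset.sum_eq_zero fun t _ => ?_
    rw [hφ0 _ (by rw [hent, h0, zero_mul]), mul_zero]
  · set s : kˣ := Units.mk0 _ h0 with hs
    have h2 : ∀ t : kˣ, φ (h * torus t) = a (s * t) := fun t => hφ _ _ (hent t)
    have hpow : ι (s : k) ^ (Fintype.card k - 1 - m) * ι (s : k) ^ m = 1 := by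
      rw [← pow_add, Nat.sub_add_cancel hm.le, ← map_pow, FiniteField.pow_card_sub_one_eq_one _ s.ne_zero,
        map_one]
    change (∑ t : kˣ, ι t ^ m * a t) * ι (s : k) ^ (Fintype.card k - 1 - m) = _
    rw [← Equiv.sum_comp (Equiv.mulLeft s), Finset.sum_mul]
    refine Finset.sum_congr rfl fun t _ => ?_
    rw [h2, Equiv.coe_mulLeft, Units.val_mul, map_mul, mul_pow]
    linear_combination (ι (t : k) ^ m * a (s * t)) * hpow

/-- A right translation stable space of functions on `Ū(k)\SL₂(k)` with a nonzero `U(k)`-invariant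
element `φ` contains some `h ↦ aⁿ`, `0 ≤ n < q`. If the average of `w · φ` over `U(k)` is nonzero, it is
supported on `a ≠ 0`. Otherwise `φ` itself is supported on `a ≠ 0`, or its average over the torus is a
nonzero constant. -/
theorem exists_pow_mem_of_invariant
    (hS : ∀ g, ∀ φ ∈ S, (fun h => φ (h * g)) ∈ S) {φ : SpecialLinearGroup (Fin 2) k → E}
    (hφS : φ ∈ S) (hφ : ∀ c h, φ (lower c * h) = φ h) (hU : ∀ c h, φ (h * upper c) = φ h)
    (hne : φ ≠ 0) : ∃ n < Fintype.card k, (fun h => ι (h.1 0 0) ^ n) ∈ S := by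
  have hq : (Fintype.card k : E) = 0 := by
    rw [← map_natCast ι, FiniteField.cast_card_eq_zero, map_zero]
  set s₀ : E := ∑ t : kˣ, φ (torus t) with hs₀
  -- the average of `w · φ` over `U(k)`
  have hψS : (∑ c : k, fun h => φ (h * (upper c * weyl k))) ∈ S :=
    S.sum_mem fun c _ => hS _ _ hφS
  set ψ : SpecialLinearGroup (Fin 2) k → E := ∑ c : k, fun h => φ (h * (upper c * weyl k)) with hψ
  have hent0 : ∀ (h : SpecialLinearGroup (Fin 2) k) (c : k),
      (h * (upper c * weyl k)).1 0 0 = -(h.1 0 0 * c + h.1 0 1) := by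
    intro h c
    rw [← mul_assoc, mul_entry, mul_entry, mul_entry]
    simp [upper_entry, weyl_entry]
  have hent1 : ∀ (h : SpecialLinearGroup (Fin 2) k) (c : k),
      (h * (upper c * weyl k)).1 0 1 = h.1 0 0 := by
    intro h c
    rw [← mul_assoc, mul_entry, mul_entry, mul_entry]
    simp [upper_entry, weyl_entry]
  -- for `a = 0` the `q` terms of the average have the same top row
  have hψ0 : ∀ h, h.1 0 0 = 0 → ψ h = 0 := by
    intro h h0
    rw [hψ, Finset.sum_apply, Finset.sum_congr rfl (g := fun _ => φ (h * (upper 0 * weyl k)))]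
    · rw [Finset.sum_const, Finset.card_univ, nsmul_eq_mul, hq, zero_mul]
    · intro c _
      apply eq_of_top_row_eq hφ
      · rw [hent0, hent0, h0]; simp
      · rw [hent1, hent1]
  -- for `a = t ≠ 0` the top rows are `(x, t)` with `x` running over `k`; `φ` depends only on `x` if
  -- `x ≠ 0`, and the term `x = 0` is `φ (antitorus t)`
  have hψ1 : ∀ h (t : kˣ), h.1 0 0 = (t : k) → ψ h = s₀ + φ (antitorus t) := by
    intro h t ht
    rw [hψ, Finset.sum_apply]
    let e : k ≃ k := (Equiv.mulLeft₀ (t : k) t.ne_zero).trans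
      ((Equiv.addRight (h.1 0 1)).trans (Equiv.neg k))
    have he : ∀ c, (h * (upper c * weyl k)).1 0 0 = e c := by
      intro c
      rw [hent0, ht]
      rfl
    rw [← e.symm.sum_comp, Fintype.sum_eq_add_sum_subtype_ne _ (0 : k), add_comm]
    congr 1
    · rw [hs₀, ← (unitsEquivNeZero (G₀ := k)).sum_comp]
      refine Finset.sum_congr rfl fun u _ => ?_
      apply eq_torus hφ hU
      rw [he, Equiv.apply_symm_apply]
      rfl
    · apply eq_antitorus hφ
      · rw [he, Equiv.apply_symm_apply]
      · rw [hent1, ht]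
  -- if `ψ = 0`, then `φ = -s₀` on `a = 0`, so `φ` is supported on `a ≠ 0` when `s₀ = 0`; when `s₀ ≠ 0`
  -- the average of `φ` over the torus is `s₀` on `a ≠ 0` and `-(q - 1) s₀ = s₀` on `a = 0`
  by_cases hA : ∃ t : kˣ, s₀ + φ (antitorus t) ≠ 0
  · obtain ⟨t, ht⟩ := hA
    exact exists_pow_mem_of_torus ι S hS hψS (a := fun t => s₀ + φ (antitorus t))
      (fun h0 => ht (congrFun h0 t)) hψ0 hψ1
  push Not at hA
  have hanti : ∀ t, φ (antitorus t) = -s₀ := fun t => (neg_eq_of_add_eq_zero_right (hA t)).symm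
  by_cases h0 : s₀ = 0
  · have hφ0 : ∀ h, h.1 0 0 = 0 → φ h = 0 := by
      intro h hh
      obtain ⟨t, ht⟩ := exists_unit_of_top_left_eq_zero hh
      rw [eq_antitorus hφ hh ht, hanti, h0, neg_zero]
    refine exists_pow_mem_of_torus ι S hS hφS (a := fun t => φ (torus t)) ?_ hφ0
      (fun h t ht => eq_torus hφ hU ht)
    intro hz
    apply hne
    funext h
    by_cases hh : h.1 0 0 = 0
    · exact hφ0 h hh
    · rw [eq_torus hφ hU (t := Units.mk0 _ hh) rfl]
      exact congrFun hz _
  · refine ⟨0, Fintype.card_pos, ?_⟩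
    have h1 : (∑ t : kˣ, fun h => φ (h * torus t)) ∈ S := S.sum_mem fun t _ => hS _ _ hφS
    rw [← S.smul_mem_iff h0]
    convert h1 using 1
    funext h
    rw [Finset.sum_apply]
    simp only [Pi.smul_apply, smul_eq_mul, pow_zero, mul_one]
    have hent : ∀ t : kˣ, (h * torus t).1 0 0 = h.1 0 0 * t := by
      intro t
      simp [mul_entry, torus_entry]
    by_cases hh : h.1 0 0 = 0
    · have h2 : ∀ t : kˣ, φ (h * torus t) = -s₀ := by
        intro t
        have h3 : (h * torus t).1 0 0 = 0 := by rw [hent, hh, zero_mul]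
        obtain ⟨u, hu⟩ := exists_unit_of_top_left_eq_zero h3
        rw [eq_antitorus hφ h3 hu, hanti]
      simp only [h2]
      rw [Finset.sum_const, Finset.card_univ, Fintype.card_units, nsmul_eq_mul,
        Nat.cast_sub Fintype.card_pos, hq]
      simp
    · rw [hs₀, ← Equiv.sum_comp (Equiv.mulLeft (Units.mk0 _ hh))]
      refine Finset.sum_congr rfl fun t _ => ?_
      rw [eq_torus hφ hU (hent t |>.trans (by rfl : _ = ((Units.mk0 _ hh * t : kˣ) : k)))]
      rfl

end FunctionsOnSL2

/-! ### Weights in representations of `SL₂(k)` -/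

section Socle

open Matrix (SpecialLinearGroup)

variable {k : Type*} [Field k] {p : ℕ} [Fact p.Prime] [CharP k p] {f : ℕ}
variable {E : Type*} [Field E] (ι : k →+* E)
variable {V : Type*} [AddCommGroup V] [Module E V]

/-- Upper unipotents as a homomorphism. -/
def upperHom (k : Type*) [Field k] : Multiplicative k →* SpecialLinearGroup (Fin 2) k where
  toFun x := upper x.toAdd
  map_one' := by ext i j; fin_cases i <;> fin_cases j <;> simp [upper_entry]
  map_mul' x y := by
    ext i j
    fin_cases i <;> fin_cases j <;> simp [mul_entry, upper_entry, add_comm]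

/-- Lower unipotents as a homomorphism. -/
def lowerHom (k : Type*) [Field k] : Multiplicative k →* SpecialLinearGroup (Fin 2) k where
  toFun x := lower x.toAdd
  map_one' := by ext i j; fin_cases i <;> fin_cases j <;> simp [lower_entry]
  map_mul' x y := by
    ext i j
    fin_cases i <;> fin_cases j <;> simp [mul_entry, lower_entry]

theorem exists_fixed_vector_multiplicative (p : ℕ) [Fact p.Prime] [CharP k p] [CharP E p] [Finite k]
    [Nontrivial V] (τ : Representation E (Multiplicative k) V) : ∃ w ≠ 0, ∀ g, τ g w = w := by
  obtain ⟨v, hv⟩ := exists_ne (0 : V)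
  have : Finite (Multiplicative k) := inferInstanceAs (Finite k)
  refine exists_fixed_vector p τ hv (Set.finite_range _) fun g => ⟨1, fun h => ?_⟩
  have : g ^ p ^ 1 = 1 := by
    rw [pow_one]
    apply Multiplicative.toAdd.injective
    rw [toAdd_pow, toAdd_one, nsmul_eq_mul, CharP.cast_eq_zero, zero_mul]
  rw [this, map_one, Module.End.one_apply]

/-- Let `V` be a representation of `SL₂(k)` without proper nonzero subrepresentations. Then there is a
nonzero homomorphism from some weight to `V`. A functional on `V` invariant under lower unipotents
embeds `V` into the functions on `Ū(k)\SL₂(k)`, where the image contains that of the highest weight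
vector of some weight. -/
theorem exists_hom_of_minimal (hq : Nat.card k = p ^ f)
    (τ : Representation E (SpecialLinearGroup (Fin 2) k) V) [Module.Finite E V] [Nontrivial V]
    (hmin : ∀ U : Submodule E V, (∀ g, ∀ v ∈ U, τ g v ∈ U) → U = ⊥ ∨ U = ⊤) :
    ∃ (r : Fin f → Fin p) (ψ : WeightSpace E r →ₗ[E] V), ψ ≠ 0 ∧
      ∀ g s, ψ (finiteWeightRep ι r g s) = τ g (ψ s) := by
  classical
  have hp := Fact.out (p := p.Prime)
  have : Finite k := Nat.finite_of_card_ne_zero (by rw [hq]; exact (pow_pos hp.pos f).ne')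
  let _ := Fintype.ofFinite k
  have : CharP E p := charP_of_injective_ringHom ι.injective p
  obtain ⟨l, hl0, hl⟩ := exists_fixed_vector_multiplicative p (τ.dual.comp (lowerHom k))
  have hl' : ∀ (c : k) v, l (τ (lower c) v) = l v := by
    intro c v
    have h1 := LinearMap.congr_fun (hl (Multiplicative.ofAdd (-c))) v
    have h2 : (lowerHom k (Multiplicative.ofAdd (-c)))⁻¹ = lower c := by
      rw [← map_inv]
      change lower (- -c) = lower c
      rw [neg_neg]
    change l (τ (lowerHom k (Multiplicative.ofAdd (-c)))⁻¹ v) = l v at h1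
    rwa [h2] at h1
  obtain ⟨v, hv0, hv⟩ := exists_fixed_vector_multiplicative p (τ.comp (upperHom k))
  have hv' : ∀ c : k, τ (upper c) v = v := fun c => hv (Multiplicative.ofAdd c)
  -- the matrix coefficients `J w : h ↦ l (h w)` embed `V` into the functions on `Ū(k)\SL₂(k)`, by
  -- minimality of `V`
  let J : V →ₗ[E] (SpecialLinearGroup (Fin 2) k → E) := LinearMap.pi fun h => l ∘ₗ τ h
  have hJ : ∀ w h, J w h = l (τ h w) := fun _ _ => rfl
  have hJg : ∀ g w h, J (τ g w) h = J w (h * g) := by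
    intro g w h
    rw [hJ, hJ, map_mul]
    rfl
  have hJlow : ∀ w c h, J w (lower c * h) = J w h := by
    intro w c h
    rw [hJ, hJ, map_mul, Module.End.mul_apply, hl']
  have hinj : LinearMap.ker J = ⊥ := by
    refine (hmin _ fun g w hw => ?_).resolve_right fun htop => ?_
    · rw [LinearMap.mem_ker] at hw ⊢
      funext h
      rw [hJg, hw]
      rfl
    · apply hl0
      ext w
      have h1 : J w = 0 := LinearMap.mem_ker.1 (by rw [htop]; trivial)
      have h2 := congrFun h1 1
      rw [hJ, map_one] at h2
      exact h2
  have hinj' := LinearMap.ker_eq_bot.1 hinj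
  have hstab : ∀ g, ∀ φ ∈ LinearMap.range J, (fun h => φ (h * g)) ∈ LinearMap.range J := by
    rintro g _ ⟨w, rfl⟩
    exact ⟨τ g w, funext fun h => hJg g w h⟩
  obtain ⟨n, hn, hmem⟩ := exists_pow_mem_of_invariant ι (LinearMap.range J) hstab
    (φ := J v) ⟨v, rfl⟩ (hJlow v) (fun c h => by rw [← hJg, hv'])
    (fun h0 => hv0 (hinj' (h0.trans (map_zero J).symm)))
  rw [← Nat.card_eq_fintype_card, hq] at hn
  -- the weight is given by the base `p` digits of `n`
  set r : Fin f → Fin p := finFunctionFinEquiv.symm ⟨n, hn⟩ with hr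
  have hrn : (finFunctionFinEquiv r : ℕ) = n := by rw [hr, Equiv.apply_symm_apply]
  have hw : weightFun ι r (highestWeight E r) ∈ LinearMap.range J := by
    convert hmem using 1
    funext h
    rw [weightFun_highestWeight, hrn]
  have hrange : ∀ s, weightFun ι r s ∈ LinearMap.range J := by
    have h1 : Submodule.span E (Set.range fun g => finiteWeightRep ι r g (highestWeight E r)) ≤
        (LinearMap.range J).comap (weightFun ι r) := by
      rw [Submodule.span_le]
      rintro _ ⟨g, rfl⟩
      have h2 := hstab g _ hw
      change weightFun ι r _ ∈ LinearMap.range J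
      convert h2 using 1
      funext h
      exact weightFun_equivariant ι r g _ h
    rw [span_highestWeight ι r hq] at h1
    exact fun s => h1 (Submodule.mem_top (x := s))
  let ψ : WeightSpace E r →ₗ[E] V :=
    (LinearEquiv.ofInjective J hinj').symm.toLinearMap ∘ₗ (weightFun ι r).codRestrict _ hrange
  have hψ : ∀ s, J (ψ s) = weightFun ι r s := by
    intro s
    exact congrArg Subtype.val
      ((LinearEquiv.ofInjective J hinj').apply_symm_apply ⟨weightFun ι r s, hrange s⟩)
  refine ⟨r, ψ, fun h0 => ?_, fun g s => hinj' ?_⟩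
  · have h1 := congrFun (hψ (highestWeight E r)) 1
    rw [h0, weightFun_highestWeight] at h1
    simp at h1
  · funext h
    rw [hψ, weightFun_equivariant, hJg, hψ]

/-- Every nonzero finite-dimensional representation of `SL₂(k)` over `E` receives a nonzero
homomorphism from some weight. -/
theorem exists_hom_of_finite (hq : Nat.card k = p ^ f)
    (τ : Representation E (SpecialLinearGroup (Fin 2) k) V) [Module.Finite E V] [Nontrivial V] :
    ∃ (r : Fin f → Fin p) (ψ : WeightSpace E r →ₗ[E] V), ψ ≠ 0 ∧
      ∀ g s, ψ (finiteWeightRep ι r g s) = τ g (ψ s) := by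
  obtain ⟨U, ⟨hU0, hU⟩, hmin⟩ := (IsWellFounded.wf (r := ((· < ·) :
    Submodule E V → Submodule E V → Prop))).has_min
    {U : Submodule E V | U ≠ ⊥ ∧ ∀ g, ∀ v ∈ U, τ g v ∈ U} ⟨⊤, top_ne_bot, fun _ _ _ => trivial⟩
  have : Nontrivial U := Submodule.nontrivial_iff_ne_bot.2 hU0
  let τU : Representation E (SpecialLinearGroup (Fin 2) k) U :=
    Subrepresentation.toRepresentation (ρ := τ) ⟨U, fun g v hv => hU g v hv⟩
  have hτU : ∀ g (u : U), (τU g u : V) = τ g u := fun _ _ => rfl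
  obtain ⟨r, ψ, hψ0, hψ⟩ := exists_hom_of_minimal ι hq τU (by
    intro U' hU'
    by_contra! h
    refine hmin (U'.map U.subtype) ⟨?_, ?_⟩ ?_
    · intro h0
      apply h.1
      exact Submodule.map_injective_of_injective U.injective_subtype (h0.trans (Submodule.map_bot _).symm)
    · rintro g _ ⟨u, hu, rfl⟩
      exact ⟨τU g u, hU' g u hu, rfl⟩
    · refine lt_of_le_of_ne (U.map_subtype_le U') fun heq => h.2 ?_
      rw [eq_top_iff]
      rintro ⟨u, hu⟩ -
      rw [← heq] at hu
      obtain ⟨u', hu', rfl⟩ := hu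
      exact hu')
  refine ⟨r, U.subtype ∘ₗ ψ, fun h0 => hψ0 ?_, fun g s => ?_⟩
  · ext s
    exact congrArg Subtype.val (Subtype.ext (LinearMap.congr_fun h0 s) : ψ s = 0)
  · change (ψ _ : V) = τ g (ψ s)
    rw [hψ, hτU]

end Socle

/-! ### Parameters with respect to `K̃` -/

section Parameters

variable {F : Type*} [Field F] [ValuativeRel F] [TopologicalSpace F] [IsNonarchimedeanLocalField F]
variable {p : ℕ} [Fact p.Prime] [CharP 𝓀[F] p] {f : ℕ}
variable {E : Type*} [Field E] (ι : 𝓀[F] →+* E) (ϖ : {x : 𝒪[F] // Irreducible x})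
variable {W : Type*} [AddCommGroup W] [Module E W] {ρ : Representation E (Mp F) W}

/-- Reduction `SL₂(𝒪_F) → SL₂(𝔨)`. -/
noncomputable def redSL (F : Type*) [Field F] [ValuativeRel F] [TopologicalSpace F]
    [IsNonarchimedeanLocalField F] :
    Matrix.SpecialLinearGroup (Fin 2) 𝒪[F] →* Matrix.SpecialLinearGroup (Fin 2) 𝓀[F] :=
  Matrix.SpecialLinearGroup.map (IsLocalRing.residue 𝒪[F])

theorem redSL_surjective : Function.Surjective (redSL F) :=
  SL_map_surjective _ IsLocalRing.residue_surjective

theorem redSL_eq_one_iff {k : Matrix.SpecialLinearGroup (Fin 2) 𝒪[F]} :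
    redSL F k = 1 ↔ k ∈ congruence F 1 := by
  rw [congruence_one]; rfl

theorem weightRep_eq (r : Fin f → Fin p) (k : Matrix.SpecialLinearGroup (Fin 2) 𝒪[F]) :
    weightRep ι r k = finiteWeightRep ι r (redSL F k) := rfl

theorem ktEquiv_val (k : Matrix.SpecialLinearGroup (Fin 2) 𝒪[F]) (ζ : ℤˣ) :
    (ktEquiv (k, ζ) : Mp F) = split k * central ζ := by
  have h1 : (ktEquiv (k, (1 : ℤˣ)) : Mp F) = split k :=
    Subtype.ext (GLCover.ext rfl (mul_one _))
  have h2 : (ktEquiv ((1 : Matrix.SpecialLinearGroup (Fin 2) 𝒪[F]), ζ) : Mp F) = central ζ :=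
    Subtype.ext (GLCover.ext (map_one (toGL (F := F))) (by
      change theta (1 : Matrix.SpecialLinearGroup (Fin 2) 𝒪[F]) * ζ = ζ
      rw [theta_one, one_mul]))
  rw [← h1, ← h2, ← Subgroup.coe_mul, ← map_mul, Prod.mk_mul_mk, mul_one, one_mul]

theorem weightRepTilde_ktEquiv (r : Fin f → Fin p) (k : Matrix.SpecialLinearGroup (Fin 2) 𝒪[F])
    (ζ : ℤˣ) (s : WeightSpace E r) : weightRepTilde ι r (ktEquiv (k, ζ)) s =
      genuineSign E ζ • finiteWeightRep ι r (redSL F k) s := by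
  change genuineSign E (ktEquiv.symm (ktEquiv (k, ζ))).2 •
    weightRep ι r (ktEquiv.symm (ktEquiv (k, ζ))).1 s = _
  rw [MulEquiv.symm_apply_apply, weightRep_eq]

/-- The space of `K(1)`-fixed vectors as a representation of `SL₂(𝔨) = K/K(1)`. -/
theorem exists_residueRep (ρ : Representation E (Mp F) W) :
    ∃ τ : Representation E (Matrix.SpecialLinearGroup (Fin 2) 𝓀[F]) (congruenceFixed ρ 1),
      ∀ k w, (τ (redSL F k) w : W) = ρ (split k) w := by
  have hnormal : (congruence F 1).Normal := by rw [congruence]; infer_instance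
  have hstab : ∀ k, ∀ w ∈ congruenceFixed ρ 1, ρ (split k) w ∈ congruenceFixed ρ 1 := by
    intro k w hw g hg
    have h1 := hw (k⁻¹ * g * k) (by simpa using hnormal.conj_mem g hg k⁻¹)
    rw [← Module.End.mul_apply, ← map_mul, ← map_mul, show g * k = k * (k⁻¹ * g * k) by group,
      map_mul, map_mul, Module.End.mul_apply, h1]
  let lift := Function.surjInv (redSL_surjective (F := F))
  have hlift : ∀ g, redSL F (lift g) = g := Function.surjInv_eq _
  have hkey : ∀ k k', redSL F k = redSL F k' → ∀ w ∈ congruenceFixed ρ 1,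
      ρ (split k) w = ρ (split k') w := by
    intro k k' h w hw
    have h1 : k'⁻¹ * k ∈ congruence F 1 := by
      rw [← redSL_eq_one_iff, map_mul, map_inv, h, inv_mul_cancel]
    have h2 := congrArg (ρ (split k')) (hw _ h1)
    rwa [← Module.End.mul_apply, ← map_mul, ← map_mul, mul_inv_cancel_left] at h2
  refine ⟨⟨⟨fun g => (ρ (split (lift g))).restrict (hstab _), ?_⟩, ?_⟩, ?_⟩
  · ext w
    change ρ (split (lift 1)) w = w
    rw [hkey (lift 1) 1 (by rw [hlift, map_one]) w w.2, map_one, map_one, Module.End.one_apply]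
  · intro g g'
    ext w
    change ρ (split (lift (g * g'))) w = ρ (split (lift g)) (ρ (split (lift g')) w)
    rw [hkey (lift (g * g')) (lift g * lift g') (by rw [map_mul, hlift, hlift, hlift]) w w.2,
      map_mul, map_mul, Module.End.mul_apply]
  · intro k w
    exact hkey _ _ (hlift _) w w.2

/-- Existence of a parameter with respect to `K̃`, from the consequences of smoothness and
admissibility that concern the congruence subgroups. -/
theorem exists_parameter [IsAlgClosed E] [CharP E p] (hq : Nat.card 𝓀[F] = p ^ f)
    (hsmooth : ∀ v : W, ∃ n, ∀ k ∈ congruence F n, ρ (split k) v = v) (hgenuine : IsGenuine ρ)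
    (hirr : ρ.IsIrreducible) [Module.Finite E (congruenceFixed ρ 1)] :
    ∃ (r : Fin f → Fin p) (lam : E), IsQuotientOf ρ (cokerModule ι ϖ r lam) := by
  have : Nontrivial W := by
    have := hirr.toNontrivial
    by_contra h
    rw [not_nontrivial_iff_subsingleton] at h
    obtain ⟨a, b, hab⟩ := exists_pair_ne (Subrepresentation ρ)
    exact hab (Subrepresentation.toSubmodule_injective (Subsingleton.elim _ _))
  obtain ⟨w, hw, hw0⟩ := exists_congruenceFixed_ne_zero p hsmooth
  have : Nontrivial (congruenceFixed ρ 1) := ⟨⟨w, hw⟩, 0, fun h => hw0 (congrArg Subtype.val h)⟩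
  obtain ⟨τ, hτ⟩ := exists_residueRep ρ
  obtain ⟨r, ψ, hψ0, hψ⟩ := exists_hom_of_finite ι hq τ
  refine ⟨r, exists_isQuotientOf_cokerRep hirr (heckeT ι ϖ r) (v₀ := highestWeight E r) ?_
    (congruenceFixed ρ 1) ?_ (φ := (congruenceFixed ρ 1).subtype ∘ₗ ψ) ?_ ?_⟩
  · rw [eq_top_iff, ← span_highestWeight ι r hq]
    refine Submodule.span_mono ?_
    rintro _ ⟨g, rfl⟩
    obtain ⟨k, rfl⟩ := redSL_surjective g
    refine ⟨ktEquiv (k, 1), ?_⟩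
    beta_reduce
    rw [weightRepTilde_ktEquiv]
    simp [genuineSign]
  · intro w hw k hk
    have h1 := hw (ktEquiv (k, 1)) (by
      rw [weightRepTilde_ktEquiv, redSL_eq_one_iff.2 hk, map_one]
      simp [genuineSign])
    rw [ktEquiv_val] at h1
    have h2 : central (F := F) 1 = 1 := rfl
    rwa [h2, mul_one] at h1
  · intro h s
    obtain ⟨⟨k, ζ⟩, rfl⟩ := ktEquiv.surjective h
    rw [weightRepTilde_ktEquiv, ktEquiv_val, map_smul, map_mul, Module.End.mul_apply, hgenuine,
      map_smul]
    change genuineSign E ζ • (ψ _ : W) = genuineSign E ζ • ρ (split k) (ψ s)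
    rw [hψ, hτ]
  · intro h0
    apply hψ0
    ext s
    exact LinearMap.congr_fun h0 s

end Parameters

/-! ### Twisting by an automorphism -/

section Conjugation

variable {G : Type*} [Group G] {E : Type*} [Field E]
variable {V : Type*} [AddCommGroup V] [Module E V] {W : Type*} [AddCommGroup W] [Module E W]
variable {H : Subgroup G} {σ : Representation E H V} {ρ : Representation E G W}

theorem isIrreducible_comp (c : MulAut G) (hirr : ρ.IsIrreducible) :
    Representation.IsIrreducible (ρ.comp c.toMonoidHom : Representation E G W) := by
  let e : Subrepresentation (ρ.comp c.toMonoidHom : Representation E G W) ≃o Subrepresentation ρ :=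
    { toFun := fun U => ⟨U.toSubmodule, fun g v hv => by
        have := U.apply_mem_toSubmodule (c.symm g) hv
        change ρ (c (c.symm g)) v ∈ _ at this
        rwa [c.apply_symm_apply] at this⟩
      invFun := fun U => ⟨U.toSubmodule, fun g v hv => U.apply_mem_toSubmodule (c g) hv⟩
      left_inv := fun _ => rfl
      right_inv := fun _ => rfl
      map_rel_iff' := Iff.rfl }
  have := hirr
  exact e.isSimpleOrder

/-- If the twist of `ρ` by an automorphism `c` is a quotient of `ind_H σ / (T - λ)`, then `ρ` is a
quotient of the conjugate module `ind_{c(H)} σ^c / (Φ T Φ⁻¹ - λ)`. -/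
theorem IsQuotientOf.conj (c : MulAut G) {T : (indRep H σ).IntertwiningMap (indRep H σ)} {lam : E}
    (h : IsQuotientOf (ρ.comp c.toMonoidHom : Representation E G W) (cokerRep T lam)) :
    IsQuotientOf ρ (cokerRep (conjOp c T) lam) := by
  obtain ⟨q, hq⟩ := h
  let L : compactInd H σ →ₗ[E] W := q.toLinearMap ∘ₗ Submodule.mkQ _
  have hLT : ∀ F, L (T F) = lam • L F := by
    intro F
    have h0 : (Submodule.Quotient.mk (T F - lam • F) : Coker T lam) = 0 :=
      (Submodule.Quotient.mk_eq_zero _).2 (LinearMap.mem_range.2 ⟨F, rfl⟩)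
    rw [← map_smul, ← sub_eq_zero, ← map_sub]
    exact (congrArg q.toLinearMap h0).trans (map_zero _)
  have hLg : ∀ g F, L (indRep H σ g F) = ρ (c g) (L F) := fun g F =>
    LinearMap.congr_fun (q.isIntertwining' g) (Submodule.Quotient.mk F)
  let L' := L ∘ₗ (conjInd c H σ).symm.toLinearMap
  refine ⟨⟨Submodule.liftQ _ L' ?_, ?_⟩, ?_⟩
  · rintro _ ⟨F, rfl⟩
    rw [LinearMap.mem_ker, LinearMap.sub_apply, map_sub, LinearMap.smul_apply, map_smul, sub_eq_zero]
    change L ((conjInd c H σ).symm (conjInd c H σ (T ((conjInd c H σ).symm F)))) =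
      lam • L ((conjInd c H σ).symm F)
    rw [LinearEquiv.symm_apply_apply, hLT]
  · intro g
    apply LinearMap.ext
    intro Q
    obtain ⟨F, rfl⟩ := Submodule.Quotient.mk_surjective _ Q
    change L ((conjInd c H σ).symm (indRep _ _ g F)) = ρ g (L ((conjInd c H σ).symm F))
    have h1 : (conjInd c H σ).symm (indRep _ _ g F) =
        indRep H σ (c.symm g) ((conjInd c H σ).symm F) := by
      apply Subtype.ext; funext x
      change F.1 (c x * g) = F.1 (c (x * c.symm g))
      simp
    rw [h1, hLg, c.apply_symm_apply]
  · intro w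
    obtain ⟨Q, rfl⟩ := hq w
    obtain ⟨F, rfl⟩ := Submodule.Quotient.mk_surjective _ Q
    refine ⟨Submodule.Quotient.mk (conjInd c H σ F), ?_⟩
    change L ((conjInd c H σ).symm (conjInd c H σ F)) = _
    rw [LinearEquiv.symm_apply_apply]
    rfl

end Conjugation

/-! ### Conjugation by `α̃` -/

section ConjugationByAlpha

variable {F : Type*} [Field F] [ValuativeRel F] [TopologicalSpace F] [IsNonarchimedeanLocalField F]
variable {ϖ : {x : 𝒪[F] // Irreducible x}}

theorem principal_of_mem_congruence {k : Matrix.SpecialLinearGroup (Fin 2) 𝒪[F]}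
    (hk : k ∈ congruence F 1) {D : Fˣ} (hD : (D : F) = k.1 1 1) : red (D : F) = 1 ∧ ord D = 0 := by
  have h1 : IsLocalRing.residue 𝒪[F] (k.1 1 1) = 1 := by
    have h2 := mem_congruence_iff.1 hk 1 1
    rw [pow_one, Matrix.sub_apply, Matrix.one_apply_eq, ← IsLocalRing.residue_eq_zero_iff, map_sub,
      map_one, sub_eq_zero] at h2
    exact h2
  refine ⟨by rw [hD, red_coe, h1], (isUnit_iff_ord hD).1 ?_⟩
  rw [← IsLocalRing.residue_ne_zero_iff_isUnit, h1]
  exact one_ne_zero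

theorem theta_of_mem_congruence {k : Matrix.SpecialLinearGroup (Fin 2) 𝒪[F]}
    (hk : k ∈ congruence F 1) : theta k = 1 := by
  by_cases h : (k.1 1 0 : F) ≠ 0 ∧ ¬ IsUnit (k.1 1 0)
  · obtain ⟨hr, ho⟩ := principal_of_mem_congruence hk
      (D := Units.mk0 _ (lowerRight_ne_zero k h.2)) rfl
    rw [theta_of_pos (C := Units.mk0 _ h.1) (D := Units.mk0 _ (lowerRight_ne_zero k h.2)) rfl rfl h.2]
    exact hilbert_principal hr ho
  · rw [theta, dif_neg h]

/-- For `k ∈ K(1)` with `k' = αkα⁻¹ ∈ K(1)`, conjugation by `α̃` carries `(k, θ(k))` to `(k', θ(k'))`.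
All the signs are trivial because the lower right entry is a principal unit. -/
theorem conjAlpha_split {k k' : Matrix.SpecialLinearGroup (Fin 2) 𝒪[F]}
    (hk : k ∈ congruence F 1) (hk' : k' ∈ congruence F 1) (h00 : k'.1 0 0 = k.1 0 0)
    (h01 : k.1 0 1 = ϖ.1 * k'.1 0 1) (h10 : k'.1 1 0 = ϖ.1 * k.1 1 0)
    (h11 : k'.1 1 1 = k.1 1 1) : conjAlpha ϖ (split k) = split k' := by
  have hv : (unif ϖ : F) = ϖ.1 := rfl
  have hm : diag 1 (unif ϖ) * toGL k = toGL k' * diag 1 (unif ϖ) := by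
    apply Units.ext
    ext i j
    rw [Units.val_mul, Units.val_mul, Matrix.mul_apply, Matrix.mul_apply, Fin.sum_univ_two,
      Fin.sum_univ_two, diag_entry]
    simp only [toGL_apply]
    fin_cases i <;> fin_cases j <;> simp [h00, h01, h10, h11, ← hv, mul_comm]
  have hdetα : Matrix.GeneralLinearGroup.det (diag 1 (unif ϖ)) = unif ϖ := by
    apply Units.ext
    change (diag 1 (unif ϖ)).1.det = _
    rw [diag_entry]; simp
  have hXα : bottomEntry (diag 1 (unif ϖ)) = unif ϖ := by
    apply Units.ext
    rw [bottomEntry_of_zero] <;> rw [diag_entry] <;> simp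
  have hXαk : bottomEntry (diag 1 (unif ϖ) * toGL k) = unif ϖ * bottomEntry (toGL k) := by
    have e : ∀ j, (diag 1 (unif ϖ) * toGL k).1 1 j = (unif ϖ : F) * (toGL k).1 1 j := by
      intro j
      rw [Units.val_mul, Matrix.mul_apply, Fin.sum_univ_two, diag_entry]
      simp
    apply Units.ext
    rw [Units.val_mul]
    by_cases hc : (toGL k).1 1 0 = 0
    · rw [bottomEntry_of_zero hc, bottomEntry_of_zero (by rw [e, hc, mul_zero]), e]
    · rw [bottomEntry_of_ne hc, bottomEntry_of_ne (by rw [e]; simpa using hc), e]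
  have hc1 : cocycle (diag 1 (unif ϖ)) (toGL k) = 1 := by
    rw [cocycle, hXαk, hXα, hdetα, mul_div_cancel_left, mul_div_cancel_right,
      hilbert_symm (unif ϖ), Int.units_mul_self]
  have hc2 : cocycle (toGL k') (diag 1 (unif ϖ)) = 1 := by
    rw [cocycle_of_det_eq_one (det_toGL _), ← hm, hXαk, hXα, mul_div_cancel_left]
    by_cases hc : k.1 1 0 = 0
    · have hX : (bottomEntry (toGL k) : F) = k.1 1 1 := by
        rw [bottomEntry_of_zero] <;> rw [toGL_apply]
        rw [hc]; rfl
      obtain ⟨hr, ho⟩ := principal_of_mem_congruence hk hX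
      exact hilbert_principal hr ho
    · have hX : bottomEntry (toGL k') = unif ϖ * bottomEntry (toGL k) := by
        have hcF : (k.1 1 0 : F) ≠ 0 := by simpa using hc
        have hc' : (k'.1 1 0 : F) ≠ 0 := by
          rw [h10]
          simpa [hc] using ϖ.2.ne_zero
        apply Units.ext
        rw [Units.val_mul, bottomEntry_of_ne (g := toGL k) hcF,
          bottomEntry_of_ne (g := toGL k') hc', toGL_apply, toGL_apply, h10]
        rfl
      rw [hX, div_self', hilbert_one_left]
  apply Subtype.ext
  have h1 : alphaTilde ϖ * splitFun k = splitFun k' * alphaTilde ϖ := by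
    ext1
    · exact hm
    · change 1 * theta k * cocycle (diag 1 (unif ϖ)) (toGL k) =
        theta k' * 1 * cocycle (toGL k') (diag 1 (unif ϖ))
      rw [hc1, hc2, theta_of_mem_congruence hk, theta_of_mem_congruence hk', mul_comm]
  change alphaTilde ϖ * splitFun k * (alphaTilde ϖ)⁻¹ = splitFun k'
  rw [h1, mul_inv_cancel_right]

theorem conjAlpha_central (ζ : ℤˣ) : conjAlpha ϖ (central ζ) = central ζ := by
  apply Subtype.ext
  change alphaTilde ϖ * (⟨1, ζ⟩ : GLCover F) * (alphaTilde ϖ)⁻¹ = ⟨1, ζ⟩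
  rw [mul_inv_eq_iff_eq_mul]
  ext1
  · exact (mul_one _).trans (one_mul _).symm
  · rw [GLCover.mul_sgn, GLCover.mul_sgn, cocycle_one_left, cocycle_one_right, mul_comm ζ]

theorem exists_eq_uniformizer_mul {n : ℕ} {x : 𝒪[F]} (hx : x ∈ 𝓂[F] ^ (n + 1)) :
    ∃ y ∈ 𝓂[F] ^ n, x = ϖ.1 * y := by
  rw [Irreducible.maximalIdeal_eq ϖ.2, Ideal.span_singleton_pow] at hx ⊢
  obtain ⟨z, rfl⟩ := Ideal.mem_span_singleton.1 hx
  exact ⟨ϖ.1 ^ n * z, Ideal.mem_span_singleton.2 (Dvd.intro _ rfl), by ring⟩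

theorem uniformizer_mul_mem {n : ℕ} {x : 𝒪[F]} (hx : x ∈ 𝓂[F] ^ n) : ϖ.1 * x ∈ 𝓂[F] ^ n :=
  Ideal.mul_mem_left _ _ hx

theorem mem_congruence_iff_entries {n : ℕ} {k : Matrix.SpecialLinearGroup (Fin 2) 𝒪[F]} :
    k ∈ congruence F n ↔ k.1 0 0 - 1 ∈ 𝓂[F] ^ n ∧ k.1 0 1 ∈ 𝓂[F] ^ n ∧ k.1 1 0 ∈ 𝓂[F] ^ n ∧
      k.1 1 1 - 1 ∈ 𝓂[F] ^ n := by
  rw [mem_congruence_iff]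
  simp [Fin.forall_fin_two, Matrix.sub_apply, and_assoc]

variable (ϖ)

/-- Conjugation by `α̃` maps the lift of `K(n + 2)` into the lift of `K(n + 1)`. -/
theorem exists_conjAlpha_split_eq {n : ℕ} {k : Matrix.SpecialLinearGroup (Fin 2) 𝒪[F]}
    (hk : k ∈ congruence F (n + 2)) :
    ∃ k' ∈ congruence F (n + 1), conjAlpha ϖ (split k) = split k' := by
  obtain ⟨h00, h01, h10, h11⟩ := mem_congruence_iff_entries.1 hk
  obtain ⟨b, hb, hb'⟩ := exists_eq_uniformizer_mul (ϖ := ϖ) h01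
  have hle : 𝓂[F] ^ (n + 2) ≤ 𝓂[F] ^ (n + 1) := Ideal.pow_le_pow_right (by omega)
  have hdet : (!![k.1 0 0, b; ϖ.1 * k.1 1 0, k.1 1 1]).det = 1 := by
    have := det_eq k
    rw [hb'] at this
    rw [Matrix.det_fin_two_of]
    linear_combination this
  let k' : Matrix.SpecialLinearGroup (Fin 2) 𝒪[F] := ⟨!![k.1 0 0, b; ϖ.1 * k.1 1 0, k.1 1 1], hdet⟩
  have hk' : k' ∈ congruence F (n + 1) :=
    mem_congruence_iff_entries.2 ⟨hle h00, hb, uniformizer_mul_mem (hle h10), hle h11⟩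
  exact ⟨k', hk', conjAlpha_split (congruence_antitone (by omega) hk)
    (congruence_antitone (by omega) hk') rfl hb' rfl rfl⟩

/-- The lift of `K(n + 2)` lies in the image of the lift of `K(n + 1)` under conjugation by `α̃`. -/
theorem exists_eq_conjAlpha_split {n : ℕ} {k' : Matrix.SpecialLinearGroup (Fin 2) 𝒪[F]}
    (hk' : k' ∈ congruence F (n + 2)) :
    ∃ k ∈ congruence F (n + 1), conjAlpha ϖ (split k) = split k' := by
  obtain ⟨h00, h01, h10, h11⟩ := mem_congruence_iff_entries.1 hk'
  obtain ⟨c, hc, hc'⟩ := exists_eq_uniformizer_mul (ϖ := ϖ) h10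
  have hle : 𝓂[F] ^ (n + 2) ≤ 𝓂[F] ^ (n + 1) := Ideal.pow_le_pow_right (by omega)
  have hdet : (!![k'.1 0 0, ϖ.1 * k'.1 0 1; c, k'.1 1 1]).det = 1 := by
    have := det_eq k'
    rw [hc'] at this
    rw [Matrix.det_fin_two_of]
    linear_combination this
  let k : Matrix.SpecialLinearGroup (Fin 2) 𝒪[F] := ⟨!![k'.1 0 0, ϖ.1 * k'.1 0 1; c, k'.1 1 1], hdet⟩
  have hk : k ∈ congruence F (n + 1) :=
    mem_congruence_iff_entries.2 ⟨hle h00, uniformizer_mul_mem (hle h01), hc, hle h11⟩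
  exact ⟨k, hk, conjAlpha_split (congruence_antitone (by omega) hk)
    (congruence_antitone (by omega) hk') rfl rfl hc' rfl⟩

end ConjugationByAlpha

end MetaplecticSL2

theorem proposition5p9 {F : Type*} [Field F] [ValuativeRel F] [TopologicalSpace F]
    [IsNonarchimedeanLocalField F] [CharZero F]
    (p f : ℕ) [Fact p.Prime] (hp : p ≠ 2) [CharP 𝓀[F] p] (hq : Nat.card 𝓀[F] = p ^ f)
    (ϖ : {x : 𝒪[F] // Irreducible x})
    {E : Type*} [Field E] [IsAlgClosed E] [CharP E p] (ι : 𝓀[F] →+* E)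
    {W : Type*} [AddCommGroup W] [Module E W] (ρ : Representation E (MetaplecticSL2.Mp F) W)
    (hsmooth : MetaplecticSL2.IsSmooth ρ) (hgenuine : MetaplecticSL2.IsGenuine ρ)
    (hirr : ρ.IsIrreducible) (hadm : MetaplecticSL2.IsAdmissible ρ) :
    (∃ (r : Fin f → Fin p) (lam : E),
      MetaplecticSL2.IsQuotientOf ρ (MetaplecticSL2.cokerModule ι ϖ r lam)) ∧
    (∃ (s : Fin f → Fin p) (lam : E),
      MetaplecticSL2.IsQuotientOf ρ (MetaplecticSL2.cokerModule' ι ϖ s lam)) := by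
  open MetaplecticSL2 in
  constructor
  · have := hadm.finite_congruenceFixed 1
    exact exists_parameter ι ϖ hq hsmooth.exists_congruence hgenuine hirr
  · -- a parameter with respect to `K̃` of the twist of `ρ` by conjugation with `α̃`
    let c := conjAlpha ϖ
    let ρ' : Representation E (Mp F) W := ρ.comp c.toMonoidHom
    have hρ' : ∀ g, ρ' g = ρ (c g) := fun _ => rfl
    have hle : congruenceFixed ρ' 1 ≤ congruenceFixed ρ 2 := by
      intro w hw k' hk'
      obtain ⟨k, hk, hkk'⟩ := exists_eq_conjAlpha_split ϖ (n := 0) hk'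
      rw [← hkk']
      exact hw k hk
    have := hadm.finite_congruenceFixed 2
    have : Module.Finite E (congruenceFixed ρ' 1) := Submodule.finiteDimensional_of_le hle
    obtain ⟨s, lam, h⟩ := exists_parameter (ρ := ρ') ι ϖ hq (by
      intro v
      obtain ⟨n, hn⟩ := hsmooth.exists_congruence v
      refine ⟨n + 2, fun k hk => ?_⟩
      obtain ⟨k', hk', hkk'⟩ := exists_conjAlpha_split_eq ϖ hk
      rw [hρ', hkk']
      exact hn k' (congruence_antitone (Nat.le_succ n) hk')) (by
      intro ζ v
      rw [hρ', conjAlpha_central, hgenuine]) (isIrreducible_comp c hirr)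
    exact ⟨s, lam, h.conj c⟩
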